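/- Let $N$ be a connected (Hausdorff, second countable, boundaryless, smooth) manifold of dimension $2n$ with a symplectic form $\omega$ (smooth, closed, nondegenerate) and a continuous Riemannian metric, and let $1\le r\le\infty$. A $C^r$ symplectic diffeomorphism $f$ of $N$ is called \emph{integrable} if there is a locally finite family of pairwise disjoint open sets $N_i\subset N$ such that (a) $\bigcup_i N_i$ is dense in $N$, and its complement is contained in a countable union of embedded (not necessarily closed) $C^1$ submanifolds of codimension one; (b) for each $i$ there is a smooth symplectic diffeomorphism $h_i:N_i\to D_i\times\mathbb T^n$, where $D_i\subset\mathbb R^n$ is an open set diffeomorphic to the cube $(0,1)^n$, $\mathbb T^n=\mathbb R^n/\mathbb Z^n$, and $D_i\times\mathbb T^n$ carries the form $\sum_j dI_j\wedge d\theta_j$; (c) for each $i$, $f$ maps every torus $h_i^{-1}(\{I\}\times\mathbb T^n)$ to itself and acts on it as a rotation $\theta\mapsto\theta+\omega_I$, and the map $D_i\ni I\mapsto\omega_I\in\mathbb T^n$ is a local diffeomorphism (of class $C^r$). For maps $g_1,g_2:N\to N$, an orbit of $x$ under the iterated function system $\mathcal G(g_1,g_2)$ is a sequence $\big(g_{\sigma_k}\circ\cdots\circ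 g_{\sigma_1}(x)\big)_{k\ge1}$ with $(\sigma_i)_{i\ge1}\in\{1,2\}^{\mathbb N}$, and the $\mathcal G$-orbit of $x$ is the set of all points that lie on some orbit of $x$. \textbf{Proposition.} Let $T_1$ be an integrable $C^r$ symplectic diffeomorphism of $N$. In every neighbourhood of $T_1$ in the strong (Whitney) $C^r$ topology there is an integrable $C^r$ symplectic diffeomorphism $T_2$, of the form $T_2=\varphi\circ T_1\circ\varphi^{-1}$ with $\varphi$ a $C^\infty$ symplectic diffeomorphism of $N$, such that for all nonzero integers $d,d'$: (1) the iterated function system $\mathcal G(T_1^{d},T_2^{d'})$ has a dense orbit, i.e. there are a point $x$ and a sequence $\sigma$ whose orbit is dense in $N$; (2) Lebesgue-almost every point of $N$ has a dense $\mathcal G(T_1^{d},T_2^{d'})$-orbit. Moreover $T_2$ can be chosen so that for every $\delta\in\mathbb R$: if $T_1$ satisfies the bunching condition $\limsup_{k\to\infty}\frac1k\log\sup_{x\in N}\frac{\|D_xT_1^k\|}{m(D_xT_1^k)}<\delta$, where $m(A)=\min_{\|v\|=1}\|Av\|$, then so does $T_2$. -/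

import Mathlib

open Set Filter Topology MeasureTheory
open scoped Manifold ContDiff

noncomputable section

namespace SymplecticIFS

/-- Euclidean space of dimension `m`. -/
abbrev Euc (m : ℕ) : Type := EuclideanSpace ℝ (Fin m)

/-! ### Iterated function systems -/

/-- The point reached after `k` steps from `x` when the branch `σ` is followed:
`g (σ (k-1)) ∘ ⋯ ∘ g (σ 0)` applied to `x`. -/
def branch {ι X : Type*} (g : ι → X → X) (σ : ℕ → ι) (x : X) : ℕ → X
  | 0 => x
  | k + 1 => g (σ k) (branch g σ x k)

/-- The orbit of `x` along the branch `σ`, as a set of points (at least one map is applied). -/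
def branchOrbit {ι X : Type*} (g : ι → X → X) (σ : ℕ → ι) (x : X) : Set X :=
  range fun k : ℕ => branch g σ x (k + 1)

/-- The orbit of `x` under the iterated function system generated by `g`:
all the points that lie on some orbit of `x`. -/
def ifsOrbit {ι X : Type*} (g : ι → X → X) (x : X) : Set X :=
  ⋃ σ : ℕ → ι, branchOrbit g σ x

/-! ### Notions on a smooth manifold without boundary of dimension `m` -/

section Manifold

variable {m : ℕ} {N : Type*} [TopologicalSpace N] [ChartedSpace (Euc m) N]

/-- Lebesgue null sets of a manifold: null in every smooth chart. -/
def IsLebesgueNull (A : Set N) : Prop :=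
  ∀ e ∈ IsManifold.maximalAtlas (𝓡 m) ∞ N, volume (e '' (A ∩ e.source)) = 0

/-- Embedded (not necessarily closed) submanifolds of codimension one and class `C¹`:
near each of its points the set is the zero set of a `C¹` function without critical points. -/
def IsHypersurface (L : Set N) : Prop :=
  ∀ p ∈ L, ∃ (V : Set N) (u : N → ℝ), IsOpen V ∧ p ∈ V ∧
    ContMDiffOn (𝓡 m) 𝓘(ℝ, ℝ) 1 u V ∧
    (∀ q ∈ V, mfderiv (𝓡 m) 𝓘(ℝ, ℝ) u q ≠ 0) ∧
    L ∩ V = {q ∈ V | u q = 0}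

/-- Data of a basic neighbourhood in the strong (Whitney) `C^r` topology: a locally finite
sequence of compact sets `K k` (possibly empty), smooth charts around `K k` in the source and
smooth charts `d k` in the target, positive numbers `ε k`, and a finite order `s ≤ r`. -/
structure StrongNhdData (m : ℕ) (N : Type*) [TopologicalSpace N] [ChartedSpace (Euc m) N]
    (r : ℕ∞) where
  K : ℕ → Set N
  c : ℕ → OpenPartialHomeomorph N (Euc m)
  d : ℕ → OpenPartialHomeomorph N (Euc m)
  ε : ℕ → ℝ
  s : ℕ
  isCompact_K : ∀ k, IsCompact (K k)
  locallyFinite_K : LocallyFinite K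
  c_mem : ∀ k, c k ∈ IsManifold.maximalAtlas (𝓡 m) ∞ N
  d_mem : ∀ k, d k ∈ IsManifold.maximalAtlas (𝓡 m) ∞ N
  K_subset : ∀ k, K k ⊆ (c k).source
  ε_pos : ∀ k, 0 < ε k
  s_le : (s : ℕ∞) ≤ r

/-- The data `W` describes a neighbourhood of the map `f`. -/
def StrongNhdData.IsAt {r : ℕ∞} (W : StrongNhdData m N r) (f : N → N) : Prop :=
  ∀ k, MapsTo f (W.K k) (W.d k).source

/-- The map `g` lies in the basic neighbourhood of `f` described by `W`: on each `K k`, in the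
given charts, the derivatives of `g` and `f` up to order `s` differ by less than `ε k`. -/
def StrongNhdData.Contains {r : ℕ∞} (W : StrongNhdData m N r) (f g : N → N) : Prop :=
  ∀ k, MapsTo g (W.K k) (W.d k).source ∧
    ∀ j ≤ W.s, ∀ x ∈ W.K k,
      ‖iteratedFDeriv ℝ j (W.d k ∘ g ∘ (W.c k).symm) (W.c k x)
        - iteratedFDeriv ℝ j (W.d k ∘ f ∘ (W.c k).symm) (W.c k x)‖ < W.ε k

/-- The length of a tangent vector in a continuous Riemannian metric. -/
def tangentLength [IsManifold (𝓡 m) ∞ N]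
    (g : Bundle.ContinuousRiemannianMetric (Euc m) (fun x : N => TangentSpace (𝓡 m) x))
    (x : N) (v : TangentSpace (𝓡 m) x) : ℝ :=
  Real.sqrt (g.inner x v v)

/-- The bunching condition with threshold `δ`:
`limsup_k (1/k) log (sup_x ‖D_x f^k‖ / m(D_x f^k)) < δ`, where `m(A)` is the minimum of `‖A v‖` over
unit vectors `v`. The inequality `‖A‖ / m(A) ≤ exp (c k)` is written out as
`‖A u‖ ≤ exp (c k) ‖A v‖` for all unit vectors `u` and `v`. -/
def IsBunched [IsManifold (𝓡 m) ∞ N]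
    (g : Bundle.ContinuousRiemannianMetric (Euc m) (fun x : N => TangentSpace (𝓡 m) x))
    (δ : ℝ) (f : N → N) : Prop :=
  ∃ c < δ, ∀ᶠ k : ℕ in atTop, ∀ (x : N) (u v : TangentSpace (𝓡 m) x),
    tangentLength g x u = 1 → tangentLength g x v = 1 →
      tangentLength g (f^[k] x) (mfderiv (𝓡 m) (𝓡 m) (f^[k]) x u) ≤
        Real.exp (c * k) * tangentLength g (f^[k] x) (mfderiv (𝓡 m) (𝓡 m) (f^[k]) x v)

/-- The expression in the chart `e` of a field of alternating 2-forms: its pullback by `e⁻¹`. -/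
def localForm (Ω : ∀ x : N, TangentSpace (𝓡 m) x [⋀^Fin 2]→L[ℝ] ℝ)
    (e : OpenPartialHomeomorph N (Euc m)) (y : Euc m) : Euc m [⋀^Fin 2]→L[ℝ] ℝ :=
  (Ω (e.symm y)).compContinuousLinearMap
    (mfderiv (𝓡 m) (𝓡 m) e.symm y : Euc m →L[ℝ] TangentSpace (𝓡 m) (e.symm y))

end Manifold

/-! ### Symplectic manifolds and integrable diffeomorphisms -/

/-- A symplectic form: a smooth closed nondegenerate differential 2-form. Smoothness and
closedness are expressed in the smooth charts of the manifold. -/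
structure SymplecticForm (n : ℕ) (N : Type*) [TopologicalSpace N]
    [ChartedSpace (Euc (2 * n)) N] where
  form : ∀ x : N, TangentSpace (𝓡 (2 * n)) x [⋀^Fin 2]→L[ℝ] ℝ
  smooth : ∀ e ∈ IsManifold.maximalAtlas (𝓡 (2 * n)) ∞ N,
    ContDiffOn ℝ ∞ (localForm form e) e.target
  closed : ∀ e ∈ IsManifold.maximalAtlas (𝓡 (2 * n)) ∞ N,
    ∀ y ∈ e.target, extDeriv (localForm form e) y = 0
  nondegenerate : ∀ (x : N) (u : TangentSpace (𝓡 (2 * n)) x),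
    (∀ v : TangentSpace (𝓡 (2 * n)) x, form x ![u, v] = 0) → u = 0

section Symplectic

variable {n : ℕ} {N : Type*} [TopologicalSpace N] [ChartedSpace (Euc (2 * n)) N]

/-- The differentiable map `f` preserves the symplectic form. -/
def IsSymplectic (Ω : SymplecticForm n N) (f : N → N) : Prop :=
  ∀ (x : N) (u v : TangentSpace (𝓡 (2 * n)) x),
    Ω.form (f x) ![mfderiv (𝓡 (2 * n)) (𝓡 (2 * n)) f x u,
      mfderiv (𝓡 (2 * n)) (𝓡 (2 * n)) f x v] = Ω.form x ![u, v]

/-- The open cube `(0,1)ⁿ`. -/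
def openCube (n : ℕ) : Set (Euc n) := {x | ∀ j, x j ∈ Ioo (0 : ℝ) 1}

/-- The set `D` is open and diffeomorphic to the open cube. -/
def IsDiffeomorphicToCube {n : ℕ} (D : Set (Euc n)) : Prop :=
  ∃ e : OpenPartialHomeomorph (Euc n) (Euc n), e.source = openCube n ∧ e.target = D ∧
    ContDiffOn ℝ ∞ e e.source ∧ ContDiffOn ℝ ∞ e.symm e.target

/-- Action-angle coordinates: a symplectic diffeomorphism `h` from an open set `carrier` of `N` onto
`D × 𝕋ⁿ`, where `D ⊆ ℝⁿ` is diffeomorphic to the cube, `𝕋ⁿ = ℝⁿ / ℤⁿ`, and `D × 𝕋ⁿ` carries the form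
`∑ j, dI_j ∧ dθ_j`. It is given by its inverse `param = h⁻¹`, lifted to `D × ℝⁿ`: a smooth map,
injective exactly up to `ℤⁿ`-translations of `θ`, which pulls the symplectic form back to the
standard one (so that it is a local diffeomorphism). -/
structure ActionAngle (Ω : SymplecticForm n N) where
  carrier : Set N
  D : Set (Euc n)
  param : Euc n × Euc n → N
  isOpen_carrier : IsOpen carrier
  D_cube : IsDiffeomorphicToCube D
  smooth : ContMDiffOn 𝓘(ℝ, Euc n × Euc n) (𝓡 (2 * n)) ∞ param (D ×ˢ univ)
  image_eq : param '' (D ×ˢ univ) = carrier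
  param_eq_iff : ∀ I ∈ D, ∀ I' ∈ D, ∀ θ θ' : Euc n,
    param (I, θ) = param (I', θ') ↔ I = I' ∧ ∀ j, ∃ k : ℤ, θ' j - θ j = k
  symplectic : ∀ I ∈ D, ∀ θ : Euc n, ∀ u v : Euc n × Euc n,
    Ω.form (param (I, θ))
      ![(mfderiv 𝓘(ℝ, Euc n × Euc n) (𝓡 (2 * n)) param (I, θ) :
          Euc n × Euc n →L[ℝ] TangentSpace (𝓡 (2 * n)) (param (I, θ))) u,
        (mfderiv 𝓘(ℝ, Euc n × Euc n) (𝓡 (2 * n)) param (I, θ) :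
          Euc n × Euc n →L[ℝ] TangentSpace (𝓡 (2 * n)) (param (I, θ))) v]
      = ∑ j, (u.1 j * v.2 j - v.1 j * u.2 j)

/-- On the tori of the action-angle coordinates `A` the map `f` acts by rotations, and the rotation
vector `x ↦ ω_x ∈ 𝕋ⁿ` (here lifted to `ℝⁿ`) is a local diffeomorphism of class `C^r`. -/
def ActionAngle.IsRotatedBy {Ω : SymplecticForm n N} (A : ActionAngle Ω) (r : ℕ∞) (f : N → N) :
    Prop :=
  ∃ α : Euc n → Euc n, IsLocalDiffeomorphOn 𝓘(ℝ, Euc n) 𝓘(ℝ, Euc n) r α A.D ∧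
    ∀ I ∈ A.D, ∀ θ : Euc n, f (A.param (I, θ)) = A.param (I, θ + α I)

/-- Integrable maps (of class `C^r`) of a symplectic manifold: the closure of a locally finite
union of disjoint open sets with action-angle coordinates is the whole manifold, the map is a
rotation on each of the corresponding tori, with rotation vector depending on the torus in a
locally diffeomorphic way, and the complement of the union is contained in a countable union of
codimension one submanifolds. -/
def IsIntegrable (Ω : SymplecticForm n N) (r : ℕ∞) (f : N → N) : Prop :=
  ∃ (ι : Type) (A : ι → ActionAngle Ω),
    closure (⋃ i, (A i).carrier) = univ ∧
    (∀ i j, i ≠ j → Disjoint (A i).carrier (A j).carrier) ∧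
    (∀ C : Set N, IsCompact C → {i | ((A i).carrier ∩ C).Nonempty}.Finite) ∧
    (∀ i, (A i).IsRotatedBy r f) ∧
    ∃ L : ℕ → Set N, (∀ k, IsHypersurface (m := 2 * n) (L k)) ∧
      (⋃ i, (A i).carrier)ᶜ ⊆ ⋃ k, L k

end Symplectic

end SymplecticIFS

end

/-! Write `T` for `T₁` and seek `φ` near the identity with `T₂ = φ ∘ T ∘ φ⁻¹`. For a nonempty open
`V`, let `Q` be the set of points whose orbits meet `V` (`hitting`). It is open and contains its
preimage under each generator. In action-angle coordinates `T ^ d` rotates the torus of action `I`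
by `d • α I`. Since `α` is a local diffeomorphism, for almost every `I` the positive multiples of
this vector are dense modulo `ℤⁿ`, and such a torus lies in `Q` as soon as it meets `Q`. By Fubini,
the largest open set `O` in which `Q` has full measure (`conullInterior`) is a union of tori in
every domain. The same argument for `T₂` shows that `φ⁻¹(O)` is a union of tori too
(`ActionAngle.conullInterior_saturated`).

The rest is topology (`carrier_subset_of_saturated`). The frontier `X` of `O` has empty interior,
and `X` and `φ⁻¹(X)` are unions of tori inside the domains. Suppose that `φ` sends every torus to a
set whose actions, in some domain, fill an open set (`IsGood`). Then no torus lies in `φ⁻¹(X)`, for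
otherwise `X` would contain an open set of tori. If moreover every torus meets the image of some
domain under `φ`, then `X` misses all the domains. Each connected domain is thus inside `O` or away
from its closure. If `φ` maps some point of each domain into that domain, and some point of every
nonempty intersection of two closures into a domain, then being inside `O` propagates between
domains with meeting closures. Local finiteness and connectedness of `N` put every domain in `O`.
What is left lies in hypersurfaces, so `Q` has full measure. Intersecting over a countable basis
gives the almost-everywhere statement; a Baire argument in the product of `N` with the space of
sequences gives one dense orbit (`exists_dense_branchOrbit`).

The conjugacy is `φ = a⁻¹ ∘ ψ ∘ c`. The factor `ψ` moves chosen points of intersections of closures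
into domains (`exists_crossing`). The factors `a` and `c` preserve every domain, fix all points
outside the domains, and make all tori good for `ψ⁻¹ ∘ a` and for `a⁻¹ ∘ ψ ∘ c` (`exists_twist`). To
make tori good, one translates and shears by `s` near a point of the torus: the derivative of the
resulting map from angles to actions has a determinant polynomial in `s`, and this polynomial is
nonzero because level sets of the actions are Lagrangian (`twistPolynomial_ne_zero`). The bad
parameters thus form a countable union of hypersurface pieces. As the tori form an `n`-parameter
family, `n + 1` independent perturbations at disjoint places suffice to make at least one of them
work for every torus (`dense_avoid_thin`).

All perturbations are time-one maps of compactly supported Hamiltonians in charts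
(`exists_sympFamily`). Infinitely many with disjoint supports are glued (`exists_glue`); where the
supports accumulate the result stays smooth because the displacements decrease fast in all `C^k`
norms. Closeness to the identity in the strong topology survives products and conjugation
(`exists_strongNhd_conj`). Each factor and its inverse distorts lengths by at most `2`, so `φ` and
`φ⁻¹` do so by at most `8`, which preserves the bunching condition. -/

noncomputable section
namespace SymplecticIFS

/-! ### Smooth dependence of flows on parameters and initial points -/

section Path

set_option linter.unusedSectionVars false
variable {E F G : Type} [NormedAddCommGroup E] [NormedSpace ℝ E] [NormedAddCommGroup F]
  [NormedSpace ℝ F]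

/-- Pointwise application of a path of linear maps to a path of vectors, as a bilinear map. -/
def pathApplyₗ :
    C(unitInterval, E →L[ℝ] F) →ₗ[ℝ] C(unitInterval, E) →ₗ[ℝ] C(unitInterval, F) :=
  LinearMap.mk₂ ℝ (fun (T : C(unitInterval, E →L[ℝ] F)) (γ : C(unitInterval, E)) =>
      (⟨fun s => T s (γ s), by fun_prop⟩ : C(unitInterval, F)))
    (fun _ _ _ => by ext; simp) (fun _ _ _ => by ext; simp)
    (fun _ _ _ => by ext; simp) (fun _ _ _ => by ext; simp)

lemma norm_pathApplyₗ_le (T : C(unitInterval, E →L[ℝ] F)) (γ : C(unitInterval, E)) :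
    ‖pathApplyₗ T γ‖ ≤ 1 * ‖T‖ * ‖γ‖ := by
  rw [ContinuousMap.norm_le _ (by positivity)]
  intro s
  rw [one_mul]
  exact (T s).le_of_opNorm_le_of_le (T.norm_coe_le_norm s) (γ.norm_coe_le_norm s)

/-- Pointwise application of a path of linear maps to a path of vectors. -/
def pathApply : C(unitInterval, E →L[ℝ] F) →L[ℝ] C(unitInterval, E) →L[ℝ] C(unitInterval, F) :=
  LinearMap.mkContinuous₂ (𝕜 := ℝ) (𝕜₂ := ℝ) (𝕜₃ := ℝ) (E := C(unitInterval, E →L[ℝ] F))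
    (F := C(unitInterval, E)) (G := C(unitInterval, F)) (σ₂₃ := RingHom.id ℝ)
    (σ₁₃ := RingHom.id ℝ) pathApplyₗ 1 norm_pathApplyₗ_le

@[simp] lemma pathApply_apply (T : C(unitInterval, E →L[ℝ] F)) (γ : C(unitInterval, E))
    (s : unitInterval) : pathApply T γ s = T s (γ s) := rfl

/-- Composition of paths with a continuous map. -/
def pathComp (f : E → F) (hf : Continuous f) (γ : C(unitInterval, E)) : C(unitInterval, F) :=
  ⟨fun s => f (γ s), by fun_prop⟩

@[simp] lemma pathComp_apply (f : E → F) (hf : Continuous f) (γ : C(unitInterval, E))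
    (s : unitInterval) : pathComp f hf γ s = f (γ s) := rfl

/-- Compact support makes `fderiv ℝ f` uniformly continuous, so the mean value inequality bounds the
remainder with one radius valid at all times of the path. This uniformity is what differentiability
in the sup norm requires. -/
lemma hasFDerivAt_pathComp {f : E → F} (hf : ContDiff ℝ 1 f) (hs : HasCompactSupport f)
    (γ : C(unitInterval, E)) :
    HasFDerivAt (pathComp f hf.continuous)
      (pathApply (pathComp (fderiv ℝ f) (hf.continuous_fderiv one_ne_zero) γ)) γ := by
  have hc : Continuous (fderiv ℝ f) := hf.continuous_fderiv one_ne_zero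
  have hu : UniformContinuous (fderiv ℝ f) :=
    (hs.fderiv ℝ).uniformContinuous_of_continuous hc
  rw [hasFDerivAt_iff_isLittleO_nhds_zero, Asymptotics.isLittleO_iff]
  intro ε hε
  obtain ⟨δ, hδ, hδ'⟩ := Metric.uniformContinuous_iff.1 hu ε hε
  filter_upwards [Metric.ball_mem_nhds (0 : C(unitInterval, E)) hδ] with h hh
  rw [ContinuousMap.norm_le _ (by positivity)]
  intro s
  have hhs : ‖h s‖ ≤ ‖h‖ := h.norm_coe_le_norm s
  have hlt : ‖h‖ < δ := by simpa using hh
  have key := (convex_ball (γ s) δ).norm_image_sub_le_of_norm_hasFDerivWithin_le'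
    (f := f) (f' := fderiv ℝ f) (φ := fderiv ℝ f (γ s)) (C := ε)
    (x := γ s) (y := γ s + h s)
    (fun x _ => ((hf.differentiable one_ne_zero) x).hasFDerivAt.hasFDerivWithinAt)
    (fun x hx => by
      rw [← dist_eq_norm]; exact (hδ' (by simpa using hx)).le)
    (Metric.mem_ball_self hδ) (by simpa using hhs.trans_lt hlt)
  simp only [ContinuousMap.sub_apply, pathComp_apply, ContinuousMap.add_apply, pathApply_apply]
  simp only [add_sub_cancel_left] at key
  exact key.trans (by gcongr)

/-- The derivative of a composition operator is again a composition operator, with `fderiv ℝ f` in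
place of `f`, followed by a bounded linear map. The induction therefore has to quantify over the
target space. -/
lemma contDiff_pathComp_nat (n : ℕ) : ∀ {F : Type} [NormedAddCommGroup F] [NormedSpace ℝ F]
    {f : E → F} (hf : ContDiff ℝ ∞ f), HasCompactSupport f →
    ContDiff ℝ n (pathComp f hf.continuous) := by
  induction n with
  | zero =>
    intro F _ _ f hf hs
    exact contDiff_zero.2 (continuous_iff_continuousAt.2 fun γ =>
      (hasFDerivAt_pathComp (hf.of_le (by simp)) hs γ).continuousAt)
  | succ n ih =>
    intro F _ _ f hf hs
    refine contDiff_succ_iff_hasFDerivAt.2 ⟨_, ?_, fun γ =>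
      hasFDerivAt_pathComp (hf.of_le (by simp)) hs γ⟩
    have h1 : ContDiff ℝ ∞ (fderiv ℝ f) := hf.fderiv_right (by simp)
    have h2 : ContDiff ℝ n (pathApply (E := E) (F := F)) := ContinuousLinearMap.contDiff _
    exact h2.comp (ih h1 (hs.fderiv ℝ))

lemma contDiff_pathComp {f : E → F} (hf : ContDiff ℝ ∞ f) (hs : HasCompactSupport f) :
    ContDiff ℝ ∞ (pathComp f hf.continuous) :=
  contDiff_infty.2 fun n => contDiff_pathComp_nat n hf hs

/-- The primitive of a path, vanishing at `0`, as a linear map. -/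
def pathIntegralₗ : C(unitInterval, E) →ₗ[ℝ] C(unitInterval, E) where
  toFun γ := ⟨fun s => ∫ τ in (0 : ℝ)..s, IccExtend zero_le_one γ τ, by
    have : Continuous (IccExtend (zero_le_one (α := ℝ)) γ) := γ.continuous.Icc_extend'
    exact (intervalIntegral.continuous_primitive
      (fun a b => this.intervalIntegrable a b) 0).comp continuous_subtype_val⟩
  map_add' γ η := by
    ext s
    have h1 : Continuous (IccExtend (zero_le_one (α := ℝ)) γ) := γ.continuous.Icc_extend'
    have h2 : Continuous (IccExtend (zero_le_one (α := ℝ)) η) := η.continuous.Icc_extend'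
    simp only [ContinuousMap.coe_mk, ContinuousMap.add_apply]
    rw [← intervalIntegral.integral_add (h1.intervalIntegrable _ _) (h2.intervalIntegrable _ _)]
    rfl
  map_smul' c γ := by
    ext s
    simp only [ContinuousMap.coe_mk, ContinuousMap.smul_apply, RingHom.id_apply]
    rw [← intervalIntegral.integral_smul]
    rfl

lemma norm_pathIntegralₗ_le (γ : C(unitInterval, E)) : ‖pathIntegralₗ γ‖ ≤ 1 * ‖γ‖ := by
  rw [ContinuousMap.norm_le _ (by positivity)]
  intro s
  have := intervalIntegral.norm_integral_le_of_norm_le_const (a := 0) (b := (s : ℝ))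
    (f := IccExtend zero_le_one γ) (C := ‖γ‖) (fun x _ => γ.norm_coe_le_norm _)
  refine this.trans ?_
  rw [one_mul, sub_zero, abs_of_nonneg s.2.1]
  exact mul_le_of_le_one_right (norm_nonneg _) s.2.2

/-- The primitive of a path, vanishing at `0`. -/
def pathIntegral : C(unitInterval, E) →L[ℝ] C(unitInterval, E) :=
  pathIntegralₗ.mkContinuous 1 norm_pathIntegralₗ_le

lemma pathIntegral_apply (γ : C(unitInterval, E)) (s : unitInterval) :
    pathIntegral γ s = ∫ τ in (0 : ℝ)..s, IccExtend zero_le_one γ τ := rfl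

lemma norm_pathIntegral_le (γ : C(unitInterval, E)) : ‖pathIntegral γ‖ ≤ ‖γ‖ :=
  (norm_pathIntegralₗ_le γ).trans_eq (one_mul _)

lemma norm_pathApply_le (T : C(unitInterval, E →L[ℝ] F)) (γ : C(unitInterval, E)) :
    ‖pathApply T γ‖ ≤ ‖T‖ * ‖γ‖ :=
  (norm_pathApplyₗ_le T γ).trans_eq (by rw [one_mul])

/-- Constant paths. -/
def pathConst : E →L[ℝ] C(unitInterval, E) := ContinuousLinearMap.const ℝ unitInterval

@[simp] lemma pathConst_apply (x : E) (s : unitInterval) : pathConst x s = x := rfl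

lemma norm_pathConst_le (x : E) : ‖pathConst x‖ ≤ ‖x‖ := by
  rw [ContinuousMap.norm_le _ (by positivity)]; intro s; rfl

end Path
end SymplecticIFS
end

/-! ### Time-one maps via the implicit function theorem in path space -/

noncomputable section
namespace SymplecticIFS

section Flow

set_option linter.unusedSectionVars false

variable {E P : Type} [NormedAddCommGroup E] [NormedSpace ℝ E] [CompleteSpace E]
  [NormedAddCommGroup P] [NormedSpace ℝ P] [CompleteSpace P]

/-- The defect of a path `γ` as a solution of `γ' = V(γ) p`, `γ 0 = x`, in integrated form. -/
def flowDefect (V : E → P →L[ℝ] E) (hV : Continuous V) (u : (P × E) × C(unitInterval, E)) :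
    C(unitInterval, E) :=
  u.2 - pathConst u.1.2 - pathIntegral (pathApply (pathComp V hV u.2) (pathConst u.1.1))

lemma contDiff_flowDefect {V : E → P →L[ℝ] E} (hV : ContDiff ℝ ∞ V) (hs : HasCompactSupport V) :
    ContDiff ℝ ∞ (flowDefect V hV.continuous) := by
  have h0 := contDiff_pathComp hV hs
  have h1 : ContDiff ℝ ∞ (pathApply (E := P) (F := E)) := ContinuousLinearMap.contDiff _
  have h2 : ContDiff ℝ ∞ (pathIntegral (E := E)) := ContinuousLinearMap.contDiff _
  have h3 : ContDiff ℝ ∞ (pathConst (E := E)) := ContinuousLinearMap.contDiff _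
  have h4 : ContDiff ℝ ∞ (pathConst (E := P)) := ContinuousLinearMap.contDiff _
  unfold flowDefect
  refine (contDiff_snd.sub (h3.comp (contDiff_snd.comp contDiff_fst))).sub (h2.comp ?_)
  exact (h1.comp (h0.comp contDiff_snd)).clm_apply (h4.comp (contDiff_fst.comp contDiff_fst))

/-- The field is linear in the parameter `p`, so the integral term is Lipschitz in the path with
constant `‖p‖ * K`; small parameters replace short times. -/
lemma flowDefect_contracting {V : E → P →L[ℝ] E} (hV : Continuous V) {K : ℝ}
    (hK : ∀ x y, ‖V x - V y‖ ≤ K * ‖x - y‖) (hK0 : 0 < K) (z : P × E) (hz : ‖z.1‖ * K ≤ 1 / 2)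
    (γ η : C(unitInterval, E)) :
    ‖(flowDefect V hV (z, γ) - γ) - (flowDefect V hV (z, η) - η)‖ ≤ 1 / 2 * ‖γ - η‖ := by
  have e : (flowDefect V hV (z, γ) - γ) - (flowDefect V hV (z, η) - η) =
      - pathIntegral (pathApply (pathComp V hV γ - pathComp V hV η) (pathConst z.1)) := by
    simp only [flowDefect, map_sub, sub_apply]; abel
  rw [e, norm_neg]
  have h1 : ‖pathComp V hV γ - pathComp V hV η‖ ≤ K * ‖γ - η‖ := by
    rw [ContinuousMap.norm_le _ (by positivity)]
    intro s
    exact (hK _ _).trans (mul_le_mul_of_nonneg_left ((γ - η).norm_coe_le_norm s) hK0.le)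
  calc _ ≤ _ := norm_pathIntegral_le _
    _ ≤ ‖pathComp V hV γ - pathComp V hV η‖ * ‖pathConst (z.1)‖ := norm_pathApply_le _ _
    _ ≤ (K * ‖γ - η‖) * ‖z.1‖ := by
      gcongr; exact norm_pathConst_le _
    _ = (‖z.1‖ * K) * ‖γ - η‖ := by ring
    _ ≤ _ := by gcongr

lemma existsUnique_flowDefect {V : E → P →L[ℝ] E} (hV : Continuous V) {K : ℝ}
    (hK : ∀ x y, ‖V x - V y‖ ≤ K * ‖x - y‖) (hK0 : 0 < K) (z : P × E)
    (hz : ‖z.1‖ * K ≤ 1 / 2) : ∃! γ, flowDefect V hV (z, γ) = 0 := by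
  have hc : ContractingWith (1 / 2) (fun γ => γ - flowDefect V hV (z, γ)) := by
    refine ⟨by norm_num, LipschitzWith.of_dist_le_mul fun γ η => ?_⟩
    rw [dist_eq_norm, dist_eq_norm, ← norm_neg]
    have := flowDefect_contracting hV hK hK0 z hz γ η
    simp only [NNReal.coe_div, NNReal.coe_one, NNReal.coe_ofNat]
    convert! this using 2
    abel
  refine ⟨hc.fixedPoint, ?_, fun η hη => hc.fixedPoint_unique ?_⟩
  · have := hc.fixedPoint_isFixedPt
    simpa [Function.IsFixedPt] using this
  · change η - flowDefect V hV (z, η) = η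
    rw [hη, sub_zero]

/-- The contraction estimate passes to the derivative: the partial derivative in the path differs
from the identity by norm at most `1 / 2`, and a Neumann series inverts it. -/
lemma isInvertible_fderiv_flowDefect {V : E → P →L[ℝ] E} (hV : ContDiff ℝ ∞ V)
    (hs : HasCompactSupport V) {K : ℝ} (hK : ∀ x y, ‖V x - V y‖ ≤ K * ‖x - y‖) (hK0 : 0 < K)
    (u : (P × E) × C(unitInterval, E)) (hz : ‖u.1.1‖ * K ≤ 1 / 2) :
    (fderiv ℝ (flowDefect V hV.continuous) u ∘L
      .inr ℝ (P × E) C(unitInterval, E)).IsInvertible := by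
  set A := fderiv ℝ (flowDefect V hV.continuous) u ∘L .inr ℝ (P × E) C(unitInterval, E)
  have hA : HasFDerivAt (fun γ => flowDefect V hV.continuous (u.1, γ)) A u.2 :=
    HasFDerivAt.comp (g := flowDefect V hV.continuous) u.2
      (((contDiff_flowDefect hV hs).differentiable (by simp)) u).hasFDerivAt
      (hasFDerivAt_prodMk_right u.1 u.2)
  have hB : HasFDerivAt (fun γ => γ - flowDefect V hV.continuous (u.1, γ)) (1 - A) u.2 :=
    (hasFDerivAt_id _).sub hA
  have hn : ‖1 - A‖ ≤ 1 / 2 := by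
    refine hB.le_of_lip' (by norm_num) (Eventually.of_forall fun γ => ?_)
    rw [← norm_neg]
    convert! flowDefect_contracting hV.continuous hK hK0 u.1 hz γ u.2 using 2
    abel
  have hu : IsUnit A := by
    have := isUnit_one_sub_of_norm_lt_one (R := C(unitInterval, E) →L[ℝ] C(unitInterval, E))
      (x := 1 - A) (lt_of_le_of_lt hn (by norm_num))
    rwa [sub_sub_cancel] at this
  obtain ⟨w, hw⟩ := hu
  exact ⟨ContinuousLinearEquiv.unitsEquiv ℝ _ w, by rw [← hw]; rfl⟩

lemma flowDefect_eq_zero_iff {V : E → P →L[ℝ] E} (hV : Continuous V) (z : P × E)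
    (γ : C(unitInterval, E)) : flowDefect V hV (z, γ) = 0 ↔
      ∀ s : unitInterval, γ s = z.2 + ∫ τ in (0 : ℝ)..s, V (IccExtend zero_le_one γ τ) z.1 := by
  rw [ContinuousMap.ext_iff]
  refine forall_congr' fun s => ?_
  simp only [flowDefect, ContinuousMap.sub_apply, pathConst_apply, pathIntegral_apply,
    ContinuousMap.zero_apply]
  rw [sub_sub, sub_eq_zero]
  rfl

/-- Curves solving the differential equation solve the integral equation. -/
lemma flowDefect_of_hasDerivAt {V : E → P →L[ℝ] E} (hV : Continuous V) {p : P} {c : ℝ → E}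
    (hc : ∀ t ∈ Icc (0 : ℝ) 1, HasDerivAt c (V (c t) p) t) :
    ∃ γ : C(unitInterval, E), (∀ s, γ s = c s) ∧ flowDefect V hV ((p, c 0), γ) = 0 := by
  have hcc : ContinuousOn c (Icc 0 1) := fun t ht => (hc t ht).continuousAt.continuousWithinAt
  refine ⟨⟨fun s => c s, hcc.comp_continuous continuous_subtype_val fun s => s.2⟩,
    fun s => rfl, (flowDefect_eq_zero_iff hV _ _).2 fun s => ?_⟩
  have hsub : uIcc (0 : ℝ) s ⊆ Icc 0 1 := by
    rw [uIcc_of_le s.2.1]; exact Icc_subset_Icc_right s.2.2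
  have h2 : ∫ τ in (0 : ℝ)..s, V (c τ) p = c s - c 0 :=
    intervalIntegral.integral_eq_sub_of_hasDerivAt (fun t ht => hc t (hsub ht))
      (ContinuousOn.intervalIntegrable
        ((hV.comp_continuousOn (hcc.mono hsub)).clm_apply continuousOn_const))
  have h3 : ∫ τ in (0 : ℝ)..s, V (IccExtend (zero_le_one (α := ℝ))
      (fun s : unitInterval => c s) τ) p = ∫ τ in (0 : ℝ)..s, V (c τ) p := by
    refine intervalIntegral.integral_congr fun τ hτ => ?_
    rw [IccExtend_of_mem _ _ (hsub hτ)]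
  change c s = c 0 + ∫ τ in (0 : ℝ)..s, V (IccExtend (zero_le_one (α := ℝ))
      (fun s : unitInterval => c s) τ) p
  rw [h3, h2]; abel

/-- The time-one map of `y' = V(y) p` depends smoothly on `p` (small) and the initial point. -/
theorem exists_smooth_flow (V : E → P →L[ℝ] E) (hV : ContDiff ℝ ∞ V)
    (hs : HasCompactSupport V) :
    ∃ ε > 0, ∃ Φ : P × E → E, ContDiffOn ℝ ∞ Φ (Metric.ball 0 ε ×ˢ univ) ∧
      (∀ p ∈ Metric.ball (0 : P) ε, ∀ c : ℝ → E,
        (∀ t ∈ Icc (0 : ℝ) 1, HasDerivAt c (V (c t) p) t) → Φ (p, c 0) = c 1) ∧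
      (∀ p ∈ Metric.ball (0 : P) ε, ∀ x, ∀ t ∈ Icc (0 : ℝ) 1,
        HasDerivAt (fun t : ℝ => Φ (t • p, x)) (V (Φ (t • p, x)) p) t) := by
  obtain ⟨C, hC⟩ := ContDiff.lipschitzWith_of_hasCompactSupport hs hV (by simp)
  obtain ⟨K, hK0, hK⟩ : ∃ K : ℝ, 0 < K ∧ ∀ x y, ‖V x - V y‖ ≤ K * ‖x - y‖ :=
    ⟨C + 1, by positivity, fun x y => (hC.norm_sub_le x y).trans (by gcongr; linarith)⟩
  have hsmall : ∀ p ∈ Metric.ball (0 : P) (1 / (2 * K)), ‖p‖ * K ≤ 1 / 2 := fun p hp => by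
    have : ‖p‖ < 1 / (2 * K) := by simpa using hp
    rw [lt_div_iff₀ (by positivity)] at this
    linarith
  have hex := fun (z : P × E) (hz : ‖z.1‖ * K ≤ 1 / 2) =>
    existsUnique_flowDefect hV.continuous hK hK0 z hz
  choose! Γ hΓ hΓu using hex
  have hΓs : ContDiffOn ℝ ∞ Γ (Metric.ball 0 (1 / (2 * K)) ×ˢ univ) := by
    rintro z ⟨hz, -⟩
    have hcd := (contDiff_flowDefect hV hs).contDiffAt (x := (z, Γ z))
    have hinv := isInvertible_fderiv_flowDefect hV hs hK hK0 (z, Γ z) (hsmall _ hz)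
    -- Near `z` the implicit function solves the same equation, whose solution is unique, so it
    -- coincides with `Γ`, which inherits its smoothness.
    have h1 := hcd.contDiffAt_implicitFunction (by simp) hinv
    refine (h1.congr_of_eventuallyEq ?_).contDiffWithinAt
    have hnhds : (Metric.ball (0 : P) (1 / (2 * K)) ×ˢ univ) ∈ 𝓝 z :=
      (Metric.isOpen_ball.prod isOpen_univ).mem_nhds ⟨hz, mem_univ _⟩
    filter_upwards [hcd.eventually_apply_implicitFunction (by simp) hinv, hnhds] with y hy hy'
    refine (hΓu y (hsmall _ hy'.1) _ ?_).symm
    change flowDefect V _ _ = 0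
    rw [hy]
    exact hΓ z (hsmall _ hz)
  set Φ : P × E → E := fun z => Γ z 1 with hΦ
  have hev : ContDiff ℝ ∞ (ContinuousMap.evalCLM ℝ (1 : unitInterval) : C(unitInterval, E) →L[ℝ] E) :=
    ContinuousLinearMap.contDiff _
  have hΦs : ContDiffOn ℝ ∞ Φ (Metric.ball 0 (1 / (2 * K)) ×ˢ univ) :=
    ContDiff.comp_contDiffOn hev hΓs
  have huniq : ∀ p ∈ Metric.ball (0 : P) (1 / (2 * K)), ∀ c : ℝ → E,
      (∀ t ∈ Icc (0 : ℝ) 1, HasDerivAt c (V (c t) p) t) → Φ (p, c 0) = c 1 := by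
    intro p hp c hc
    obtain ⟨γ, hγ, hγ0⟩ := flowDefect_of_hasDerivAt hV.continuous hc
    rw [hΦ]; simp only
    rw [← hΓu (p, c 0) (hsmall _ hp) γ hγ0, hγ]; rfl
  have hball : ∀ p ∈ Metric.ball (0 : P) (1 / (2 * K)), ∀ t ∈ Icc (-1 : ℝ) 1,
      t • p ∈ Metric.ball (0 : P) (1 / (2 * K)) := fun p hp t ht => by
    have h1 : ‖p‖ < 1 / (2 * K) := by simpa using hp
    have h2 : |t| ≤ 1 := abs_le.2 ht
    have : ‖t • p‖ < 1 / (2 * K) := by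
      rw [norm_smul, Real.norm_eq_abs]
      exact (mul_le_of_le_one_left (norm_nonneg _) h2).trans_lt h1
    simpa using this
  -- the derivative at interior positive times
  have hpos : ∀ p ∈ Metric.ball (0 : P) (1 / (2 * K)), ∀ x, ∀ t ∈ Ioo (0 : ℝ) 1,
      HasDerivAt (fun t : ℝ => Φ (t • p, x)) (V (Φ (t • p, x)) p) t := by
    intro p hp x
    set γ := Γ (p, x) with hγ
    set η : ℝ → E := IccExtend (zero_le_one (α := ℝ)) γ with hη
    have hηc : Continuous η := γ.continuous.Icc_extend'
    have hint : Continuous fun τ => V (η τ) p := (hV.continuous.comp hηc).clm_apply continuous_const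
    have heq := (flowDefect_eq_zero_iff hV.continuous (p, x) γ).1 (hΓ (p, x) (hsmall _ hp))
    have hηd : ∀ t ∈ Ioo (0 : ℝ) 1, HasDerivAt η (V (η t) p) t := by
      intro t ht
      have h1 := (intervalIntegral.integral_hasDerivAt_right (hint.intervalIntegrable 0 t)
        (hint.stronglyMeasurableAtFilter _ _) hint.continuousAt).const_add x
      refine h1.congr_of_eventuallyEq ?_
      filter_upwards [Ioo_mem_nhds ht.1 ht.2] with s hs'
      rw [hη, IccExtend_of_mem _ _ (Ioo_subset_Icc_self hs')]
      exact heq ⟨s, Ioo_subset_Icc_self hs'⟩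
    -- Linearity in `p` again: the path run at speed `t` solves the equation with parameter `t • p`.
    have hval : ∀ t ∈ Ioo (0 : ℝ) 1, Φ (t • p, x) = η t := by
      intro t ht
      let ζ : C(unitInterval, E) := ⟨fun s => η (t * s), by fun_prop⟩
      have hζ : flowDefect V hV.continuous ((t • p, x), ζ) = 0 := by
        rw [flowDefect_eq_zero_iff]
        intro s
        have hts : t * s ∈ Icc (0 : ℝ) 1 :=
          ⟨mul_nonneg ht.1.le s.2.1, mul_le_one₀ ht.2.le s.2.1 s.2.2⟩
        have e1 : ζ s = x + ∫ τ in (0 : ℝ)..(t * s), V (η τ) p := by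
          change η (t * s) = _
          rw [hη, IccExtend_of_mem _ _ hts]
          exact heq ⟨t * s, hts⟩
        rw [e1]
        congr 1
        have e2 : ∫ τ in (0 : ℝ)..s, V (IccExtend (zero_le_one (α := ℝ)) ζ τ) (t • p)
            = ∫ τ in (0 : ℝ)..s, t • V (η (t * τ)) p := by
          refine intervalIntegral.integral_congr fun τ hτ => ?_
          rw [uIcc_of_le s.2.1] at hτ
          rw [IccExtend_of_mem _ _ ⟨hτ.1, hτ.2.trans s.2.2⟩, map_smul]
          rfl
        change _ = ∫ τ in (0 : ℝ)..s, V (IccExtend (zero_le_one (α := ℝ)) ζ τ) (t • p)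
        rw [e2, intervalIntegral.integral_smul,
          intervalIntegral.smul_integral_comp_mul_left (fun τ => V (η τ) p) t]
        simp
      have := hΓu (t • p, x) (hsmall _ (hball p hp t ⟨by linarith [ht.1], ht.2.le⟩)) ζ hζ
      rw [hΦ]; simp only
      rw [← this]
      change η (t * (1 : unitInterval)) = η t
      simp
    intro t ht
    rw [hval t ht]
    refine (hηd t ht).congr_of_eventuallyEq ?_
    filter_upwards [Ioo_mem_nhds ht.1 ht.2] with s hs' using hval s hs'
  -- smoothness in time
  have hsm : ∀ p ∈ Metric.ball (0 : P) (1 / (2 * K)), ∀ x,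
      ContDiffOn ℝ ∞ (fun t : ℝ => Φ (t • p, x)) (Ioo (-1) 1) := by
    intro p hp x
    refine hΦs.comp (((contDiff_id.smul contDiff_const).prodMk contDiff_const).contDiffOn)
      fun t ht => ⟨hball p hp t ⟨ht.1.le, ht.2.le⟩, mem_univ _⟩
  -- Negative times come from the parameter `-p`. At time zero the derivative of the curve and the
  -- field along it are both continuous, so the equation extends from nonzero times.
  have hall : ∀ p ∈ Metric.ball (0 : P) (1 / (2 * K)), ∀ x, ∀ t ∈ Ioo (-1 : ℝ) 1,
      HasDerivAt (fun t : ℝ => Φ (t • p, x)) (V (Φ (t • p, x)) p) t := by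
    intro p hp x
    have hne : ∀ t ∈ Ioo (-1 : ℝ) 1, t ≠ 0 →
        HasDerivAt (fun t : ℝ => Φ (t • p, x)) (V (Φ (t • p, x)) p) t := by
      intro t ht h0
      rcases lt_or_gt_of_ne h0 with h | h
      · have hp' : -p ∈ Metric.ball (0 : P) (1 / (2 * K)) := by simpa using hp
        have h1 := hpos (-p) hp' x (-t) ⟨by linarith, by linarith [ht.1]⟩
        have h2 := h1.scomp t (hasDerivAt_neg t)
        simp only [Function.comp_def, smul_neg, neg_smul, neg_neg, map_neg, one_smul] at h2
        exact h2
      · exact hpos p hp x t ⟨h, ht.2⟩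
    intro t ht
    by_cases h0 : t = 0
    · subst h0
      have hd : DifferentiableAt ℝ (fun t : ℝ => Φ (t • p, x)) 0 :=
        ((hsm p hp x).differentiableOn (by simp)).differentiableAt (Ioo_mem_nhds ht.1 ht.2)
      have hc1 : ContinuousAt (deriv fun t : ℝ => Φ (t • p, x)) 0 :=
        ((hsm p hp x).continuousOn_deriv_of_isOpen isOpen_Ioo (by simp)).continuousAt
          (Ioo_mem_nhds ht.1 ht.2)
      have hc2 : ContinuousAt (fun t : ℝ => V (Φ (t • p, x)) p) 0 :=
        (hV.continuous.continuousAt.comp hd.continuousAt).clm_apply continuousAt_const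
      have heq : (deriv fun t : ℝ => Φ (t • p, x)) 0 = V (Φ ((0 : ℝ) • p, x)) p := by
        refine tendsto_nhds_unique (hc1.tendsto.mono_left (nhdsWithin_le_nhds (s := {0}ᶜ)))
          ((hc2.tendsto.mono_left nhdsWithin_le_nhds).congr' ?_)
        filter_upwards [self_mem_nhdsWithin, mem_nhdsWithin_of_mem_nhds (Ioo_mem_nhds ht.1 ht.2)]
          with s hs1 hs2
        exact (hne s hs2 hs1).deriv.symm
      rw [← heq]; exact hd.hasDerivAt
    · exact hne t ht h0
  -- With half the radius, time `t` for `p` is time `t / 2` for `2 • p`, so the whole closed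
  -- interval of times falls inside the open interval treated above.
  refine ⟨1 / (2 * K) / 2, by positivity, Φ, hΦs.mono ?_, ?_, ?_⟩
  · exact prod_mono_left (Metric.ball_subset_ball (by linarith [show 0 < 1 / (2 * K) by positivity]))
  · intro p hp c hc
    exact huniq p (Metric.ball_subset_ball
      (by linarith [show 0 < 1 / (2 * K) by positivity]) hp) c hc
  · intro p hp x t ht
    have hp' : (2 : ℝ) • p ∈ Metric.ball (0 : P) (1 / (2 * K)) := by
      have : ‖p‖ < 1 / (2 * K) / 2 := by simpa using hp
      rw [mem_ball_zero_iff, norm_smul]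
      norm_num
      norm_num at this
      linarith
    have h1 := hall _ hp' x (t / 2) ⟨by linarith [ht.1], by linarith [ht.2]⟩
    have h2 := h1.scomp t ((hasDerivAt_id t).div_const 2)
    have e : ∀ s : ℝ, (s / 2) • (2 : ℝ) • p = s • p := fun s => by rw [smul_smul]; congr 1; ring
    simp only [Function.comp_def, id_eq, e] at h2
    rw [map_smul, smul_smul] at h2
    norm_num at h2
    exact h2

end Flow
end SymplecticIFS
end

noncomputable section
namespace SymplecticIFS

/-! ### Hamiltonian flows in an open set of a vector space -/

section Hamiltonian

set_option linter.unusedSectionVars false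

variable {E P : Type} [NormedAddCommGroup E] [NormedSpace ℝ E] [FiniteDimensional ℝ E]
  [NormedAddCommGroup P] [NormedSpace ℝ P] [FiniteDimensional ℝ P]

lemma two_le_infty : (2 : WithTop ℕ∞) ≤ ∞ := by
  have : ((2 : ℕ∞) : WithTop ℕ∞) ≤ ((⊤ : ℕ∞) : WithTop ℕ∞) := WithTop.coe_le_coe.2 le_top
  simpa using this

/-- Alternating 2-forms as bilinear forms. -/
def formBilin : (E [⋀^Fin 2]→L[ℝ] ℝ) →L[ℝ] E →L[ℝ] E →L[ℝ] ℝ :=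
  (ContinuousLinearMap.compL ℝ E (E [×1]→L[ℝ] ℝ) (E →L[ℝ] ℝ)
    ((continuousMultilinearCurryFin1 ℝ E ℝ).toContinuousLinearEquiv : _ →L[ℝ] _)) ∘L
  ((continuousMultilinearCurryLeftEquiv ℝ (fun _ : Fin 2 => E) ℝ).toContinuousLinearEquiv :
    _ →L[ℝ] _) ∘L (ContinuousAlternatingMap.toContinuousMultilinearMapLI).toContinuousLinearMap

lemma formBilin_apply (η : E [⋀^Fin 2]→L[ℝ] ℝ) (u v : E) : formBilin η u v = η ![u, v] := by
  change η (Fin.cons u _) = _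
  congr 1
  ext i
  fin_cases i <;> rfl

lemma contDiff_formBilin : ContDiff ℝ ∞ (formBilin (E := E)) := ContinuousLinearMap.contDiff _

lemma hasFDerivAt_formBilin (η : E [⋀^Fin 2]→L[ℝ] ℝ) :
    HasFDerivAt (formBilin (E := E)) (formBilin (E := E)) η := ContinuousLinearMap.hasFDerivAt _

lemma hasFDerivAt_formBilin_comp {X : Type} [NormedAddCommGroup X] [NormedSpace ℝ X]
    {f : X → E [⋀^Fin 2]→L[ℝ] ℝ} {f' : X →L[ℝ] E [⋀^Fin 2]→L[ℝ] ℝ} {x : X}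
    (hf : HasFDerivAt f f' x) :
    HasFDerivAt (fun y => formBilin (f y)) ((formBilin (E := E)) ∘L f') x := by
  have h := contDiff_formBilin.differentiable (by simp) (f x)
  have h1 := h.hasFDerivAt.comp x hf
  have h2 : fderiv ℝ (formBilin (E := E)) (f x) = formBilin := (hasFDerivAt_formBilin _).fderiv
  rw [h2] at h1
  exact h1

lemma form_swap (η : E [⋀^Fin 2]→L[ℝ] ℝ) (u v : E) : η ![u, v] = - η ![v, u] := by
  have h := η.toAlternatingMap.map_swap ![v, u] (i := 0) (j := 1) (by simp)
  have e : (![v, u] ∘ ⇑(Equiv.swap (0 : Fin 2) 1)) = ![u, v] := by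
    ext i
    fin_cases i <;> rfl
  rw [e] at h
  exact h

lemma isInvertible_formBilin {η : E [⋀^Fin 2]→L[ℝ] ℝ}
    (h : ∀ u, (∀ v, η ![u, v] = 0) → u = 0) : (formBilin η).IsInvertible := by
  have hinj : Function.Injective (formBilin η : E →ₗ[ℝ] E →L[ℝ] ℝ) := by
    rw [injective_iff_map_eq_zero]
    intro u hu
    refine h u fun v => ?_
    rw [← formBilin_apply]
    exact congrArg (fun f : E →L[ℝ] ℝ => f v) hu
  have hfr : Module.finrank ℝ E = Module.finrank ℝ (E →L[ℝ] ℝ) := by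
    rw [← LinearEquiv.finrank_eq (LinearMap.toContinuousLinearMap (𝕜 := ℝ) (E := E) (F' := ℝ))]
    exact (Subspace.dual_finrank_eq (K := ℝ) (V := E)).symm
  refine ⟨(LinearEquiv.ofInjectiveOfFinrankEq _ hinj hfr).toContinuousLinearEquiv, ?_⟩
  ext u v
  rfl

/-- The Hamiltonian vector fields of a linear family `h` of functions. -/
def hamField (η : E → E [⋀^Fin 2]→L[ℝ] ℝ) (h : E → P →L[ℝ] ℝ) (x : E) : P →L[ℝ] E :=
  (formBilin (η x)).inverse ∘L (fderiv ℝ h x).flip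

lemma form_hamField {η : E → E [⋀^Fin 2]→L[ℝ] ℝ} (h : E → P →L[ℝ] ℝ) {x : E}
    (hnd : ∀ u, (∀ v, η x ![u, v] = 0) → u = 0) (p : P) (w : E) :
    η x ![hamField η h x p, w] = fderiv ℝ h x w p := by
  rw [← formBilin_apply]
  have := (isInvertible_formBilin hnd)
  simp only [hamField, ContinuousLinearMap.comp_apply]
  rw [this.self_apply_inverse]
  rfl

/-- The form is controlled only on `O`. Away from the support of `h` the differential of `h`
vanishes, so the field is locally zero there whatever value `inverse` takes. -/
lemma contDiff_hamField {η : E → E [⋀^Fin 2]→L[ℝ] ℝ} {O : Set E} (hO : IsOpen O)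
    (hη : ContDiffOn ℝ ∞ η O) (hnd : ∀ x ∈ O, ∀ u, (∀ v, η x ![u, v] = 0) → u = 0)
    {h : E → P →L[ℝ] ℝ} (hh : ContDiff ℝ ∞ h) (hsub : tsupport h ⊆ O) :
    ContDiff ℝ ∞ (hamField η h) := by
  rw [contDiff_iff_contDiffAt]
  intro x
  by_cases hx : x ∈ tsupport h
  · have hxO := hsub hx
    obtain ⟨e, he⟩ := isInvertible_formBilin (hnd x hxO)
    have h1 : ContDiffAt ℝ ∞ (fun y => (formBilin (η y)).inverse) x := by
      have h2 : ContDiffAt ℝ ∞ ContinuousLinearMap.inverse (formBilin (η x)) := by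
        rw [← he]; exact contDiffAt_map_inverse e
      have h3 : ContDiffAt ℝ ∞ (fun y => formBilin (η y)) x :=
        contDiff_formBilin.contDiffAt.comp x (hη.contDiffAt (hO.mem_nhds hxO))
      exact h2.comp x h3
    have h4 : ContDiff ℝ ∞ (fun y => (fderiv ℝ h y).flip) := by
      have h5 : ContDiff ℝ ∞ (fderiv ℝ h) := hh.fderiv_right (by simp)
      have h6 : ContDiff ℝ ∞ (ContinuousLinearMap.flipₗᵢ ℝ E P ℝ) := LinearIsometryEquiv.contDiff _
      exact h6.comp h5
    exact h1.clm_comp h4.contDiffAt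
  · have : hamField η h =ᶠ[𝓝 x] fun _ => 0 := by
      have h1 := (isClosed_tsupport h).isOpen_compl.mem_nhds hx
      filter_upwards [h1] with y hy
      have : fderiv ℝ h y = 0 := by
        by_contra hne
        exact hy (support_fderiv_subset ℝ hne)
      rw [hamField, this]
      ext; simp
    exact contDiffAt_const.congr_of_eventuallyEq this

lemma hamField_eq_zero {η : E → E [⋀^Fin 2]→L[ℝ] ℝ} {h : E → P →L[ℝ] ℝ} {x : E}
    (hx : x ∉ tsupport h) : hamField η h x = 0 := by
  have : fderiv ℝ h x = 0 := by
    by_contra hne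
    exact hx (support_fderiv_subset ℝ hne)
  rw [hamField, this]
  ext; simp

/-- The Lie derivative of a closed form along a Hamiltonian vector field vanishes. -/
lemma lie_hamField {η : E → E [⋀^Fin 2]→L[ℝ] ℝ} {O : Set E} (hO : IsOpen O)
    (hη : ContDiffOn ℝ ∞ η O) (hcl : ∀ x ∈ O, extDeriv η x = 0)
    (hnd : ∀ x ∈ O, ∀ u, (∀ v, η x ![u, v] = 0) → u = 0)
    {h : E → P →L[ℝ] ℝ} (hh : ContDiff ℝ ∞ h) (hsub : tsupport h ⊆ O) {x : E} (hx : x ∈ O)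
    (p : P) (a b : E) :
    fderiv ℝ η x (hamField η h x p) ![a, b] + η x ![fderiv ℝ (fun y => hamField η h y p) x a, b] +
      η x ![a, fderiv ℝ (fun y => hamField η h y p) x b] = 0 := by
  have hX : DifferentiableAt ℝ (fun y => hamField η h y p) x :=
    (((contDiff_hamField hO hη hnd hh hsub).clm_apply contDiff_const).differentiable
      (by simp)) x
  have hηd : DifferentiableAt ℝ η x :=
    (hη.contDiffAt (hO.mem_nhds hx)).differentiableAt (by simp)
  have hB : HasFDerivAt (fun y => formBilin (η y)) (formBilin ∘L fderiv ℝ η x) x :=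
    hasFDerivAt_formBilin_comp hηd.hasFDerivAt
  have hh1 : ContDiff ℝ ∞ (fderiv ℝ h) := hh.fderiv_right (by simp)
  have hh1d : DifferentiableAt ℝ (fderiv ℝ h) x := hh1.differentiable (by simp) x
  have hsym : IsSymmSndFDerivAt ℝ h x := (hh.of_le (m := 2) two_le_infty).contDiffAt.isSymmSndFDerivAt (by simp)
  -- The identity `η(X, d) = dh(d)` holds near `x`; it is differentiated in the direction `c`.
  have hid : ∀ c d : E, fderiv ℝ η x c ![hamField η h x p, d] +
      η x ![fderiv ℝ (fun y => hamField η h y p) x c, d] =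
      fderiv ℝ (fderiv ℝ h) x c d p := by
    intro c d
    have h1 : HasFDerivAt (fun y => formBilin (η y) (hamField η h y p) d) _ x :=
      (hB.clm_apply hX.hasFDerivAt).clm_apply (hasFDerivAt_const d x)
    have h2 : HasFDerivAt (fun y => fderiv ℝ h y d p) _ x :=
      (hh1d.hasFDerivAt.clm_apply (hasFDerivAt_const d x)).clm_apply (hasFDerivAt_const p x)
    have h3 : (fun y => formBilin (η y) (hamField η h y p) d) =ᶠ[𝓝 x]
        fun y => fderiv ℝ h y d p := by
      filter_upwards [hO.mem_nhds hx] with y hy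
      rw [formBilin_apply, form_hamField h (hnd y hy)]
    have h4 := congrArg (fun f : E →L[ℝ] ℝ => f c) (h1.unique (h2.congr_of_eventuallyEq h3))
    simp only [add_apply, ContinuousLinearMap.comp_apply, ContinuousLinearMap.flip_apply,
      zero_apply, map_zero, formBilin_apply, zero_add] at h4
    linarith
  -- Cartan's formula by hand: `dη(X, a, b) = 0` is combined with the identities for `(a, b)` and
  -- `(b, a)`, and the second derivatives of `h` cancel by symmetry.
  have hc := congrArg (fun f => f ![hamField η h x p, a, b]) (hcl x hx)
  simp only [extDeriv, ContinuousAlternatingMap.alternatizeUncurryFin_apply] at hc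
  replace hc := (Fin.sum_univ_three _).symm.trans hc
  have e0 : (0 : Fin 3).removeNth ![hamField η h x p, a, b] = ![a, b] := by
    ext i; fin_cases i <;> rfl
  have e1 : (1 : Fin 3).removeNth ![hamField η h x p, a, b] = ![hamField η h x p, b] := by
    ext i; fin_cases i <;> rfl
  have e2 : (2 : Fin 3).removeNth ![hamField η h x p, a, b] = ![hamField η h x p, a] := by
    ext i; fin_cases i <;> rfl
  rw [e0, e1, e2] at hc
  simp at hc
  have i1 := hid a b
  have i2 := hid b a
  have i3 := congrArg (fun f : P →L[ℝ] ℝ => f p) (hsym a b)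
  rw [form_swap (η x) a]
  linarith

/-- Existence of a smooth Hamiltonian flow, with its main properties. -/
theorem exists_hamiltonian_flow {η : E → E [⋀^Fin 2]→L[ℝ] ℝ} {O : Set E} (hO : IsOpen O)
    (hη : ContDiffOn ℝ ∞ η O) (hcl : ∀ x ∈ O, extDeriv η x = 0)
    (hnd : ∀ x ∈ O, ∀ u, (∀ v, η x ![u, v] = 0) → u = 0)
    {h : E → P →L[ℝ] ℝ} (hh : ContDiff ℝ ∞ h) (hs : HasCompactSupport h)
    (hsub : tsupport h ⊆ O) :
    ∃ ε > 0, ∃ Φ : P × E → E, ContDiffOn ℝ ∞ Φ (Metric.ball 0 ε ×ˢ univ) ∧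
      (∀ x, Φ (0, x) = x) ∧
      (∀ p ∈ Metric.ball (0 : P) ε, ∀ x, Φ (-p, Φ (p, x)) = x) ∧
      (∀ p ∈ Metric.ball (0 : P) ε, ∀ x ∉ tsupport h, Φ (p, x) = x) ∧
      (∀ p ∈ Metric.ball (0 : P) ε, ∀ x ∈ O, ∀ u v,
        η (Φ (p, x)) ![fderiv ℝ (fun y => Φ (p, y)) x u, fderiv ℝ (fun y => Φ (p, y)) x v] =
          η x ![u, v]) ∧
      (∀ p ∈ Metric.ball (0 : P) ε, ∀ c : ℝ → E, (∀ t ∈ Icc (0 : ℝ) 1, c t ∈ O ∧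
        ∃ c', HasDerivAt c c' t ∧ ∀ w, η (c t) ![c', w] = fderiv ℝ h (c t) w p) →
        Φ (p, c 0) = c 1) ∧
      (∀ p ∈ Metric.ball (0 : P) ε, ∀ x ∈ O, ∃ v, HasDerivAt (fun t : ℝ => Φ (t • p, x)) v 0 ∧
        ∀ w, η x ![v, w] = fderiv ℝ h x w p) := by
  set V := hamField η h with hVdef
  have hV : ContDiff ℝ ∞ V := contDiff_hamField hO hη hnd hh hsub
  have hVs : HasCompactSupport V := HasCompactSupport.intro hs fun x hx => hamField_eq_zero hx
  obtain ⟨ε, hε, Φ, hΦ, huniq, hder⟩ := exists_smooth_flow V hV hVs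
  have hfix : ∀ p ∈ Metric.ball (0 : P) ε, ∀ x ∉ tsupport h, Φ (p, x) = x := by
    intro p hp x hx
    refine huniq p hp (fun _ => x) fun t _ => ?_
    rw [hVdef, hamField_eq_zero hx]
    simpa using hasDerivAt_const t x
  have hzero : ∀ x, Φ (0, x) = x := fun x =>
    huniq 0 (Metric.mem_ball_self hε) (fun _ => x) fun t _ => by simpa using hasDerivAt_const t x
  have hball : ∀ p ∈ Metric.ball (0 : P) ε, ∀ t ∈ Icc (0 : ℝ) 1,
      t • p ∈ Metric.ball (0 : P) ε := fun p hp t ht => by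
    have h1 : ‖p‖ < ε := by simpa using hp
    rw [mem_ball_zero_iff, norm_smul, Real.norm_eq_abs, abs_of_nonneg ht.1]
    exact (mul_le_of_le_one_left (norm_nonneg _) ht.2).trans_lt h1
  -- The reversed curve `t ↦ Φ ((1 - t) • p, x)` solves the equation with parameter `-p`.
  have hinv : ∀ p ∈ Metric.ball (0 : P) ε, ∀ x, Φ (-p, Φ (p, x)) = x := by
    intro p hp x
    have := huniq (-p) (by simpa using hp) (fun t => Φ ((1 - t) • p, x)) fun t ht => by
      have h1 := hder p hp x (1 - t) ⟨by linarith [ht.2], by linarith [ht.1]⟩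
      have h2 := h1.scomp t ((hasDerivAt_id t).const_sub 1)
      simpa [Function.comp_def] using h2
    simpa [hzero] using this
  -- A point that left `O` would be outside the support, hence fixed by the inverse flow, which is
  -- supposed to bring it back into `O`.
  have hmem : ∀ p ∈ Metric.ball (0 : P) ε, ∀ x ∈ O, Φ (p, x) ∈ O := by
    intro p hp x hx
    by_contra hcon
    have h1 : Φ (-p, Φ (p, x)) = Φ (p, x) :=
      hfix (-p) (by simpa using hp) _ fun hm => hcon (hsub hm)
    rw [hinv p hp x] at h1
    exact hcon (h1 ▸ hx)
  refine ⟨ε, hε, Φ, hΦ, hzero, hinv, hfix, ?_, ?_, ?_⟩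
  · intro p hp x hx u v
    -- the flow as a function of time and position
    let g : ℝ × E → E := fun z => Φ (z.1 • p, z.2)
    let T : Set ℝ := {t | t • p ∈ Metric.ball (0 : P) ε}
    have hT : IsOpen T := Metric.isOpen_ball.preimage (by fun_prop)
    have hg : ContDiffOn ℝ ∞ g (T ×ˢ univ) :=
      hΦ.comp (t := Metric.ball 0 ε ×ˢ univ) (by fun_prop) fun z hz => ⟨hz.1, mem_univ _⟩
    have hTI : ∀ t ∈ Icc (0 : ℝ) 1, t ∈ T := hball p hp
    have hgat : ∀ t ∈ Icc (0 : ℝ) 1, ∀ y, ContDiffAt ℝ ∞ g (t, y) := fun t ht y =>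
      hg.contDiffAt ((hT.prod isOpen_univ).mem_nhds ⟨hTI t ht, mem_univ _⟩)
    have hgt : ∀ t ∈ Icc (0 : ℝ) 1, ∀ y, fderiv ℝ g (t, y) (1, 0) = V (g (t, y)) p := by
      intro t ht y
      have h1 : HasDerivAt (fun s => g (s, y)) (fderiv ℝ g (t, y) (1, 0)) t := by
        have := ((hgat t ht y).differentiableAt (by simp)).hasFDerivAt.comp_hasDerivAt t
          ((hasDerivAt_id t).prodMk (hasDerivAt_const t y))
        exact this
      exact h1.unique (hder p hp y t ht)
    have hgx : ∀ t ∈ Icc (0 : ℝ) 1, ∀ y w, fderiv ℝ (fun y => Φ (t • p, y)) y w =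
        fderiv ℝ g (t, y) (0, w) := by
      intro t ht y w
      have h1 : HasFDerivAt (fun y => g (t, y)) (fderiv ℝ g (t, y) ∘L .inr ℝ ℝ E) y :=
        HasFDerivAt.comp (g := g) y ((hgat t ht y).differentiableAt (by simp)).hasFDerivAt
          (hasFDerivAt_prodMk_right t y)
      have h2 := h1.fderiv
      change fderiv ℝ (fun y => g (t, y)) y w = _
      rw [h2]; rfl
    -- the variational equation
    have hvar : ∀ w, ∀ t ∈ Icc (0 : ℝ) 1, HasDerivAt (fun s => fderiv ℝ g (s, x) (0, w))
        (fderiv ℝ (fun y => V y p) (g (t, x)) (fderiv ℝ g (t, x) (0, w))) t := by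
      intro w t ht
      have hg' : ContDiffAt ℝ ∞ (fderiv ℝ g) (t, x) := (hgat t ht x).fderiv_right (by simp)
      have hgd := (hg'.differentiableAt (by simp)).hasFDerivAt
      have h1 : HasDerivAt (fun s => fderiv ℝ g (s, x) (0, w))
          (fderiv ℝ (fderiv ℝ g) (t, x) (1, 0) (0, w)) t := by
        have h2 : HasDerivAt (fun s => fderiv ℝ g (s, x))
            (fderiv ℝ (fderiv ℝ g) (t, x) (1, 0)) t :=
          hgd.comp_hasDerivAt t ((hasDerivAt_id t).prodMk (hasDerivAt_const t x))
        simpa using h2.clm_apply (hasDerivAt_const t ((0, w) : ℝ × E))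
      -- Symmetry of the second derivative exchanges the time and space derivatives, turning the
      -- flow equation into the equation for the derivative of the flow.
      have hsym : IsSymmSndFDerivAt ℝ g (t, x) := ((hgat t ht x).of_le (m := 2) two_le_infty).isSymmSndFDerivAt (by simp)
      rw [hsym] at h1
      have h3 : HasFDerivAt (fun y => fderiv ℝ g (t, y) (1, 0))
          (((fderiv ℝ (fderiv ℝ g) (t, x)).flip (1, 0)) ∘L .inr ℝ ℝ E) x := by
        have h4 : HasFDerivAt (fun z => fderiv ℝ g z (1, 0))
            ((fderiv ℝ (fderiv ℝ g) (t, x)).flip (1, 0)) (t, x) := by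
          simpa using hgd.clm_apply (hasFDerivAt_const ((1, 0) : ℝ × E) (t, x))
        exact HasFDerivAt.comp (g := fun z => fderiv ℝ g z (1, 0)) x h4
          (hasFDerivAt_prodMk_right t x)
      have h5 : HasFDerivAt (fun y => V (g (t, y)) p)
          (fderiv ℝ (fun y => V y p) (g (t, x)) ∘L (fderiv ℝ g (t, x) ∘L .inr ℝ ℝ E)) x := by
        have h6 : HasFDerivAt (fun y => V y p) (fderiv ℝ (fun y => V y p) (g (t, x))) (g (t, x)) :=
          (((hV.clm_apply contDiff_const).differentiable (by simp)) _).hasFDerivAt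
        exact HasFDerivAt.comp (g := fun y => V y p) x h6
          (HasFDerivAt.comp (g := g) x ((hgat t ht x).differentiableAt (by simp)).hasFDerivAt
          (hasFDerivAt_prodMk_right t x))
      have h7 : (fun y => fderiv ℝ g (t, y) (1, 0)) = fun y => V (g (t, y)) p :=
        funext fun y => hgt t ht y
      rw [h7] at h3
      have h8 := congrArg (fun f : E →L[ℝ] E => f w) (h3.unique h5)
      simp only [ContinuousLinearMap.comp_apply, ContinuousLinearMap.flip_apply,
        ContinuousLinearMap.inr_apply] at h8
      rwa [h8] at h1
    -- The pulled-back form is constant in time: its time derivative is the Lie derivative of `η`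
    -- evaluated on the transported vectors.
    have hW : ∀ t ∈ Icc (0 : ℝ) 1, HasDerivAt (fun s => formBilin (η (g (s, x)))
        (fderiv ℝ g (s, x) (0, u)) (fderiv ℝ g (s, x) (0, v))) 0 t := by
      intro t ht
      have hgO : g (t, x) ∈ O := hmem _ (hball p hp t ht) x hx
      have hηd : HasFDerivAt η (fderiv ℝ η (g (t, x))) (g (t, x)) :=
        ((hη.contDiffAt (hO.mem_nhds hgO)).differentiableAt (by simp)).hasFDerivAt
      have h1 : HasDerivAt (fun s => formBilin (η (g (s, x))))
          (formBilin (fderiv ℝ η (g (t, x)) (V (g (t, x)) p))) t :=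
        HasFDerivAt.comp_hasDerivAt (l := fun y => formBilin (η y)) (f := fun s => g (s, x)) t
          (hasFDerivAt_formBilin_comp hηd) (hder p hp x t ht)
      have h2 := (h1.clm_apply (hvar u t ht)).clm_apply (hvar v t ht)
      have h3 := lie_hamField hO hη hcl hnd hh hsub hgO p (fderiv ℝ g (t, x) (0, u))
        (fderiv ℝ g (t, x) (0, v))
      convert! h2 using 1
      simp only [add_apply, formBilin_apply]
      exact h3.symm
    have hconst := constant_of_has_deriv_right_zero
      (fun t ht => (hW t ht).continuousAt.continuousWithinAt)
      (fun t ht => (hW t (Ico_subset_Icc_self ht)).hasDerivWithinAt) 1 (by simp)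
    simp only [formBilin_apply] at hconst
    have e0 : ∀ w, fderiv ℝ g (0, x) (0, w) = w := by
      intro w
      rw [← hgx 0 (by simp)]
      have : (fun y => Φ ((0 : ℝ) • p, y)) = id := by
        funext y; rw [zero_smul]; exact hzero y
      rw [this, fderiv_id]; rfl
    have e1 : ∀ w, fderiv ℝ g (1, x) (0, w) = fderiv ℝ (fun y => Φ (p, y)) x w := by
      intro w
      rw [← hgx 1 (by simp), one_smul]
    rw [e0, e0, e1, e1] at hconst
    simpa [g, hzero] using hconst
  · intro p hp c hc
    refine huniq p hp c fun t ht => ?_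
    obtain ⟨hcO, c', hc', hw⟩ := hc t ht
    have : c' = V (c t) p := by
      have hnd' := hnd _ hcO (c' - V (c t) p) fun w => by
        have h1 := hw w
        rw [← form_hamField h (hnd _ hcO), ← formBilin_apply, ← formBilin_apply] at h1
        rw [← formBilin_apply, map_sub, sub_apply, h1, sub_self]
      exact sub_eq_zero.1 hnd'
    rwa [← this]
  · intro p hp x hx
    refine ⟨V x p, ?_, fun w => form_hamField h (hnd x hx) p w⟩
    have := hder p hp x 0 (by simp)
    rwa [zero_smul, hzero] at this

end Hamiltonian
end SymplecticIFS
end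

/-! ### Derivatives in charts and Hamiltonian families on the manifold -/

noncomputable section
namespace SymplecticIFS

section Tangent

variable {m : ℕ} {X Y Z : Type*} [TopologicalSpace X] [ChartedSpace (Euc m) X]
  [TopologicalSpace Y] [ChartedSpace (Euc m) Y] [TopologicalSpace Z] [ChartedSpace (Euc m) Z]

/-- The derivative of a map between manifolds, with all tangent spaces identified with the model
space. -/
def tmap (f : X → Y) (x : X) : Euc m →L[ℝ] Euc m := mfderiv (𝓡 m) (𝓡 m) f x

lemma tmap_comp {f : X → Y} {g : Y → Z} {x : X} (hg : MDifferentiableAt (𝓡 m) (𝓡 m) g (f x))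
    (hf : MDifferentiableAt (𝓡 m) (𝓡 m) f x) : 
    tmap (m := m) (g ∘ f) x = tmap g (f x) ∘L tmap f x :=
  mfderiv_comp x hg hf

lemma tmap_congr {f g : X → Y} {x : X} (h : f =ᶠ[𝓝 x] g) : tmap (m := m) f x = tmap g x :=
  h.mfderiv_eq

lemma tmap_id (x : X) : tmap (id : X → X) x = ContinuousLinearMap.id ℝ (Euc m) := mfderiv_id

lemma tmap_eq_fderiv (f : Euc m → Euc m) (x : Euc m) : tmap f x = fderiv ℝ f x :=
  mfderiv_eq_fderiv

end Tangent

section Charts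

variable {m : ℕ} {N : Type*} [TopologicalSpace N] [ChartedSpace (Euc m) N]
  {e : OpenPartialHomeomorph N (Euc m)}

lemma mdifferentiableAt_chart (he : e ∈ IsManifold.maximalAtlas (𝓡 m) ∞ N) {x : N}
    (hx : x ∈ e.source) : MDifferentiableAt (𝓡 m) 𝓘(ℝ, Euc m) e x :=
  ((contMDiffOn_of_mem_maximalAtlas he).contMDiffAt (e.open_source.mem_nhds hx)).mdifferentiableAt
    (by simp)

lemma mdifferentiableAt_chart_symm (he : e ∈ IsManifold.maximalAtlas (𝓡 m) ∞ N) {y : Euc m}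
    (hy : y ∈ e.target) : MDifferentiableAt 𝓘(ℝ, Euc m) (𝓡 m) e.symm y :=
  ((contMDiffOn_symm_of_mem_maximalAtlas he).contMDiffAt
    (e.open_target.mem_nhds hy)).mdifferentiableAt (by simp)

lemma tmap_chart_tmap_symm (he : e ∈ IsManifold.maximalAtlas (𝓡 m) ∞ N) {y : Euc m}
    (hy : y ∈ e.target) (u : Euc m) : tmap e (e.symm y) (tmap e.symm y u) = u := by
  have h1 := tmap_comp (mdifferentiableAt_chart he (e.map_target hy))
    (mdifferentiableAt_chart_symm he hy)
  have h2 : e ∘ e.symm =ᶠ[𝓝 y] id := e.eventually_right_inverse hy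
  rw [tmap_congr h2, tmap_id] at h1
  exact (congrArg (fun f : Euc m →L[ℝ] Euc m => f u) h1).symm

lemma tmap_symm_tmap_chart (he : e ∈ IsManifold.maximalAtlas (𝓡 m) ∞ N) {x : N}
    (hx : x ∈ e.source) (u : Euc m) : tmap e.symm (e x) (tmap e x u) = u := by
  have h1 := tmap_comp (mdifferentiableAt_chart_symm he (e.map_source hx))
    (mdifferentiableAt_chart he hx)
  have h2 : e.symm ∘ e =ᶠ[𝓝 x] id := e.eventually_left_inverse hx
  rw [tmap_congr h2, tmap_id] at h1
  exact (congrArg (fun f : Euc m →L[ℝ] Euc m => f u) h1).symm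

end Charts

section Symplectic

variable {n : ℕ} {N : Type*} [TopologicalSpace N] [ChartedSpace (Euc (2 * n)) N]
  (Ω : SymplecticForm n N) {e : OpenPartialHomeomorph N (Euc (2 * n))}

/-- The symplectic form at a point, with the tangent space identified with the model space. -/
def SymplecticForm.at (x : N) : Euc (2 * n) [⋀^Fin 2]→L[ℝ] ℝ := Ω.form x

lemma isSymplectic_iff {f : N → N} : IsSymplectic Ω f ↔ ∀ (x : N) (u v : Euc (2 * n)),
    Ω.at (f x) ![tmap f x u, tmap f x v] = Ω.at x ![u, v] := Iff.rfl

lemma localForm_apply (y u v : Euc (2 * n)) :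
    localForm Ω.form e y ![u, v] = Ω.at (e.symm y) ![tmap e.symm y u, tmap e.symm y v] := by
  have : (fun i => tmap e.symm y (![u, v] i)) = ![tmap e.symm y u, tmap e.symm y v] := by
    ext i; fin_cases i <;> rfl
  rw [← this]
  rfl

lemma form_eq_localForm (he : e ∈ IsManifold.maximalAtlas (𝓡 (2 * n)) ∞ N) {x : N}
    (hx : x ∈ e.source) (u v : Euc (2 * n)) :
    Ω.at x ![u, v] = localForm Ω.form e (e x) ![tmap e x u, tmap e x v] := by
  rw [localForm_apply, tmap_symm_tmap_chart he hx, tmap_symm_tmap_chart he hx, e.left_inv hx]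

lemma localForm_nondegenerate (he : e ∈ IsManifold.maximalAtlas (𝓡 (2 * n)) ∞ N)
    {y : Euc (2 * n)} (hy : y ∈ e.target) (u : Euc (2 * n))
    (hu : ∀ v, localForm Ω.form e y ![u, v] = 0) : u = 0 := by
  have h1 : tmap e.symm y u = 0 := Ω.nondegenerate (e.symm y) (tmap e.symm y u) fun v => by
    have h2 := hu (tmap e (e.symm y) v)
    rw [localForm_apply] at h2
    have h3 := tmap_symm_tmap_chart he (e.map_target hy) v
    rw [e.right_inv hy] at h3
    rw [h3] at h2
    exact h2
  rw [← tmap_chart_tmap_symm he hy u, h1, map_zero]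

/-- Smooth families of symplectic diffeomorphisms with a common compact support, parametrised by
a neighbourhood of the origin in a normed space. -/
structure SympFamily (Ω : SymplecticForm n N) (P : Type) [NormedAddCommGroup P]
    [NormedSpace ℝ P] where
  F : P → N → N
  S : Set N
  ε : ℝ
  isCompact_S : IsCompact S
  ε_pos : 0 < ε
  smooth : ContMDiffOn (𝓘(ℝ, P).prod (𝓡 (2 * n))) (𝓡 (2 * n)) ∞ (fun z : P × N => F z.1 z.2)
    (Metric.ball 0 ε ×ˢ univ)
  zero : ∀ x, F 0 x = x
  inv : ∀ p ∈ Metric.ball (0 : P) ε, ∀ x, F (-p) (F p x) = x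
  fix : ∀ p ∈ Metric.ball (0 : P) ε, ∀ x ∉ S, F p x = x
  symp : ∀ p ∈ Metric.ball (0 : P) ε, IsSymplectic Ω (F p)

variable {P : Type} [NormedAddCommGroup P] [NormedSpace ℝ P] [FiniteDimensional ℝ P]

/-- The family of Hamiltonian diffeomorphisms generated by compactly supported Hamiltonians in a
chart. -/
theorem exists_sympFamily [T2Space N] (he : e ∈ IsManifold.maximalAtlas (𝓡 (2 * n)) ∞ N)
    {h : Euc (2 * n) → P →L[ℝ] ℝ} (hh : ContDiff ℝ ∞ h) (hs : HasCompactSupport h)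
    (hsub : tsupport h ⊆ e.target) :
    ∃ A : SympFamily Ω P, A.S = e.symm '' tsupport h ∧
      (∀ p ∈ Metric.ball (0 : P) A.ε, ∀ x ∈ e.source, A.F p x ∈ e.source) ∧
      (∀ p ∈ Metric.ball (0 : P) A.ε, ∀ c : ℝ → Euc (2 * n), (∀ t ∈ Icc (0 : ℝ) 1,
        c t ∈ e.target ∧ ∃ c', HasDerivAt c c' t ∧
          ∀ w, localForm Ω.form e (c t) ![c', w] = fderiv ℝ h (c t) w p) →
        A.F p (e.symm (c 0)) = e.symm (c 1)) ∧
      (∀ p ∈ Metric.ball (0 : P) A.ε, ∀ x ∈ e.source,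
        ∃ v, HasDerivAt (fun t : ℝ => e (A.F (t • p) x)) v 0 ∧
        ∀ w, localForm Ω.form e (e x) ![v, w] = fderiv ℝ h (e x) w p) := by
  classical
  obtain ⟨ε, hε, Φ, hΦ, hzero, hinv, hfix, hsymp, hsol, hder⟩ :=
    exists_hamiltonian_flow (P := P) e.open_target (Ω.smooth e he) (Ω.closed e he)
      (fun y hy u hu => localForm_nondegenerate Ω he hy u hu) hh hs hsub
  have hneg : ∀ p ∈ Metric.ball (0 : P) ε, -p ∈ Metric.ball (0 : P) ε := fun p hp => by
    simpa using hp
  have hmem : ∀ p ∈ Metric.ball (0 : P) ε, ∀ y ∈ e.target, Φ (p, y) ∈ e.target := by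
    intro p hp y hy
    by_contra hcon
    have h1 := hfix (-p) (hneg p hp) (Φ (p, y)) fun hm => hcon (hsub hm)
    rw [hinv p hp] at h1
    exact hcon (h1 ▸ hy)
  let F : P → N → N := fun p x => if x ∈ e.source then e.symm (Φ (p, e x)) else x
  have hF : ∀ p, ∀ x ∈ e.source, F p x = e.symm (Φ (p, e x)) := fun p x hx => if_pos hx
  have hFmem : ∀ p ∈ Metric.ball (0 : P) ε, ∀ x ∈ e.source, F p x ∈ e.source := by
    intro p hp x hx
    rw [hF p x hx]
    exact e.map_target (hmem p hp _ (e.map_source hx))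
  have hScomp : IsCompact (e.symm '' tsupport h) :=
    hs.isCompact.image_of_continuousOn (e.continuousOn_symm.mono hsub)
  have hFfix : ∀ p ∈ Metric.ball (0 : P) ε, ∀ x ∉ e.symm '' tsupport h, F p x = x := by
    intro p hp x hx
    by_cases hxe : x ∈ e.source
    · rw [hF p x hxe, hfix p hp _ fun hm => hx ⟨e x, hm, e.left_inv hxe⟩, e.left_inv hxe]
    · exact if_neg hxe
  have hSsub : e.symm '' tsupport h ⊆ e.source := by
    rintro _ ⟨y, hy, rfl⟩
    exact e.map_target (hsub hy)
  have hΦx : ∀ p ∈ Metric.ball (0 : P) ε, ∀ y, DifferentiableAt ℝ (fun y => Φ (p, y)) y := by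
    intro p hp y
    have h1 := hΦ.contDiffAt ((Metric.isOpen_ball.prod isOpen_univ).mem_nhds
      (show (p, y) ∈ Metric.ball (0 : P) ε ×ˢ univ from ⟨hp, mem_univ _⟩))
    exact DifferentiableAt.comp (g := Φ) y (h1.differentiableAt (by simp))
      (by fun_prop : DifferentiableAt ℝ (fun y => (p, y)) y)
  refine ⟨{ F := F, S := e.symm '' tsupport h, ε := ε, isCompact_S := hScomp, ε_pos := hε,
            smooth := ?_, zero := ?_, inv := ?_, fix := hFfix, symp := ?_ }, rfl, hFmem, ?_, ?_⟩
  · intro z hz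
    apply ContMDiffAt.contMDiffWithinAt
    by_cases hx : z.2 ∈ e.source
    · have ho : IsOpen (Metric.ball (0 : P) ε ×ˢ e.source) :=
        Metric.isOpen_ball.prod e.open_source
      have h1 : ContMDiffAt (𝓘(ℝ, P).prod (𝓡 (2 * n))) 𝓘(ℝ, Euc (2 * n)) ∞
          (fun z : P × N => Φ (z.1, e z.2)) z := by
        have h2 : ContMDiffAt 𝓘(ℝ, P × Euc (2 * n)) 𝓘(ℝ, Euc (2 * n)) ∞ Φ (z.1, e z.2) :=
          (hΦ.contDiffAt ((Metric.isOpen_ball.prod isOpen_univ).mem_nhds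
            ⟨hz.1, mem_univ _⟩)).contMDiffAt
        have h3 : ContMDiffAt (𝓡 (2 * n)) 𝓘(ℝ, Euc (2 * n)) ∞ e z.2 :=
          (contMDiffOn_of_mem_maximalAtlas he).contMDiffAt (e.open_source.mem_nhds hx)
        have h4 : ContMDiffAt (𝓘(ℝ, P).prod (𝓡 (2 * n))) 𝓘(ℝ, P × Euc (2 * n)) ∞
            (fun z : P × N => (z.1, e z.2)) z :=
          contMDiffAt_fst.prodMk_space (h3.comp z contMDiffAt_snd)
        exact ContMDiffAt.comp (g := Φ) z h2 h4
      have h5 : ContMDiffAt 𝓘(ℝ, Euc (2 * n)) (𝓡 (2 * n)) ∞ e.symm (Φ (z.1, e z.2)) :=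
        (contMDiffOn_symm_of_mem_maximalAtlas he).contMDiffAt
          (e.open_target.mem_nhds (hmem _ hz.1 _ (e.map_source hx)))
      refine (ContMDiffAt.comp (g := e.symm) z h5 h1).congr_of_eventuallyEq ?_
      filter_upwards [ho.mem_nhds ⟨hz.1, hx⟩] with w hw using hF _ _ hw.2
    -- The support is compact, hence closed, and lies in the chart domain; a point outside the
    -- domain thus has a neighbourhood where the family is the identity.
    · have ho : IsOpen (Metric.ball (0 : P) ε ×ˢ (e.symm '' tsupport h)ᶜ) :=
        Metric.isOpen_ball.prod hScomp.isClosed.isOpen_compl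
      refine contMDiffAt_snd.congr_of_eventuallyEq ?_
      filter_upwards [ho.mem_nhds ⟨hz.1, fun hm => hx (hSsub hm)⟩] with w hw
        using hFfix _ hw.1 _ hw.2
  · intro x
    by_cases hx : x ∈ e.source
    · exact (hF 0 x hx).trans (by rw [hzero, e.left_inv hx])
    · exact if_neg hx
  · intro p hp x
    by_cases hx : x ∈ e.source
    · have h1 : F p x = e.symm (Φ (p, e x)) := hF p x hx
      have h2 := hmem p hp _ (e.map_source hx)
      change F (-p) (F p x) = x
      rw [hF _ _ (hFmem p hp x hx), h1, e.right_inv h2, hinv p hp, e.left_inv hx]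
    · have h1 : F p x = x := if_neg hx
      change F (-p) (F p x) = x
      rw [h1]
      exact if_neg hx
  · intro p hp
    refine (isSymplectic_iff Ω).2 fun x u v => ?_
    by_cases hx : x ∈ e.source
    · have hy := hmem p hp _ (e.map_source hx)
      have heq : F p =ᶠ[𝓝 x] e.symm ∘ ((fun y => Φ (p, y)) ∘ e) := by
        filter_upwards [e.open_source.mem_nhds hx] with w hw using hF _ _ hw
      have hm2 : MDifferentiableAt 𝓘(ℝ, Euc (2 * n)) 𝓘(ℝ, Euc (2 * n))
        (fun y => Φ (p, y)) (e x) := (hΦx p hp (e x)).mdifferentiableAt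
      have hm3 : MDifferentiableAt (𝓡 (2 * n)) 𝓘(ℝ, Euc (2 * n))
        ((fun y => Φ (p, y)) ∘ e) x := hm2.comp x (mdifferentiableAt_chart he hx)
      have hd : tmap (F p) x = tmap e.symm (Φ (p, e x)) ∘L
          (fderiv ℝ (fun y => Φ (p, y)) (e x) ∘L tmap e x) := by
        rw [tmap_congr heq, tmap_comp (f := (fun y => Φ (p, y)) ∘ e) (g := e.symm)
            (mdifferentiableAt_chart_symm he hy) hm3,
          tmap_comp hm2 (mdifferentiableAt_chart he hx), tmap_eq_fderiv]
        rfl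
      rw [form_eq_localForm Ω he hx, ← hsymp p hp (e x) (e.map_source hx),
        localForm_apply, hd, hF p x hx]
      rfl
    · have hxS : x ∉ e.symm '' tsupport h := fun hm => hx (hSsub hm)
      have heq : F p =ᶠ[𝓝 x] id := by
        filter_upwards [hScomp.isClosed.isOpen_compl.mem_nhds hxS] with w hw using hFfix p hp w hw
      rw [tmap_congr heq, tmap_id, hFfix p hp x hxS]
      rfl
  · intro p hp c hc
    have h0 := (hc 0 (by simp)).1
    change F p _ = _
    rw [hF p _ (e.map_target h0), e.right_inv h0, hsol p hp c hc]
  · intro p hp x hx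
    obtain ⟨v, hv, hw⟩ := hder p hp (e x) (e.map_source hx)
    refine ⟨v, hv.congr_of_eventuallyEq ?_, hw⟩
    have hcont : Tendsto (fun t : ℝ => t • p) (𝓝 0) (𝓝 0) := by
      have : Continuous fun t : ℝ => t • p := by fun_prop
      simpa using this.tendsto 0
    filter_upwards [hcont.eventually (Metric.ball_mem_nhds 0 hε)] with t ht
    rw [hF _ x hx, e.right_inv (hmem _ ht _ (e.map_source hx))]

end Symplectic
end SymplecticIFS
end

/-! ### Continuity of jets under composition and in parameters -/

noncomputable section
namespace SymplecticIFS

section Jets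

variable {E F G P : Type*} [NormedAddCommGroup E] [NormedSpace ℝ E] [NormedAddCommGroup F]
  [NormedSpace ℝ F] [NormedAddCommGroup G] [NormedSpace ℝ G] [NormedAddCommGroup P]
  [NormedSpace ℝ P]

/-- The coefficients of the formal composition depend continuously on those of the series. -/
lemma tendsto_taylorComp {ι : Type*} {l : Filter ι} {q : ι → FormalMultilinearSeries ℝ F G}
    {p : ι → FormalMultilinearSeries ℝ E F} {q₀ : FormalMultilinearSeries ℝ F G}
    {p₀ : FormalMultilinearSeries ℝ E F} {i : ℕ}
    (hq : ∀ j ≤ i, Tendsto (fun a => q a j) l (𝓝 (q₀ j)))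
    (hp : ∀ j ≤ i, Tendsto (fun a => p a j) l (𝓝 (p₀ j))) :
    Tendsto (fun a => (q a).taylorComp (p a) i) l (𝓝 (q₀.taylorComp p₀ i)) := by
  simp only [FormalMultilinearSeries.taylorComp]
  refine tendsto_finsetSum _ fun c _ => ?_
  have hB := (c.compAlongOrderedFinpartitionL ℝ E F G).analyticOnNhd_uncurry_of_multilinear
    (s := univ)
  have hc : Continuous fun z : (F [×c.length]→L[ℝ] G) × (∀ i, E [×c.partSize i]→L[ℝ] F) =>
      c.compAlongOrderedFinpartitionL ℝ E F G z.1 z.2 :=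
    continuousOn_univ.1 hB.continuousOn
  have h1 : Tendsto (fun a => (q a c.length, fun k => p a (c.partSize k))) l
      (𝓝 (q₀ c.length, fun k => p₀ (c.partSize k))) :=
    (hq _ c.length_le).prodMk_nhds (tendsto_pi_nhds.2 fun k => hp _ (c.partSize_le k))
  exact (hc.tendsto _).comp h1

lemma ContDiffAt.continuousAt_iteratedFDeriv' {f : E → F} {x : E} {i : ℕ}
    (hf : ContDiffAt ℝ i f x) : ContinuousAt (iteratedFDeriv ℝ i f) x :=
  (ContDiffAt.iteratedFDeriv_right (m := 0) (i := i) hf (by simp)).continuousAt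

/-- The partial derivatives of a smooth function are jointly continuous. -/
lemma continuousAt_iteratedFDeriv_partial {f : P × E → F} {z₀ : P × E} {i : ℕ}
    (hf : ContDiffAt ℝ i f z₀) :
    ContinuousAt (fun z : P × E => iteratedFDeriv ℝ i (fun y => f (z.1, y)) z.2) z₀ := by
  obtain ⟨u, hu, hfu⟩ := hf.contDiffOn (m := i) le_rfl (by simp)
  obtain ⟨v, hvu, hv, hzv⟩ := mem_nhds_iff.1 hu
  have hfv := hfu.mono hvu
  have h1 : ContinuousAt (fun z => (iteratedFDeriv ℝ i f z).compContinuousLinearMap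
      fun _ => ContinuousLinearMap.inr ℝ P E) z₀ :=
    (ContinuousMultilinearMap.compContinuousLinearMapL
      (fun _ : Fin i => ContinuousLinearMap.inr ℝ P E)).continuous.continuousAt.comp
      (ContDiffAt.continuousAt_iteratedFDeriv' hf)
  refine h1.congr ?_
  filter_upwards [hv.mem_nhds hzv] with z hz
  -- After translation by `(z.1, 0)` the slice `f (z.1, ·)` is `g` composed with the linear map
  -- `inr`, so its derivatives are those of `g` restricted along `inr`.
  let g : P × E → F := fun w => f ((z.1, 0) + w)
  let s : Set (P × E) := (fun w => (z.1, (0 : E)) + w) ⁻¹' v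
  have hs : IsOpen s := hv.preimage (by fun_prop)
  have hgs : ContDiffOn ℝ i g s := hfv.comp (by fun_prop) fun w hw => hw
  have hs' : IsOpen (ContinuousLinearMap.inr ℝ P E ⁻¹' s) :=
    hs.preimage (ContinuousLinearMap.continuous _)
  have hzs : ContinuousLinearMap.inr ℝ P E z.2 ∈ s := by
    change (z.1, (0 : E)) + (0, z.2) ∈ v
    simpa using hz
  have h2 := (ContinuousLinearMap.inr ℝ P E).iteratedFDerivWithin_comp_right hgs hs.uniqueDiffOn
    hs'.uniqueDiffOn hzs (i := i) le_rfl
  rw [iteratedFDerivWithin_of_isOpen i hs' hzs, iteratedFDerivWithin_of_isOpen i hs hzs] at h2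
  have h3 : g ∘ ContinuousLinearMap.inr ℝ P E = fun y => f (z.1, y) := by
    funext y; simp [g]
  rw [h3] at h2
  rw [h2]
  congr 1
  have h4 := iteratedFDeriv_comp_add_left (𝕜 := ℝ) (f := f) i (z.1, 0)
    (ContinuousLinearMap.inr ℝ P E z.2)
  rw [h4]
  simp

/-- Uniform closeness of derivatives over a compact set for small parameters. -/
lemma eventually_iteratedFDeriv_partial_lt {f : P × E → F} {K : Set E} (hK : IsCompact K)
    {i : ℕ} (hf : ∀ y ∈ K, ContDiffAt ℝ i f (0, y)) {ε : ℝ} (hε : 0 < ε) :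
    ∀ᶠ p in 𝓝 (0 : P), ∀ y ∈ K,
      ‖iteratedFDeriv ℝ i (fun y => f (p, y)) y - iteratedFDeriv ℝ i (fun y => f (0, y)) y‖ < ε := by
  refine hK.eventually_forall_of_forall_eventually fun y hy => ?_
  have h1 := continuousAt_iteratedFDeriv_partial (hf y hy)
  have h2 : ContinuousAt (fun z : P × E => iteratedFDeriv ℝ i (fun y => f (0, y)) z.2) (0, y) :=
    ContinuousAt.comp (g := fun z : P × E => iteratedFDeriv ℝ i (fun y => f (z.1, y)) z.2)
      (f := fun z : P × E => ((0 : P), z.2)) h1 (by fun_prop)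
  have h3 := (h1.sub h2).norm
  have h4 : Tendsto (fun z : P × E => ‖iteratedFDeriv ℝ i (fun y => f (z.1, y)) z.2 -
      iteratedFDeriv ℝ i (fun y => f (0, y)) z.2‖) (𝓝 (0, y)) (𝓝 0) := by
    simpa [ContinuousAt] using h3
  exact h4.eventually_lt_const hε

end Jets
end SymplecticIFS
end

/-! ### Composition in the strong topology -/

noncomputable section
namespace SymplecticIFS

section Jets

variable {E F G : Type*} [NormedAddCommGroup E] [NormedSpace ℝ E] [NormedAddCommGroup F]
  [NormedSpace ℝ F] [NormedAddCommGroup G] [NormedSpace ℝ G]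

/-- Convergence of jets is preserved by composition. -/
lemma tendsto_iteratedFDeriv_comp {ι : Type*} {l : Filter ι} {u : ι → E → F} {v : ι → F → G}
    {y : ι → E} {u₀ : E → F} {v₀ : F → G} {y₀ : E} {s : ℕ}
    (hu : ∀ᶠ k in l, ContDiffAt ℝ s (u k) (y k))
    (hv : ∀ᶠ k in l, ContDiffAt ℝ s (v k) (u k (y k)))
    (hu₀ : ContDiffAt ℝ s u₀ y₀) (hv₀ : ContDiffAt ℝ s v₀ (u₀ y₀))
    (hut : ∀ j ≤ s, Tendsto (fun k => iteratedFDeriv ℝ j (u k) (y k)) l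
      (𝓝 (iteratedFDeriv ℝ j u₀ y₀)))
    (hvt : ∀ j ≤ s, Tendsto (fun k => iteratedFDeriv ℝ j (v k) (u k (y k))) l
      (𝓝 (iteratedFDeriv ℝ j v₀ (u₀ y₀)))) {j : ℕ} (hj : j ≤ s) :
    Tendsto (fun k => iteratedFDeriv ℝ j (v k ∘ u k) (y k)) l
      (𝓝 (iteratedFDeriv ℝ j (v₀ ∘ u₀) y₀)) := by
  have hj' : (j : WithTop ℕ∞) ≤ s := by exact_mod_cast hj
  rw [iteratedFDeriv_comp hv₀ hu₀ hj']
  refine (tendsto_taylorComp (q := fun k => ftaylorSeries ℝ (v k) (u k (y k)))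
    (p := fun k => ftaylorSeries ℝ (u k) (y k)) (fun i hi => hvt i (hi.trans hj))
    (fun i hi => hut i (hi.trans hj))).congr' ?_
  filter_upwards [hu, hv] with k h1 h2
  rw [iteratedFDeriv_comp h2 h1 hj']

lemma norm_iteratedFDeriv_zero_sub (f g : E → F) (x : E) :
    ‖iteratedFDeriv ℝ 0 f x - iteratedFDeriv ℝ 0 g x‖ = ‖f x - g x‖ := by
  simp only [iteratedFDeriv_zero_eq_comp, Function.comp_apply]
  rw [← map_sub, LinearIsometryEquiv.norm_map]

end Jets

section Whitney

variable {m : ℕ} {N : Type*} [TopologicalSpace N] [ChartedSpace (Euc m) N]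

lemma contDiffAt_chart_rep {c d : OpenPartialHomeomorph N (Euc m)}
    (hc : c ∈ IsManifold.maximalAtlas (𝓡 m) ∞ N) (hd : d ∈ IsManifold.maximalAtlas (𝓡 m) ∞ N)
    {f : N → N} {s : WithTop ℕ∞} (hs : s ≤ ∞) {x : N} (hf : ContMDiffAt (𝓡 m) (𝓡 m) s f x)
    (hx : x ∈ c.source) (hfx : f x ∈ d.source) : ContDiffAt ℝ s (d ∘ f ∘ c.symm) (c x) := by
  have h1 : ContMDiffAt 𝓘(ℝ, Euc m) (𝓡 m) s c.symm (c x) :=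
    ((contMDiffOn_symm_of_mem_maximalAtlas hc).contMDiffAt
      (c.open_target.mem_nhds (c.map_source hx))).of_le hs
  have h2 : ContMDiffAt (𝓡 m) 𝓘(ℝ, Euc m) s d (f x) :=
    ((contMDiffOn_of_mem_maximalAtlas hd).contMDiffAt (d.open_source.mem_nhds hfx)).of_le hs
  have h3 := c.left_inv hx
  rw [← contMDiffAt_iff_contDiffAt]
  have h4 : ContMDiffAt 𝓘(ℝ, Euc m) (𝓡 m) s (f ∘ c.symm) (c x) :=
    ContMDiffAt.comp (g := f) _ (by rwa [h3]) h1
  exact ContMDiffAt.comp (g := d) _ (by simpa [h3] using h2) h4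

lemma nat_le_infty (s : ℕ) : (s : WithTop ℕ∞) ≤ ∞ := by
  exact_mod_cast (le_top : (s : ℕ∞) ≤ ⊤)

/-- The map `f` is `δ`-close to `g` on `K` in the charts `c` and `d`, up to order `s`. -/
def JetClose (c d : OpenPartialHomeomorph N (Euc m)) (s : ℕ) (δ : ℝ) (K : Set N)
    (g f : N → N) : Prop :=
  MapsTo f K d.source ∧ ∀ j ≤ s, ∀ x ∈ K, ‖iteratedFDeriv ℝ j (d ∘ f ∘ c.symm) (c x)
    - iteratedFDeriv ℝ j (d ∘ g ∘ c.symm) (c x)‖ < δ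

/-- By contradiction and compactness: if no `δ` worked, maps that are `1 / (k + 1)`-close to the
identity would violate the estimate at points accumulating at some `x₀ ∈ K`. The jets of the two
perturbations there converge to those of the identity, so the jets of the composition converge to
those of `T`. The margin between `K` and `Q` keeps the image of the bad point under `b` in `Q`,
where the control of `a` applies. -/
lemma exists_jetClose_comp [T2Space N] [FirstCountableTopology N]
    {c d : OpenPartialHomeomorph N (Euc m)}
    (hc : c ∈ IsManifold.maximalAtlas (𝓡 m) ∞ N) (hd : d ∈ IsManifold.maximalAtlas (𝓡 m) ∞ N)
    {K Q : Set N} (hK : IsCompact K) (hKQ : K ⊆ interior Q) (hQc : Q ⊆ c.source) {T : N → N}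
    (s : ℕ) (hT : ContMDiff (𝓡 m) (𝓡 m) s T) (hQd : MapsTo T Q d.source) {ε : ℝ} (hε : 0 < ε) :
    ∃ δ > 0, ∀ a b : N → N, ContMDiff (𝓡 m) (𝓡 m) ∞ a → ContMDiff (𝓡 m) (𝓡 m) ∞ b →
      JetClose d d s δ (T '' Q) id a → JetClose c c s δ Q id b →
      JetClose c d s ε K T (a ∘ T ∘ b) := by
  by_contra! hcon
  choose a b ha hb haj hbj hn using fun k : ℕ => hcon (1 / ((k : ℝ) + 1)) (by positivity)
  have hlim : Tendsto (fun k : ℕ => 1 / ((k : ℝ) + 1)) atTop (𝓝 0) :=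
    tendsto_one_div_add_atTop_nhds_zero_nat
  have hKc : K ⊆ c.source := (hKQ.trans interior_subset).trans hQc
  -- a bad point for each index
  have hbad : ∀ k, ∃ x ∈ K, (a k ∘ T ∘ b k) x ∈ d.source → ∃ j ≤ s,
      ε ≤ ‖iteratedFDeriv ℝ j (d ∘ (a k ∘ T ∘ b k) ∘ c.symm) (c x)
        - iteratedFDeriv ℝ j (d ∘ T ∘ c.symm) (c x)‖ := by
    intro k
    by_contra! h
    exact hn k ⟨fun x hx => (h x hx).1, fun j hj x hx => (h x hx).2 j hj⟩
  choose x hxK hx using hbad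
  obtain ⟨x₀, hx₀, φ, hφ, hxφ⟩ := hK.tendsto_subseq hxK
  have hx₀c := hKc hx₀
  have hx₀Q : x₀ ∈ Q := interior_subset (hKQ hx₀)
  have hlimφ := hlim.comp hφ.tendsto_atTop
  have hcx : Tendsto (fun k => c (x (φ k))) atTop (𝓝 (c x₀)) :=
    (c.continuousAt hx₀c).tendsto.comp hxφ
  have hxQ : ∀ k, x (φ k) ∈ Q := fun k => interior_subset (hKQ (hxK _))
  have hxc : ∀ k, x (φ k) ∈ c.source := fun k => hQc (hxQ k)
  have hbc : ∀ k, b (φ k) (x (φ k)) ∈ c.source := fun k => (hbj _).1 (hxQ k)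
  have hcid : ∀ j : ℕ, ∀ x ∈ c.source,
      ContinuousAt (iteratedFDeriv ℝ j (c ∘ id ∘ c.symm)) (c x) := fun j x hx =>
    ContDiffAt.continuousAt_iteratedFDeriv'
      (contDiffAt_chart_rep hc hc (nat_le_infty j) contMDiffAt_id hx hx)
  have hdid : ∀ j : ℕ, ∀ x ∈ d.source,
      ContinuousAt (iteratedFDeriv ℝ j (d ∘ id ∘ d.symm)) (d x) := fun j x hx =>
    ContDiffAt.continuousAt_iteratedFDeriv'
      (contDiffAt_chart_rep hd hd (nat_le_infty j) contMDiffAt_id hx hx)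
  have hbt : ∀ j ≤ s, Tendsto (fun k => iteratedFDeriv ℝ j (c ∘ b (φ k) ∘ c.symm) (c (x (φ k))))
      atTop (𝓝 (iteratedFDeriv ℝ j (c ∘ id ∘ c.symm) (c x₀))) := by
    intro j hj
    have h1 : Tendsto (fun k => iteratedFDeriv ℝ j (c ∘ b (φ k) ∘ c.symm) (c (x (φ k))) -
        iteratedFDeriv ℝ j (c ∘ id ∘ c.symm) (c (x (φ k)))) atTop (𝓝 0) :=
      squeeze_zero_norm (fun k => ((hbj (φ k)).2 j hj _ (hxQ k)).le) hlimφ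
    simpa using h1.add ((hcid j x₀ hx₀c).tendsto.comp hcx)
  have hcb : Tendsto (fun k => c (b (φ k) (x (φ k)))) atTop (𝓝 (c x₀)) := by
    have h1 : Tendsto (fun k => c (b (φ k) (x (φ k))) - c (x (φ k))) atTop (𝓝 0) := by
      refine squeeze_zero_norm (fun k => ?_) hlimφ
      have := ((hbj (φ k)).2 0 (Nat.zero_le _) _ (hxQ k)).le
      rw [norm_iteratedFDeriv_zero_sub] at this
      simpa [c.left_inv (hxc k)] using this
    simpa using h1.add hcx
  have hbx : Tendsto (fun k => b (φ k) (x (φ k))) atTop (𝓝 x₀) := by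
    have h1 := ((c.continuousAt_symm (c.map_source hx₀c)).tendsto.comp hcb)
    rw [c.left_inv hx₀c] at h1
    exact h1.congr fun k => c.left_inv (hbc k)
  have hbQ : ∀ᶠ k in atTop, b (φ k) (x (φ k)) ∈ Q :=
    (hbx.eventually (isOpen_interior.mem_nhds (hKQ hx₀))).mono fun k hk => interior_subset hk
  have hTd : T x₀ ∈ d.source := hQd hx₀Q
  have hdT : ContDiffAt ℝ s (d ∘ T ∘ c.symm) (c x₀) :=
    contDiffAt_chart_rep hc hd (nat_le_infty s) hT.contMDiffAt hx₀c hTd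
  have hdT' : ∀ᶠ y in 𝓝 (c x₀), ContDiffAt ℝ s (d ∘ T ∘ c.symm) y := hdT.eventually (by simp)
  have hTb : ∀ j ≤ s, Tendsto (fun k => iteratedFDeriv ℝ j ((d ∘ T ∘ c.symm) ∘
      (c ∘ b (φ k) ∘ c.symm)) (c (x (φ k)))) atTop
      (𝓝 (iteratedFDeriv ℝ j ((d ∘ T ∘ c.symm) ∘ (c ∘ id ∘ c.symm)) (c x₀))) := by
    intro j hj
    refine tendsto_iteratedFDeriv_comp (v := fun _ => d ∘ T ∘ c.symm) (.of_forall fun k => ?_) ?_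
      ?_ ?_ hbt (fun i hi => ?_) hj
    · exact contDiffAt_chart_rep hc hc (nat_le_infty s)
        ((hb (φ k)).of_le (nat_le_infty s)).contMDiffAt (hxc k) (hbc k)
    · filter_upwards [hcb.eventually hdT'] with k hk
      simpa [c.left_inv (hxc k)] using hk
    · exact contDiffAt_chart_rep hc hc (nat_le_infty s) contMDiffAt_id hx₀c hx₀c
    · simpa [c.left_inv hx₀c] using hdT
    · have h1 : ContinuousAt (iteratedFDeriv ℝ i (d ∘ T ∘ c.symm)) (c x₀) :=
        ContDiffAt.continuousAt_iteratedFDeriv' (hdT.of_le (by exact_mod_cast hi))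
      have h2 := h1.tendsto.comp hcb
      simp only [Function.comp_apply, id_eq, c.left_inv hx₀c]
      refine h2.congr fun k => ?_
      simp [c.left_inv (hxc k)]
  have hpt : ∀ k, ((d ∘ T ∘ c.symm) ∘ (c ∘ b (φ k) ∘ c.symm)) (c (x (φ k))) =
      d (T (b (φ k) (x (φ k)))) := fun k => by simp [c.left_inv (hxc k), c.left_inv (hbc k)]
  have hpt₀ : ((d ∘ T ∘ c.symm) ∘ (c ∘ id ∘ c.symm)) (c x₀) = d (T x₀) := by
    simp [c.left_inv hx₀c]
  have hdTb : Tendsto (fun k => d (T (b (φ k) (x (φ k))))) atTop (𝓝 (d (T x₀))) :=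
    ((d.continuousAt hTd).comp hT.continuous.continuousAt).tendsto.comp hbx
  have haTb : ∀ j ≤ s, Tendsto (fun k => iteratedFDeriv ℝ j ((d ∘ a (φ k) ∘ d.symm) ∘
      ((d ∘ T ∘ c.symm) ∘ (c ∘ b (φ k) ∘ c.symm))) (c (x (φ k)))) atTop
      (𝓝 (iteratedFDeriv ℝ j ((d ∘ id ∘ d.symm) ∘ ((d ∘ T ∘ c.symm) ∘ (c ∘ id ∘ c.symm)))
        (c x₀))) := by
    intro j hj
    refine tendsto_iteratedFDeriv_comp (v := fun k => d ∘ a (φ k) ∘ d.symm) ?_ ?_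
      ?_ ?_ hTb (fun i hi => ?_) hj
    · filter_upwards [hcb.eventually hdT'] with k hk
      refine ContDiffAt.comp (g := d ∘ T ∘ c.symm) _ (by simpa [c.left_inv (hxc k)] using hk) ?_
      exact contDiffAt_chart_rep hc hc (nat_le_infty s)
        ((hb (φ k)).of_le (nat_le_infty s)).contMDiffAt (hxc k) (hbc k)
    · filter_upwards [hbQ] with k hk
      rw [hpt]
      exact contDiffAt_chart_rep hd hd (nat_le_infty s)
        ((ha (φ k)).of_le (nat_le_infty s)).contMDiffAt (hQd hk) ((haj _).1 ⟨_, hk, rfl⟩)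
    · refine ContDiffAt.comp (g := d ∘ T ∘ c.symm) _ (by simpa [c.left_inv hx₀c] using hdT) ?_
      exact contDiffAt_chart_rep hc hc (nat_le_infty s) contMDiffAt_id hx₀c hx₀c
    · rw [hpt₀]
      exact contDiffAt_chart_rep hd hd (nat_le_infty s) contMDiffAt_id hTd hTd
    · simp only [hpt, hpt₀]
      have h1 : Tendsto (fun k => iteratedFDeriv ℝ i (d ∘ a (φ k) ∘ d.symm)
          (d (T (b (φ k) (x (φ k))))) - iteratedFDeriv ℝ i (d ∘ id ∘ d.symm)
          (d (T (b (φ k) (x (φ k)))))) atTop (𝓝 0) := by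
        refine squeeze_zero_norm' ?_ hlimφ
        filter_upwards [hbQ] with k hk using ((haj (φ k)).2 i hi _ ⟨_, hk, rfl⟩).le
      simpa using h1.add ((hdid i _ hTd).tendsto.comp hdTb)
  have heq₀ : ((d ∘ id ∘ d.symm) ∘ ((d ∘ T ∘ c.symm) ∘ (c ∘ id ∘ c.symm))) =ᶠ[𝓝 (c x₀)]
      d ∘ T ∘ c.symm := by
    have h1 : ∀ᶠ y in 𝓝 (c x₀), T (c.symm y) ∈ d.source := by
      have h2 : ContinuousAt (fun y => T (c.symm y)) (c x₀) :=
        hT.continuous.continuousAt.comp (c.continuousAt_symm (c.map_source hx₀c))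
      exact h2.eventually (d.open_source.mem_nhds (by simpa [c.left_inv hx₀c] using hTd))
    filter_upwards [h1, c.open_target.mem_nhds (c.map_source hx₀c)] with y hy hyc
    simp [c.right_inv hyc, d.left_inv hy]
  have heq : ∀ᶠ k in atTop, ((d ∘ a (φ k) ∘ d.symm) ∘ ((d ∘ T ∘ c.symm) ∘
      (c ∘ b (φ k) ∘ c.symm))) =ᶠ[𝓝 (c (x (φ k)))] d ∘ (a (φ k) ∘ T ∘ b (φ k)) ∘ c.symm := by
    filter_upwards [hbQ] with k hk
    have hsym := c.continuousAt_symm (c.map_source (hxc k))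
    have h0 : ContinuousAt (fun y => b (φ k) (c.symm y)) (c (x (φ k))) :=
      (hb (φ k)).continuous.continuousAt.comp hsym
    have h1 : ∀ᶠ y in 𝓝 (c (x (φ k))), b (φ k) (c.symm y) ∈ c.source := by
      exact h0.eventually (c.open_source.mem_nhds (by simpa [c.left_inv (hxc k)] using hbc k))
    have h2 : ∀ᶠ y in 𝓝 (c (x (φ k))), T (b (φ k) (c.symm y)) ∈ d.source := by
      have h3 : ContinuousAt (fun y => T (b (φ k) (c.symm y))) (c (x (φ k))) :=
        hT.continuous.continuousAt.comp h0
      exact h3.eventually (d.open_source.mem_nhds (by simpa [c.left_inv (hxc k)] using hQd hk))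
    filter_upwards [h1, h2] with y hy1 hy2
    simp [c.left_inv hy1, d.left_inv hy2]
  have hfin : ∀ j ≤ s, ∀ᶠ k in atTop,
      ‖iteratedFDeriv ℝ j (d ∘ (a (φ k) ∘ T ∘ b (φ k)) ∘ c.symm) (c (x (φ k)))
        - iteratedFDeriv ℝ j (d ∘ T ∘ c.symm) (c (x (φ k)))‖ < ε := by
    intro j hj
    have h1 := haTb j hj
    rw [(heq₀.iteratedFDeriv ℝ j).eq_of_nhds] at h1
    have h2 := (ContDiffAt.continuousAt_iteratedFDeriv'
      (hdT.of_le (m := j) (by exact_mod_cast hj))).tendsto.comp hcx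
    have h3 := (h1.sub h2).norm
    rw [sub_self, norm_zero] at h3
    filter_upwards [h3.eventually_lt_const hε, heq] with k hk hk'
    rwa [(hk'.iteratedFDeriv ℝ j).eq_of_nhds] at hk
  have hfin' : ∀ᶠ k in atTop, ∀ j ∈ Finset.range (s + 1),
      ‖iteratedFDeriv ℝ j (d ∘ (a (φ k) ∘ T ∘ b (φ k)) ∘ c.symm) (c (x (φ k)))
        - iteratedFDeriv ℝ j (d ∘ T ∘ c.symm) (c (x (φ k)))‖ < ε := by
    rw [Filter.eventually_all_finset]
    intro j hj
    exact hfin j (by simpa [Nat.lt_succ_iff] using hj)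
  obtain ⟨k, hk, hkQ⟩ := (hfin'.and hbQ).exists
  -- The chart condition for the composition is automatic here: `b` sends the point into `Q` and `a`
  -- sends `T '' Q` into the domain of `d`.
  obtain ⟨j, hj, hle⟩ := hx (φ k) ((haj (φ k)).1 ⟨_, hkQ, rfl⟩)
  exact absurd (hk j (by simpa [Nat.lt_succ_iff] using hj)) (not_lt.2 hle)

/-- A locally finite sequence of compact sets has a locally finite sequence of compact
neighbourhoods inside given open neighbourhoods. -/
lemma exists_locallyFinite_thickening {X : Type*} [TopologicalSpace X] [T2Space X]
    [LocallyCompactSpace X] [SigmaCompactSpace X] {K U : ℕ → Set X} (hK : ∀ k, IsCompact (K k))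
    (hlf : LocallyFinite K) (hU : ∀ k, IsOpen (U k)) (hKU : ∀ k, K k ⊆ U k) :
    ∃ Q : ℕ → Set X, LocallyFinite Q ∧
      ∀ k, IsCompact (Q k) ∧ K k ⊆ interior (Q k) ∧ Q k ⊆ U k := by
  classical
  let C := CompactExhaustion.choice X
  -- The set `Z k` gathers the exhaustion sets of index at most `k` that miss `K k`. If the
  -- thickening of `K k` avoids it, then `C i` can meet that thickening only when `k < i` or when `C
  -- i` meets `K k` itself, that is, for finitely many `k`.
  let Z : ℕ → Set X := fun k => ⋃ i ∈ {i ∈ Finset.range (k + 1) | Disjoint (C i) (K k)}, C i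
  have hZ : ∀ k, IsClosed (Z k) := fun k =>
    isClosed_biUnion_finset fun i _ => (C.isCompact i).isClosed
  have h : ∀ k, ∃ Q, IsCompact Q ∧ K k ⊆ interior Q ∧ Q ⊆ U k ∩ (Z k)ᶜ := fun k => by
    refine exists_compact_between (hK k) ((hU k).inter (hZ k).isOpen_compl)
      (subset_inter (hKU k) fun x hx hxZ => ?_)
    simp only [Z, mem_iUnion, Finset.mem_filter] at hxZ
    obtain ⟨i, ⟨-, hi⟩, hxi⟩ := hxZ
    exact disjoint_left.1 hi hxi hx
  choose Q hQ hKQ hQU using h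
  refine ⟨Q, fun x => ?_, fun k => ⟨hQ k, hKQ k, (hQU k).trans inter_subset_left⟩⟩
  obtain ⟨i, hi⟩ := C.exists_mem_nhds x
  refine ⟨C i, hi, ?_⟩
  refine ((hlf.finite_nonempty_inter_compact (C.isCompact i)).union (finite_lt_nat i)).subset ?_
  rintro k ⟨y, hyQ, hyC⟩
  by_contra hk
  simp only [mem_union, mem_ofPred_eq, not_or, not_lt, not_nonempty_iff_eq_empty] at hk
  refine (hQU k hyQ).2 ?_
  simp only [Z, mem_iUnion, Finset.mem_filter, Finset.mem_range]
  exact ⟨i, ⟨by omega, by rw [disjoint_iff_inter_eq_empty, inter_comm]; exact hk.1⟩, hyC⟩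

/-- Continuity of composition in the strong topology: composing `T` on both sides with smooth maps
strongly close to the identity gives maps strongly close to `T`. -/
theorem exists_strongNhd_comp [T2Space N] [SecondCountableTopology N] {r : ℕ∞}
    (T : N ≃ₘ^r⟮𝓡 m, 𝓡 m⟯ N) (W : StrongNhdData m N r) (hW : W.IsAt T) :
    ∃ W₁ : StrongNhdData m N r, W₁.IsAt id ∧ ∀ a b : N → N, ContMDiff (𝓡 m) (𝓡 m) ∞ a →
      ContMDiff (𝓡 m) (𝓡 m) ∞ b → W₁.Contains id a → W₁.Contains id b →
      W.Contains T (a ∘ T ∘ b) := by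
  have : LocallyCompactSpace N := ChartedSpace.locallyCompactSpace (Euc m) N
  have hTs : ContMDiff (𝓡 m) (𝓡 m) W.s T :=
    T.contMDiff_toFun.of_le (by exact_mod_cast W.s_le)
  obtain ⟨Q, hQlf, hQ⟩ := exists_locallyFinite_thickening W.isCompact_K W.locallyFinite_K
    (U := fun k => (W.c k).source ∩ T ⁻¹' (W.d k).source)
    (fun k => (W.c k).open_source.inter ((W.d k).open_source.preimage T.continuous))
    (fun k => subset_inter (W.K_subset k) (hW k))
  have hδ := fun k => exists_jetClose_comp (W.c_mem k) (W.d_mem k) (W.isCompact_K k) (hQ k).2.1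
    ((hQ k).2.2.trans inter_subset_left) W.s hTs (fun x hx => ((hQ k).2.2 hx).2) (W.ε_pos k)
  choose δ hδpos hδ using hδ
  let e := Equiv.natSumNatEquivNat
  have hlf' : LocallyFinite fun k => T '' Q k := by
    intro y
    obtain ⟨U, hU, hUf⟩ := hQlf (T.symm y)
    refine ⟨T.symm ⁻¹' U, T.symm.continuous.continuousAt.preimage_mem_nhds hU,
      hUf.subset fun k => ?_⟩
    rintro ⟨_, ⟨x, hx, rfl⟩, hxU⟩
    refine ⟨x, hx, ?_⟩
    simpa using hxU
  -- Two families of conditions are interleaved: the sets `Q k` in the source charts control the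
  -- inner factor, the sets `T '' Q k` in the target charts control the outer one.
  let W₁ : StrongNhdData m N r :=
    { K := Sum.elim Q (fun k => T '' Q k) ∘ e.symm
      c := Sum.elim W.c W.d ∘ e.symm
      d := Sum.elim W.c W.d ∘ e.symm
      ε := Sum.elim δ δ ∘ e.symm
      s := W.s
      isCompact_K := fun k => by
        simp only [Function.comp_apply]
        rcases e.symm k with k | k
        exacts [(hQ k).1, (hQ k).1.image T.continuous]
      locallyFinite_K := (hQlf.sumElim hlf').comp_injective e.symm.injective
      c_mem := fun k => by
        simp only [Function.comp_apply]
        rcases e.symm k with k | k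
        exacts [W.c_mem k, W.d_mem k]
      d_mem := fun k => by
        simp only [Function.comp_apply]
        rcases e.symm k with k | k
        exacts [W.c_mem k, W.d_mem k]
      K_subset := fun k => by
        simp only [Function.comp_apply]
        rcases e.symm k with k | k
        · exact (hQ k).2.2.trans inter_subset_left
        · rintro _ ⟨x, hx, rfl⟩
          exact ((hQ k).2.2 hx).2
      ε_pos := fun k => by
        simp only [Function.comp_apply]
        rcases e.symm k with k | k
        exacts [hδpos k, hδpos k]
      s_le := W.s_le }
  refine ⟨W₁, fun k => W₁.K_subset k, fun a b ha hb hWa hWb k => ?_⟩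
  refine hδ k a b ha hb ?_ ?_
  · have := hWa (e (Sum.inr k))
    simpa [W₁, JetClose] using this
  · have := hWb (e (Sum.inl k))
    simpa [W₁, JetClose] using this

end Whitney
end SymplecticIFS
end

/-! ### Small members of a symplectic family: jets and lengths -/

noncomputable section
namespace SymplecticIFS

section Metric

variable {m : ℕ} {N : Type*} [TopologicalSpace N] [ChartedSpace (Euc m) N]
  [IsManifold (𝓡 m) ∞ N]
  (g : Bundle.ContinuousRiemannianMetric (Euc m) (fun x : N => TangentSpace (𝓡 m) x))

/-- A continuous Riemannian metric in a chart. -/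
lemma exists_metric_in_chart (x₀ : N) : ∃ G : N → Euc m →L[ℝ] Euc m →L[ℝ] ℝ,
    ContinuousAt G x₀ ∧ (∀ w ≠ 0, 0 < G x₀ w w) ∧
    ∀ y ∈ (chartAt (Euc m) x₀).source, ∀ v : Euc m,
      tangentLength g y v = √(G y (tmap (m := m) (chartAt (Euc m) x₀) y v)
        (tmap (m := m) (chartAt (Euc m) x₀) y v)) := by
  set G : N → Euc m →L[ℝ] Euc m →L[ℝ] ℝ := fun y =>
    ContinuousLinearMap.inCoordinates (Euc m) (TangentSpace (𝓡 m))
    (Euc m →L[ℝ] ℝ) (fun x => TangentSpace (𝓡 m) x →L[ℝ] ℝ) x₀ y x₀ y (g.inner y) with hG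
  have hGeq : ∀ y ∈ (chartAt (Euc m) x₀).source, ∀ v : Euc m,
      G y (tmap (m := m) (chartAt (Euc m) x₀) y v) (tmap (m := m) (chartAt (Euc m) x₀) y v) =
        g.inner y v v := by
    intro y hy v
    have hy' : y ∈ (trivializationAt (Euc m) (TangentSpace (𝓡 m)) x₀).baseSet := by simpa using hy
    rw [hG]
    simp only
    rw [inCoordinates_apply_eq₂ hy' hy' (Set.mem_univ _)]
    have hA : (trivializationAt (Euc m) (TangentSpace (𝓡 m)) x₀).symm y
        (tmap (m := m) (chartAt (Euc m) x₀) y v) = v := by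
      have h1 := TangentBundle.continuousLinearMapAt_trivializationAt (I := 𝓡 m) hy
      have h2 : tmap (m := m) (chartAt (Euc m) x₀) y v =
          (trivializationAt (Euc m) (TangentSpace (𝓡 m)) x₀).continuousLinearMapAt ℝ y v := by
        rw [h1]; rfl
      rw [h2]
      have h3 := (trivializationAt (Euc m) (TangentSpace (𝓡 m)) x₀).symmL_continuousLinearMapAt
        (R := ℝ) hy' v
      exact (Bundle.Trivialization.symmL_apply _ hy' _).symm.trans h3
    rw [hA]
    simp
  refine ⟨G, ?_, fun w hw => ?_, fun y hy v => ?_⟩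
  · have W := g.continuous.continuousAt (x := x₀)
    simp only [continuousAt_hom_bundle] at W
    exact W.2
  · have hx₀ := mem_chart_source (Euc m) x₀
    have hc := IsManifold.chart_mem_maximalAtlas (I := 𝓡 m) (n := ∞) x₀
    have h1 := tmap_chart_tmap_symm hc ((chartAt (Euc m) x₀).map_source hx₀) w
    rw [(chartAt (Euc m) x₀).left_inv hx₀] at h1
    have h2 := hGeq x₀ hx₀ (tmap (m := m) (chartAt (Euc m) x₀).symm (chartAt (Euc m) x₀ x₀) w)
    rw [h1] at h2
    rw [h2]
    refine g.pos x₀ _ fun h0 => hw ?_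
    rw [← h1]
    exact (congrArg (tmap (m := m) (chartAt (Euc m) x₀) x₀) h0).trans (map_zero _)
  · rw [hGeq y hy v]
    rfl

end Metric

section Family

variable {n : ℕ} {N : Type*} [TopologicalSpace N] [ChartedSpace (Euc (2 * n)) N]
  {Ω : SymplecticForm n N} {P : Type} [NormedAddCommGroup P] [NormedSpace ℝ P]
  (A : SympFamily Ω P)

namespace SympFamily

lemma contMDiffAt_uncurry {z : P × N} (hz : z.1 ∈ Metric.ball (0 : P) A.ε) :
    ContMDiffAt (𝓘(ℝ, P).prod (𝓡 (2 * n))) (𝓡 (2 * n)) ∞ (fun z : P × N => A.F z.1 z.2) z :=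
  A.smooth.contMDiffAt ((Metric.isOpen_ball.prod isOpen_univ).mem_nhds ⟨hz, mem_univ _⟩)

lemma continuousAt_uncurry (x : N) : ContinuousAt (fun z : P × N => A.F z.1 z.2) (0, x) :=
  (A.contMDiffAt_uncurry (z := (0, x)) (Metric.mem_ball_self A.ε_pos)).continuousAt

lemma contMDiff_F {p : P} (hp : p ∈ Metric.ball (0 : P) A.ε) :
    ContMDiff (𝓡 (2 * n)) (𝓡 (2 * n)) ∞ (A.F p) := fun x =>
  ContMDiffAt.comp (g := fun z : P × N => A.F z.1 z.2) x (A.contMDiffAt_uncurry (z := (p, x)) hp)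
    (contMDiffAt_const.prodMk contMDiffAt_id)

lemma eventually_mem_ball : ∀ᶠ p in 𝓝 (0 : P), p ∈ Metric.ball (0 : P) A.ε :=
  Metric.ball_mem_nhds 0 A.ε_pos

lemma eventually_mapsTo {K U : Set N} (hK : IsCompact K) (hU : IsOpen U) (hKU : K ⊆ U) :
    ∀ᶠ p in 𝓝 (0 : P), MapsTo (A.F p) K U := by
  refine hK.eventually_forall_of_forall_eventually (P := fun p x => A.F p x ∈ U) fun x hx => ?_
  refine (A.continuousAt_uncurry x).eventually (hU.mem_nhds ?_)
  simpa [A.zero x] using hKU hx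

/-- Joint smoothness of the family in charts. -/
lemma contDiffAt_rep {c d : OpenPartialHomeomorph N (Euc (2 * n))}
    (hc : c ∈ IsManifold.maximalAtlas (𝓡 (2 * n)) ∞ N)
    (hd : d ∈ IsManifold.maximalAtlas (𝓡 (2 * n)) ∞ N) {x : N} (hxc : x ∈ c.source)
    (hxd : x ∈ d.source) :
    ContDiffAt ℝ ∞ (fun z : P × Euc (2 * n) => d (A.F z.1 (c.symm z.2))) (0, c x) := by
  have h1 : ContMDiffAt 𝓘(ℝ, Euc (2 * n)) (𝓡 (2 * n)) ∞ c.symm (c x) :=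
    (contMDiffOn_symm_of_mem_maximalAtlas hc).contMDiffAt
      (c.open_target.mem_nhds (c.map_source hxc))
  have h2 : ContMDiffAt (𝓡 (2 * n)) 𝓘(ℝ, Euc (2 * n)) ∞ d x :=
    (contMDiffOn_of_mem_maximalAtlas hd).contMDiffAt (d.open_source.mem_nhds hxd)
  have h3 := c.left_inv hxc
  rw [← contMDiffAt_iff_contDiffAt]
  have h4 : ContMDiffAt 𝓘(ℝ, P × Euc (2 * n)) (𝓘(ℝ, P).prod (𝓡 (2 * n))) ∞
      (fun z : P × Euc (2 * n) => (z.1, c.symm z.2)) (0, c x) :=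
    contDiff_fst.contMDiff.contMDiffAt.prodMk
      (ContMDiffAt.comp (g := c.symm) (0, c x) h1 contDiff_snd.contMDiff.contMDiffAt)
  have h5 := ContMDiffAt.comp (g := fun z : P × N => A.F z.1 z.2) (0, c x)
    (A.contMDiffAt_uncurry (z := (0, c.symm (c x))) (Metric.mem_ball_self A.ε_pos)) h4
  exact ContMDiffAt.comp (g := d) _ (by simpa [h3, A.zero x] using h2) h5

lemma eventually_jetClose {c d : OpenPartialHomeomorph N (Euc (2 * n))}
    (hc : c ∈ IsManifold.maximalAtlas (𝓡 (2 * n)) ∞ N)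
    (hd : d ∈ IsManifold.maximalAtlas (𝓡 (2 * n)) ∞ N) {K : Set N} (hK : IsCompact K)
    (hKc : K ⊆ c.source) (hKd : K ⊆ d.source) (s : ℕ) {δ : ℝ} (hδ : 0 < δ) :
    ∀ᶠ p in 𝓝 (0 : P), JetClose c d s δ K id (A.F p) := by
  refine (A.eventually_mapsTo hK d.open_source hKd).and ?_
  have hK' : IsCompact (c '' K) := hK.image_of_continuousOn (c.continuousOn.mono hKc)
  have h1 : ∀ j ∈ Finset.range (s + 1), ∀ᶠ p in 𝓝 (0 : P), ∀ y ∈ c '' K,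
      ‖iteratedFDeriv ℝ j (fun y => d (A.F p (c.symm y))) y -
        iteratedFDeriv ℝ j (fun y => d (A.F 0 (c.symm y))) y‖ < δ := fun j _ => by
    refine eventually_iteratedFDeriv_partial_lt
      (f := fun z : P × Euc (2 * n) => d (A.F z.1 (c.symm z.2))) hK' ?_ hδ
    rintro _ ⟨x, hx, rfl⟩
    exact (A.contDiffAt_rep hc hd (hKc hx) (hKd hx)).of_le (nat_le_infty j)
  filter_upwards [(Filter.eventually_all_finset _).2 h1] with p hp j hj x hx
  have h2 := hp j (by simpa [Nat.lt_succ_iff] using hj) _ ⟨x, hx, rfl⟩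
  simp only [A.zero] at h2
  exact h2

/-- The displacement of the family in a chart, cut off by a function `β`. -/
def displacement (c : OpenPartialHomeomorph N (Euc (2 * n))) (β : Euc (2 * n) → ℝ) (p : P)
    (y : Euc (2 * n)) : Euc (2 * n) := β y • (c (A.F p (c.symm y)) - y)

/-- The cut-off displacement depends smoothly on the parameter, vanishes for parameter zero and has
support in a fixed compact set, so any given `C^k` norm is small for small parameters. These norms
are the terms of the series used for gluing. -/
lemma eventually_displacement {c : OpenPartialHomeomorph N (Euc (2 * n))}
    (hc : c ∈ IsManifold.maximalAtlas (𝓡 (2 * n)) ∞ N) {β : Euc (2 * n) → ℝ}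
    (hβ : ContDiff ℝ ∞ β) (hβs : HasCompactSupport β) (hβc : tsupport β ⊆ c.target)
    (k : ℕ) {δ : ℝ} (hδ : 0 < δ) :
    ∀ᶠ p in 𝓝 (0 : P), MapsTo (A.F p) (c.symm '' tsupport β) c.source ∧
      ContDiff ℝ ∞ (A.displacement c β p) ∧
      ∀ j ≤ k, ∀ y, ‖iteratedFDeriv ℝ j (A.displacement c β p) y‖ ≤ δ := by
  have hK : IsCompact (c.symm '' tsupport β) :=
    hβs.isCompact.image_of_continuousOn (c.continuousOn_symm.mono hβc)
  have hKc : c.symm '' tsupport β ⊆ c.source := by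
    rintro _ ⟨y, hy, rfl⟩
    exact c.map_target (hβc hy)
  have h0 : A.displacement c β 0 = 0 := by
    funext y
    by_cases hy : y ∈ tsupport β
    · simp [displacement, A.zero, c.right_inv (hβc hy)]
    · simp [displacement, image_eq_zero_of_notMem_tsupport hy]
  have hoff : ∀ p, ∀ y ∉ tsupport β, A.displacement c β p =ᶠ[𝓝 y] 0 := by
    intro p y hy
    filter_upwards [(isClosed_tsupport β).isOpen_compl.mem_nhds hy] with z hz
    simp [displacement, image_eq_zero_of_notMem_tsupport hz]
  have h1 : ∀ j ∈ Finset.range (k + 1), ∀ᶠ p in 𝓝 (0 : P), ∀ y ∈ tsupport β,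
      ‖iteratedFDeriv ℝ j (A.displacement c β p) y -
        iteratedFDeriv ℝ j (A.displacement c β 0) y‖ < δ := fun j _ => by
    refine eventually_iteratedFDeriv_partial_lt
      (f := fun z : P × Euc (2 * n) => A.displacement c β z.1 z.2) hβs.isCompact ?_ hδ
    intro y hy
    have h2 := A.contDiffAt_rep hc hc (c.map_target (hβc hy)) (c.map_target (hβc hy))
    rw [c.right_inv (hβc hy)] at h2
    exact ((hβ.comp contDiff_snd).contDiffAt.smul (h2.sub contDiffAt_snd)).of_le (nat_le_infty j)
  filter_upwards [A.eventually_mapsTo hK c.open_source hKc, A.eventually_mem_ball,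
    (Filter.eventually_all_finset _).2 h1] with p hp hpb hpj
  refine ⟨hp, contDiff_iff_contDiffAt.2 fun y => ?_, fun j hj y => ?_⟩
  · by_cases hy : y ∈ tsupport β
    · have h2 := contDiffAt_chart_rep hc hc le_rfl (A.contMDiff_F hpb).contMDiffAt
        (c.map_target (hβc hy)) (hp ⟨y, hy, rfl⟩)
      rw [c.right_inv (hβc hy)] at h2
      exact hβ.contDiffAt.smul (h2.sub contDiffAt_id)
    · exact contDiffAt_const.congr_of_eventuallyEq (hoff p y hy)
  · by_cases hy : y ∈ tsupport β
    · have h2 := hpj j (by simpa [Nat.lt_succ_iff] using hj) y hy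
      rw [h0] at h2
      simpa [Pi.zero_def] using h2.le
    · rw [((hoff p y hy).iteratedFDeriv ℝ j).eq_of_nhds]
      simpa [Pi.zero_def] using hδ.le

lemma mdifferentiable {f : N → N} (hf : ContMDiff (𝓡 (2 * n)) (𝓡 (2 * n)) ∞ f) (x : N) :
    MDifferentiableAt (𝓡 (2 * n)) (𝓡 (2 * n)) f x := hf.contMDiffAt.mdifferentiableAt (by simp)

/-- For small parameters the family distorts lengths by a factor at most two. -/
lemma eventually_tangentLength_le [IsManifold (𝓡 (2 * n)) ∞ N]
    (g : Bundle.ContinuousRiemannianMetric (Euc (2 * n))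
      (fun x : N => TangentSpace (𝓡 (2 * n)) x)) :
    ∀ᶠ p in 𝓝 (0 : P), ∀ x ∈ A.S, ∀ v : Euc (2 * n),
      tangentLength g (A.F p x) (tmap (A.F p) x v) ≤ 2 * tangentLength g x v := by
  refine A.isCompact_S.eventually_forall_of_forall_eventually fun x₀ _ => ?_
  obtain ⟨G, hG, hGpos, hGeq⟩ := exists_metric_in_chart g x₀
  set c := chartAt (Euc (2 * n)) x₀
  have hx₀ : x₀ ∈ c.source := mem_chart_source _ x₀
  have hc : c ∈ IsManifold.maximalAtlas (𝓡 (2 * n)) ∞ N := IsManifold.chart_mem_maximalAtlas x₀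
  -- the derivative in the chart
  let D : P × N → Euc (2 * n) →L[ℝ] Euc (2 * n) := fun z =>
    fderiv ℝ (fun y => c (A.F z.1 (c.symm y))) (c z.2)
  have hD : ContinuousAt D (0, x₀) := by
    have h1 := continuousAt_iteratedFDeriv_partial (i := 1)
      ((A.contDiffAt_rep hc hc hx₀ hx₀).of_le (nat_le_infty 1))
    have h2 : ContinuousAt (fun z : P × Euc (2 * n) =>
        fderiv ℝ (fun y => c (A.F z.1 (c.symm y))) z.2) (0, c x₀) := by
      have h3 := (continuousMultilinearCurryFin1 ℝ (Euc (2 * n))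
        (Euc (2 * n))).continuous.continuousAt.comp h1
      refine h3.congr (.of_forall fun z => ?_)
      ext v
      simp [iteratedFDeriv_one_apply]
    exact ContinuousAt.comp (f := fun z : P × N => (z.1, c z.2)) h2
      (continuousAt_fst.prodMk (ContinuousAt.comp (g := c) (f := Prod.snd)
        (x := ((0 : P), x₀)) (c.continuousAt hx₀) continuousAt_snd))
  have hD₀ : D (0, x₀) = ContinuousLinearMap.id ℝ _ := by
    have h1 : (fun y => c (A.F 0 (c.symm y))) =ᶠ[𝓝 (c x₀)] id := by
      filter_upwards [c.open_target.mem_nhds (c.map_source hx₀)] with y hy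
      simp [A.zero, c.right_inv hy]
    exact h1.fderiv_eq.trans fderiv_id
  have hFz : ContinuousAt (fun z : P × N => A.F z.1 z.2) (0, x₀) := A.continuousAt_uncurry x₀
  have hF₀ : A.F 0 x₀ = x₀ := A.zero x₀
  -- At `(0, x₀)` the derivative is the identity and `G < 4 G` strictly; compactness of the unit
  -- sphere makes the inequality persist nearby. The factor `4` for squared lengths becomes `2` for
  -- lengths.
  have hquad : ∀ᶠ z in 𝓝 ((0 : P), x₀), ∀ w ∈ Metric.sphere (0 : Euc (2 * n)) 1,
      G (A.F z.1 z.2) (D z w) (D z w) < 4 * G z.2 w w := by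
    refine (isCompact_sphere _ _).eventually_forall_of_forall_eventually fun w hw => ?_
    have hG1 : ContinuousAt (fun q : (P × N) × Euc (2 * n) => G (A.F q.1.1 q.1.2))
        ((0, x₀), w) :=
      ContinuousAt.comp (g := G) (f := fun q : (P × N) × Euc (2 * n) => A.F q.1.1 q.1.2)
        (by simpa [hF₀] using hG) (ContinuousAt.comp (g := fun z : P × N => A.F z.1 z.2)
          (f := Prod.fst) hFz continuousAt_fst)
    have hG2 : ContinuousAt (fun q : (P × N) × Euc (2 * n) => G q.1.2) ((0, x₀), w) :=
      ContinuousAt.comp (g := G) (f := fun q : (P × N) × Euc (2 * n) => q.1.2)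
        hG (continuousAt_snd.comp continuousAt_fst)
    have hD1 : ContinuousAt (fun q : (P × N) × Euc (2 * n) => D q.1 q.2) ((0, x₀), w) :=
      (ContinuousAt.comp (g := D) (f := Prod.fst) hD continuousAt_fst).clm_apply continuousAt_snd
    have h1 := (hG1.clm_apply hD1).clm_apply hD1
    have h2 := ((hG2.clm_apply continuousAt_snd).clm_apply continuousAt_snd).const_mul (4 : ℝ)
    have hw0 : w ≠ 0 := by
      rintro rfl
      simp at hw
    refine h1.eventually_lt h2 ?_
    simp only [hD₀, hF₀, ContinuousLinearMap.id_apply]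
    linarith [hGpos w hw0]
  have hnear : ∀ᶠ z in 𝓝 ((0 : P), x₀), A.F z.1 z.2 ∈ c.source :=
    hFz.eventually (c.open_source.mem_nhds (by simpa [hF₀] using hx₀))
  have hball : ∀ᶠ z in 𝓝 ((0 : P), x₀), z.1 ∈ Metric.ball (0 : P) A.ε :=
    continuousAt_fst.eventually A.eventually_mem_ball
  have hsrc : ∀ᶠ z in 𝓝 ((0 : P), x₀), z.2 ∈ c.source :=
    continuousAt_snd.eventually (c.open_source.mem_nhds hx₀)
  filter_upwards [hquad, hnear, hball, hsrc] with z hz hzF hzb hzc v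
  rw [hGeq _ hzF, hGeq _ hzc]
  set w := tmap (m := 2 * n) c z.2 v with hw
  have hchain : tmap (m := 2 * n) c (A.F z.1 z.2) (tmap (A.F z.1) z.2 v) = D z w := by
    have hF' := mdifferentiable (A.contMDiff_F hzb) z.2
    have h1 := tmap_comp (mdifferentiableAt_chart hc hzF) hF'
    have h2 : c ∘ A.F z.1 =ᶠ[𝓝 z.2] (fun y => c (A.F z.1 (c.symm y))) ∘ c := by
      filter_upwards [c.open_source.mem_nhds hzc] with y hy
      simp [c.left_inv hy]
    have h3 : MDifferentiableAt 𝓘(ℝ, Euc (2 * n)) 𝓘(ℝ, Euc (2 * n))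
        (fun y => c (A.F z.1 (c.symm y))) (c z.2) :=
      ((contDiffAt_chart_rep hc hc le_rfl (A.contMDiff_F hzb).contMDiffAt hzc
        hzF).differentiableAt (by simp)).mdifferentiableAt
    rw [tmap_congr h2, tmap_comp h3 (mdifferentiableAt_chart hc hzc), tmap_eq_fderiv] at h1
    exact (congrArg (fun f : Euc (2 * n) →L[ℝ] Euc (2 * n) => f v) h1).symm
  rw [hchain]
  have hle : G (A.F z.1 z.2) (D z w) (D z w) ≤ 4 * G z.2 w w := by
    rcases eq_or_ne w 0 with h0 | h0
    · simp [h0]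
    · have hn : ‖w‖ ≠ 0 := norm_ne_zero_iff.2 h0
      have h1 := hz (‖w‖⁻¹ • w) (by simp [norm_smul, hn])
      simp only [map_smul, smul_apply, smul_eq_mul] at h1
      have h2 : 0 < ‖w‖⁻¹ := by positivity
      have h3 : ‖w‖⁻¹ * (‖w‖⁻¹ * G (A.F z.1 z.2) (D z w) (D z w)) <
          ‖w‖⁻¹ * (‖w‖⁻¹ * (4 * G z.2 w w)) := by linarith
      exact (lt_of_mul_lt_mul_left (lt_of_mul_lt_mul_left h3 h2.le) h2.le).le
  calc √(G (A.F z.1 z.2) (D z w) (D z w)) ≤ √(2 ^ 2 * G z.2 w w) :=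
        Real.sqrt_le_sqrt (by linarith)
    _ = 2 * √(G z.2 w w) := by
        rw [Real.sqrt_mul (by norm_num), Real.sqrt_sq (by norm_num)]

end SympFamily
end Family
end SymplecticIFS
end

/-! ### Gluing maps with disjoint, possibly accumulating, supports -/

noncomputable section
namespace SymplecticIFS

section Jets

variable {E F G : Type*} [NormedAddCommGroup E] [NormedSpace ℝ E] [NormedAddCommGroup F]
  [NormedSpace ℝ F] [NormedAddCommGroup G] [NormedSpace ℝ G]

/-- The jet of a composition only depends on the jets of the factors. -/
lemma iteratedFDeriv_comp_congr {f f' : E → F} {g g' : F → G} {x : E} {s : ℕ}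
    (hf : ContDiffAt ℝ s f x) (hf' : ContDiffAt ℝ s f' x) (hg : ContDiffAt ℝ s g (f x))
    (hg' : ContDiffAt ℝ s g' (f' x))
    (hff : ∀ j ≤ s, iteratedFDeriv ℝ j f x = iteratedFDeriv ℝ j f' x)
    (hgg : ∀ j ≤ s, iteratedFDeriv ℝ j g (f x) = iteratedFDeriv ℝ j g' (f' x)) {j : ℕ}
    (hj : j ≤ s) : iteratedFDeriv ℝ j (g ∘ f) x = iteratedFDeriv ℝ j (g' ∘ f') x :=
  -- Continuity of jets under composition, applied to constant sequences.
  tendsto_nhds_unique (tendsto_const_nhds (f := atTop (α := ℕ)))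
    (tendsto_iteratedFDeriv_comp (u := fun _ => f) (v := fun _ => g) (y := fun _ => x)
      (.of_forall fun _ => hf) (.of_forall fun _ => hg) hf' hg'
      (fun i hi => by rw [hff i hi]; exact tendsto_const_nhds)
      (fun i hi => by rw [hgg i hi]; exact tendsto_const_nhds) hj)

end Jets

/-- A countable cover by chart domains with bump functions. -/
lemma exists_chart_bump_cover (m : ℕ) (N : Type*) [TopologicalSpace N] [ChartedSpace (Euc m) N]
    [IsManifold (𝓡 m) ∞ N] [SecondCountableTopology N] [Nonempty N] :
    ∃ (c : ℕ → OpenPartialHomeomorph N (Euc m)) (β : ℕ → Euc m → ℝ) (U : ℕ → Set N),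
      (∀ l, c l ∈ IsManifold.maximalAtlas (𝓡 m) ∞ N ∧ ContDiff ℝ ∞ (β l) ∧
        HasCompactSupport (β l) ∧ tsupport (β l) ⊆ (c l).target ∧ IsOpen (U l) ∧
        U l ⊆ (c l).source ∧ ∀ x ∈ U l, β l (c l x) = 1) ∧ ⋃ l, U l = univ := by
  have h : ∀ x : N, ∃ f : ContDiffBump (chartAt (Euc m) x x),
      Metric.closedBall (chartAt (Euc m) x x) f.rOut ⊆ (chartAt (Euc m) x).target := by
    intro x
    obtain ⟨r, hr, hsub⟩ := Metric.nhds_basis_closedBall.mem_iff.1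
      ((chartAt (Euc m) x).open_target.mem_nhds (mem_chart_target (Euc m) x))
    exact ⟨⟨r / 2, r, by positivity, by linarith⟩, hsub⟩
  choose f hf using h
  let V : N → Set N := fun x => (chartAt (Euc m) x).source ∩
    chartAt (Euc m) x ⁻¹' Metric.ball (chartAt (Euc m) x x) (f x).rIn
  have hV : ∀ x, IsOpen (V x) := fun x =>
    (chartAt (Euc m) x).isOpen_inter_preimage Metric.isOpen_ball
  have hxV : ∀ x, x ∈ V x := fun x =>
    ⟨mem_chart_source (Euc m) x, Metric.mem_ball_self (f x).rIn_pos⟩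
  obtain ⟨s, hs, hsU⟩ := TopologicalSpace.countable_cover_nhds fun x => (hV x).mem_nhds (hxV x)
  have hne : s.Nonempty := by
    by_contra hcon
    rw [not_nonempty_iff_eq_empty] at hcon
    obtain ⟨x⟩ := ‹Nonempty N›
    have := hsU ▸ mem_univ x
    simp [hcon] at this
  obtain ⟨u, rfl⟩ := hs.exists_eq_range hne
  refine ⟨fun l => chartAt (Euc m) (u l), fun l => f (u l), fun l => V (u l), fun l =>
    ⟨IsManifold.chart_mem_maximalAtlas _, (f (u l)).contDiff, (f (u l)).hasCompactSupport, ?_,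
      hV _, inter_subset_left, fun x hx => ?_⟩, by simpa using hsU⟩
  · rw [(f (u l)).tsupport_eq]; exact hf _
  · exact (f (u l)).one_of_mem_closedBall (Metric.ball_subset_closedBall hx.2)

section Glue

variable {n : ℕ} {N : Type*} [TopologicalSpace N] [ChartedSpace (Euc (2 * n)) N]
  {Ω : SymplecticForm n N} {P : Type} [NormedAddCommGroup P] [NormedSpace ℝ P]
  {ι : Type*}

/-- A point leaving the support would be fixed by the inverse map, which should bring it back. -/
lemma SympFamily.mem_S {A : SympFamily Ω P} {p : P} (hp : p ∈ Metric.ball (0 : P) A.ε) {x : N}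
    (hx : x ∈ A.S) : A.F p x ∈ A.S := by
  by_contra hcon
  have h1 := A.fix (-p) (by simpa using hp) _ hcon
  rw [A.inv p hp] at h1
  exact hcon (h1 ▸ hx)

/-- The map equal to the `i`-th member of the families on the `i`-th support, and to the identity
elsewhere. -/
def glue (A : ι → SympFamily Ω P) (p : ι → P) (x : N) : N :=
  open Classical in if h : ∃ i, x ∈ (A i).S then (A h.choose).F (p h.choose) x else x

/-- The supports of the families are disjoint, and locally finite near each of them. -/
structure Separated (A : ι → SympFamily Ω P) : Prop where
  disj : ∀ i j, i ≠ j → Disjoint (A i).S (A j).S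
  loc : ∀ i, ∀ x ∈ (A i).S, ∃ U ∈ 𝓝 x, {j | ((A j).S ∩ U).Nonempty}.Finite

variable {A : ι → SympFamily Ω P} {p : ι → P}

lemma glue_of_notMem {x : N} (hx : ∀ i, x ∉ (A i).S) : glue A p x = x :=
  dif_neg (by simpa using hx)

lemma glue_of_mem (hA : Separated A) {i : ι} {x : N} (hx : x ∈ (A i).S) :
    glue A p x = (A i).F (p i) x := by
  have h : ∃ i, x ∈ (A i).S := ⟨i, hx⟩
  have h1 : h.choose = i := by
    by_contra hne
    exact disjoint_left.1 (hA.disj _ _ hne) h.choose_spec hx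
  rw [glue, dif_pos h, h1]

lemma glue_neg (hA : Separated A) (hp : ∀ i, p i ∈ Metric.ball (0 : P) (A i).ε) (x : N) :
    glue A (-p) (glue A p x) = x := by
  by_cases h : ∃ i, x ∈ (A i).S
  · obtain ⟨i, hi⟩ := h
    rw [glue_of_mem hA hi, glue_of_mem hA (SympFamily.mem_S (hp i) hi)]
    exact (A i).inv _ (hp i) x
  · push Not at h
    rw [glue_of_notMem h, glue_of_notMem h]

/-- Near a point of one support only finitely many others occur; they are closed and miss the point,
so one member of the family describes the glued map there. -/
lemma glue_eventuallyEq [T2Space N] (hA : Separated A)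
    (hp : ∀ i, p i ∈ Metric.ball (0 : P) (A i).ε) {i : ι} {x : N} (hx : x ∈ (A i).S) :
    glue A p =ᶠ[𝓝 x] (A i).F (p i) := by
  obtain ⟨U, hU, hfin⟩ := hA.loc i x hx
  have h1 : ∀ᶠ y in 𝓝 x, ∀ j ∈ {j | ((A j).S ∩ U).Nonempty} \ {i}, y ∉ (A j).S := by
    rw [Filter.eventually_all_finite (hfin.subset sdiff_subset)]
    intro j hj
    exact (A j).isCompact_S.isClosed.isOpen_compl.mem_nhds fun hxj =>
      disjoint_left.1 (hA.disj j i (by simpa using hj.2)) hxj hx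
  filter_upwards [h1, hU] with y hy hyU
  by_cases hyi : y ∈ (A i).S
  · exact glue_of_mem hA hyi
  · rw [(A i).fix _ (hp i) y hyi]
    refine glue_of_notMem fun j hyj => ?_
    by_cases hji : j = i
    · exact hyi (hji ▸ hyj)
    · exact hy j ⟨⟨y, hyj, hyU⟩, hji⟩ hyj

/-- Near a point outside of the supports, the glued map is a smooth flat perturbation of the
identity. -/
lemma exists_glue_eq_add [T2Space N] (hA : Separated A) (enc : ι → ℕ)
    (henc : Function.Injective enc)
    (hp : ∀ i, p i ∈ Metric.ball (0 : P) (A i).ε)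
    {c : OpenPartialHomeomorph N (Euc (2 * n))} {β : Euc (2 * n) → ℝ} {U : Set N} {l : ℕ}
    (hU : IsOpen U) (hUc : U ⊆ c.source) (hβ : ∀ x ∈ U, β (c x) = 1)
    (hcond : ∀ i, l ≤ enc i → MapsTo ((A i).F (p i)) (c.symm '' tsupport β) c.source ∧
      ContDiff ℝ ∞ ((A i).displacement c β (p i)) ∧
      ∀ j ≤ enc i, ∀ y, ‖iteratedFDeriv ℝ j ((A i).displacement c β (p i)) y‖ ≤
        (1 / 2 : ℝ) ^ (enc i))
    {x : N} (hx : ∀ i, x ∉ (A i).S) (hxU : x ∈ U) (J : ℕ) :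
    ∃ v : Euc (2 * n) → Euc (2 * n), ContDiff ℝ ∞ v ∧
      (∀ j ≤ J, iteratedFDeriv ℝ j v (c x) = 0) ∧
      ∀ᶠ y in 𝓝 x, glue A p y ∈ c.source ∧ c (glue A p y) = c y + v (c y) := by
  classical
  -- Codes at least `l` have controlled displacement in this chart; codes at least `J` have summable
  -- derivatives up to order `J`. The finitely many indices discarded have closed supports missing
  -- `x`, so they do not matter near `x`.
  set L := max l J with hL
  let w : ι → Euc (2 * n) → Euc (2 * n) := fun i =>
    if L ≤ enc i then (A i).displacement c β (p i) else 0
  have hw : ∀ i, ContDiff ℝ ∞ (w i) := by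
    intro i
    by_cases hi : L ≤ enc i
    · simp only [w, if_pos hi]
      exact (hcond i ((le_max_left _ _).trans hi)).2.1
    · simp only [w, if_neg hi]
      exact contDiff_const
  have hbound : ∀ i, ∀ k ≤ enc i, ∀ y, ‖iteratedFDeriv ℝ k (w i) y‖ ≤ (1 / 2 : ℝ) ^ (enc i) := by
    intro i k hk y
    by_cases hi : L ≤ enc i
    · simp only [w, if_pos hi]
      exact (hcond i ((le_max_left _ _).trans hi)).2.2 k hk y
    · simp only [w, if_neg hi]
      rw [show (0 : Euc (2 * n) → Euc (2 * n)) = fun _ => 0 from rfl, iteratedFDeriv_fun_zero]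
      simp
  have hsum : Summable fun i => (1 / 2 : ℝ) ^ (enc i) :=
    (summable_geometric_of_lt_one (by norm_num) (by norm_num)).comp_injective henc
  have hfar : ∀ i, ∀ y ∈ c.source, y ∉ (A i).S → w i (c y) = 0 := by
    intro i y hy hyi
    by_cases hi : L ≤ enc i
    · simp only [w, if_pos hi, SympFamily.displacement, c.left_inv hy, (A i).fix _ (hp i) y hyi,
        sub_self, smul_zero]
    · simp only [w, if_neg hi]
      rfl
  refine ⟨fun y => ∑' i, w i y, ?_, ?_, ?_⟩
  · refine contDiff_tsum_of_eventually (v := fun _ i => (1 / 2 : ℝ) ^ (enc i)) hw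
      (fun _ _ => hsum) fun k _ => ?_
    have hfin : {i | enc i < k}.Finite := (finite_lt_nat k).preimage henc.injOn
    filter_upwards [hfin.compl_mem_cofinite] with i hi y
    exact hbound i k (by simpa using hi) y
  · intro j hj
    have h1 : ∀ (k : ℕ) (i : ι) (y : Euc (2 * n)), (k : ℕ∞) ≤ (J : ℕ∞) →
        ‖iteratedFDeriv ℝ k (w i) y‖ ≤ (1 / 2 : ℝ) ^ (enc i) := by
      intro k i y hk
      have hk' : k ≤ J := by exact_mod_cast hk
      by_cases hi : L ≤ enc i
      · exact hbound i k ((hk'.trans (le_max_right _ _)).trans hi) y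
      · simp only [w, if_neg hi]
        rw [show (0 : Euc (2 * n) → Euc (2 * n)) = fun _ => 0 from rfl, iteratedFDeriv_fun_zero]
        simp
    rw [iteratedFDeriv_tsum_apply (v := fun _ i => (1 / 2 : ℝ) ^ (enc i))
      (fun i => (hw i).of_le (nat_le_infty J)) (fun _ _ => hsum) h1 (by exact_mod_cast hj)]
    -- Each term vanishes on its own neighbourhood of `c x`. No common neighbourhood is needed,
    -- since the series is differentiated term by term.
    have h2 : ∀ i, iteratedFDeriv ℝ j (w i) (c x) = 0 := by
      intro i
      have h3 : w i =ᶠ[𝓝 (c x)] fun _ => 0 := by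
        have h4 := (c.continuousAt_symm (c.map_source (hUc hxU))).eventually
          ((A i).isCompact_S.isClosed.isOpen_compl.mem_nhds
            (by rw [c.left_inv (hUc hxU)]; exact hx i))
        filter_upwards [h4, c.open_target.mem_nhds (c.map_source (hUc hxU))] with y hy hyc
        have h5 := hfar i (c.symm y) (c.map_target hyc) hy
        rwa [c.right_inv hyc] at h5
      rw [(h3.iteratedFDeriv ℝ j).eq_of_nhds, iteratedFDeriv_fun_zero]
      rfl
    simp [h2]
  · have hfin : {i | enc i < L}.Finite := (finite_lt_nat L).preimage henc.injOn
    have h1 : ∀ᶠ y in 𝓝 x, ∀ i ∈ {i | enc i < L}, y ∉ (A i).S := by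
      rw [Filter.eventually_all_finite hfin]
      exact fun i _ => (A i).isCompact_S.isClosed.isOpen_compl.mem_nhds (hx i)
    filter_upwards [h1, hU.mem_nhds hxU] with y hy hyU
    by_cases h : ∃ i, y ∈ (A i).S
    · obtain ⟨i, hi⟩ := h
      have hiL : L ≤ enc i := not_lt.1 fun hlt => hy i hlt hi
      have hβy : c y ∈ tsupport β := subset_tsupport _ (by simp [hβ y hyU])
      have h2 := (hcond i ((le_max_left _ _).trans hiL)).1 ⟨c y, hβy, rfl⟩
      rw [c.left_inv (hUc hyU)] at h2
      rw [glue_of_mem hA hi, tsum_eq_single i]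
      · refine ⟨h2, ?_⟩
        simp [w, if_pos hiL, SympFamily.displacement, hβ y hyU, c.left_inv (hUc hyU)]
      · intro j hj
        exact hfar j y (hUc hyU) fun hyj => disjoint_left.1 (hA.disj j i hj) hyj hi
    · push Not at h
      rw [glue_of_notMem h]
      refine ⟨hUc hyU, ?_⟩
      simp [fun i => hfar i y (hUc hyU) (h i)]

end Glue
end SymplecticIFS
end

/-! ### Flat points and the gluing theorem -/

noncomputable section
namespace SymplecticIFS

section Glue

set_option linter.unusedSectionVars false

variable {n : ℕ} {N : Type*} [TopologicalSpace N] [ChartedSpace (Euc (2 * n)) N]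
  [IsManifold (𝓡 (2 * n)) ∞ N]
  {Ω : SymplecticForm n N} {P : Type} [NormedAddCommGroup P] [NormedSpace ℝ P]
  {ι : Type*} {A : ι → SympFamily Ω P} {p : ι → P} {r : ℕ∞}

/-- Symplectic maps which are close to the identity in the strong topology and distort lengths by
a factor at most two. -/
structure IsNearId (Ω : SymplecticForm n N)
    (g : Bundle.ContinuousRiemannianMetric (Euc (2 * n))
      (fun x : N => TangentSpace (𝓡 (2 * n)) x))
    (W : StrongNhdData (2 * n) N r) (f : N → N) : Prop where
  contMDiff : ContMDiff (𝓡 (2 * n)) (𝓡 (2 * n)) ∞ f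
  symp : IsSymplectic Ω f
  contains : W.Contains id f
  length_le : ∀ (x : N) (v : Euc (2 * n)),
    tangentLength g (f x) (tmap f x v) ≤ 2 * tangentLength g x v

lemma tangentLength_nonneg (g : Bundle.ContinuousRiemannianMetric (Euc (2 * n))
      (fun x : N => TangentSpace (𝓡 (2 * n)) x)) (x : N) (v : Euc (2 * n)) :
    0 ≤ tangentLength g x v := Real.sqrt_nonneg _

/-- Local description of a map near a fixed point, as a flat perturbation of the identity. -/
def IsFlatAt (n : ℕ) {N : Type*} [TopologicalSpace N] [ChartedSpace (Euc (2 * n)) N]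
    (f : N → N) (x : N) : Prop :=
  ∀ J : ℕ, ∃ c ∈ IsManifold.maximalAtlas (𝓡 (2 * n)) ∞ N, x ∈ c.source ∧
    ∃ v : Euc (2 * n) → Euc (2 * n), ContDiff ℝ ∞ v ∧
      (∀ j ≤ J, iteratedFDeriv ℝ j v (c x) = 0) ∧
      ∀ᶠ y in 𝓝 x, f y ∈ c.source ∧ c (f y) = c y + v (c y)

lemma IsFlatAt.contMDiffAt {f : N → N} {x : N} (h : IsFlatAt n f x) :
    ContMDiffAt (𝓡 (2 * n)) (𝓡 (2 * n)) ∞ f x := by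
  obtain ⟨c, hc, hx, v, hv, hv0, hf⟩ := h 0
  have h0 : v (c x) = 0 := by
    rw [← norm_eq_zero, ← norm_iteratedFDeriv_zero (𝕜 := ℝ), hv0 0 le_rfl, norm_zero]
  have h1 : ContMDiffAt (𝓡 (2 * n)) 𝓘(ℝ, Euc (2 * n)) ∞ c x :=
    (contMDiffOn_of_mem_maximalAtlas hc).contMDiffAt (c.open_source.mem_nhds hx)
  have h2 : ContMDiffAt (𝓡 (2 * n)) 𝓘(ℝ, Euc (2 * n)) ∞ (fun y => c y + v (c y)) x :=
    ContMDiffAt.comp (g := fun z => z + v z) x (contDiff_id.add hv).contMDiff.contMDiffAt h1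
  have h3 : ContMDiffAt 𝓘(ℝ, Euc (2 * n)) (𝓡 (2 * n)) ∞ c.symm (c x + v (c x)) := by
    rw [h0, add_zero]
    exact (contMDiffOn_symm_of_mem_maximalAtlas hc).contMDiffAt
      (c.open_target.mem_nhds (c.map_source hx))
  refine (ContMDiffAt.comp (g := c.symm) x h3 h2).congr_of_eventuallyEq ?_
  filter_upwards [hf] with y hy
  rw [Function.comp_apply, ← hy.2, c.left_inv hy.1]

lemma IsFlatAt.apply_eq {f : N → N} {x : N} (h : IsFlatAt n f x) : f x = x := by
  obtain ⟨c, hc, hx, v, hv, hv0, hf⟩ := h 0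
  have h0 : v (c x) = 0 := by
    rw [← norm_eq_zero, ← norm_iteratedFDeriv_zero (𝕜 := ℝ), hv0 0 le_rfl, norm_zero]
  obtain ⟨h1, h2⟩ := hf.self_of_nhds
  rw [h0, add_zero] at h2
  exact c.injOn h1 hx h2

/-- A flat perturbation of the identity has the jets of the identity, in all charts. -/
lemma IsFlatAt.iteratedFDeriv_eq {f : N → N} {x : N} (h : IsFlatAt n f x)
    {c d : OpenPartialHomeomorph N (Euc (2 * n))}
    (hc : c ∈ IsManifold.maximalAtlas (𝓡 (2 * n)) ∞ N)
    (hd : d ∈ IsManifold.maximalAtlas (𝓡 (2 * n)) ∞ N) (hxc : x ∈ c.source) (hxd : x ∈ d.source)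
    (j : ℕ) : iteratedFDeriv ℝ j (d ∘ f ∘ c.symm) (c x) =
      iteratedFDeriv ℝ j (d ∘ id ∘ c.symm) (c x) := by
  have hxf := h.apply_eq
  have hfc := h.contMDiffAt.continuousAt
  obtain ⟨e, he, hx, v, hv, hv0, hf⟩ := h j
  have h0 : v (e x) = 0 := by
    rw [← norm_eq_zero, ← norm_iteratedFDeriv_zero (𝕜 := ℝ), hv0 0 (Nat.zero_le _), norm_zero]
  have hec : ContDiffAt ℝ j (e ∘ id ∘ c.symm) (c x) :=
    contDiffAt_chart_rep hc he (nat_le_infty j) contMDiffAt_id hxc hx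
  have hde : ContDiffAt ℝ j (d ∘ id ∘ e.symm) (e x) :=
    contDiffAt_chart_rep he hd (nat_le_infty j) contMDiffAt_id hx hxd
  have hiv : ContDiff ℝ j (fun z => z + v z) := contDiff_id.add (hv.of_le (nat_le_infty j))
  have hex : (e ∘ id ∘ c.symm) (c x) = e x := by simp [c.left_inv hxc]
  have hev : ∀ᶠ y in 𝓝 (c x), c.symm y ∈ e.source ∧ f (c.symm y) ∈ e.source ∧
      e (f (c.symm y)) = e (c.symm y) + v (e (c.symm y)) := by
    have h1 := c.continuousAt_symm (c.map_source hxc)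
    have h2 : ∀ᶠ y in 𝓝 x, y ∈ e.source ∧ f y ∈ e.source ∧ e (f y) = e y + v (e y) :=
      (e.open_source.eventually_mem hx).and hf
    rw [← c.left_inv hxc] at h2
    exact h1.eventually h2
  -- In the chart `e` the map is `id + v`, with the jet of `id` at `e x` up to order `j`; passing to
  -- the charts `c` and `d` composes both with the same transition maps.
  have e1 : d ∘ f ∘ c.symm =ᶠ[𝓝 (c x)] (d ∘ id ∘ e.symm) ∘ ((fun z => z + v z) ∘
      (e ∘ id ∘ c.symm)) := by
    filter_upwards [hev] with y hy
    simp [← hy.2.2, e.left_inv hy.2.1]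
  have e2 : d ∘ id ∘ c.symm =ᶠ[𝓝 (c x)] (d ∘ id ∘ e.symm) ∘ (id ∘ (e ∘ id ∘ c.symm)) := by
    filter_upwards [hev] with y hy
    simp [e.left_inv hy.1]
  rw [(e1.iteratedFDeriv ℝ j).eq_of_nhds, (e2.iteratedFDeriv ℝ j).eq_of_nhds]
  refine iteratedFDeriv_comp_congr (s := j) (hiv.contDiffAt.comp _ hec)
    (contDiffAt_id.comp _ hec) ?_ ?_ (fun i hi => ?_) (fun i hi => ?_) le_rfl
  · rw [Function.comp_apply, hex, h0, add_zero]; exact hde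
  · rw [Function.comp_apply, hex]; exact hde
  · refine iteratedFDeriv_comp_congr (s := i) (hec.of_le (by exact_mod_cast hi))
      (hec.of_le (by exact_mod_cast hi)) (hiv.of_le (by exact_mod_cast hi)).contDiffAt
      contDiffAt_id (fun _ _ => rfl) (fun k hk => ?_) le_rfl
    rw [hex, show (fun z => z + v z) = id + v from rfl, iteratedFDeriv_add_apply contDiffAt_id
      (hv.of_le (nat_le_infty k)).contDiffAt, hv0 k (hk.trans hi), add_zero]
  · simp only [Function.comp_apply, id_eq, c.left_inv hxc, h0, add_zero]

lemma IsFlatAt.tmap_eq {f : N → N} {x : N} (h : IsFlatAt n f x) :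
    tmap f x = ContinuousLinearMap.id ℝ (Euc (2 * n)) := by
  obtain ⟨c, hc, hx, v, hv, hv0, hf⟩ := h 1
  have h0 : v (c x) = 0 := by
    rw [← norm_eq_zero, ← norm_iteratedFDeriv_zero (𝕜 := ℝ), hv0 0 (Nat.zero_le _), norm_zero]
  have h1 : fderiv ℝ v (c x) = 0 := by
    rw [← norm_eq_zero, ← norm_iteratedFDeriv_one (𝕜 := ℝ), hv0 1 le_rfl, norm_zero]
  have hvd : DifferentiableAt ℝ v (c x) := hv.differentiable (by simp) _
  have h2 : f =ᶠ[𝓝 x] c.symm ∘ ((fun z => z + v z) ∘ c) := by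
    filter_upwards [hf] with y hy
    simp [← hy.2, c.left_inv hy.1]
  have h3 : fderiv ℝ (fun z => z + v z) (c x) = ContinuousLinearMap.id ℝ (Euc (2 * n)) := by
    have := ((hasFDerivAt_id (𝕜 := ℝ) (c x)).add hvd.hasFDerivAt).fderiv
    rw [h1, add_zero] at this
    exact this
  have hm : MDifferentiableAt 𝓘(ℝ, Euc (2 * n)) 𝓘(ℝ, Euc (2 * n)) (fun z => z + v z) (c x) :=
    (differentiableAt_id.add hvd).mdifferentiableAt
  have hpt : ((fun z => z + v z) ∘ c) x = c x := by simp [h0]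
  have hcs := mdifferentiableAt_chart_symm hc (c.map_source hx)
  rw [tmap_congr h2, tmap_comp (f := (fun z => z + v z) ∘ c) (g := c.symm) (by rwa [hpt])
    (hm.comp x (mdifferentiableAt_chart hc hx)),
    tmap_comp hm (mdifferentiableAt_chart hc hx), tmap_eq_fderiv, h3, hpt]
  ext1 u
  exact tmap_symm_tmap_chart hc hx u

/-- Gluing small members of countably many families with disjoint supports. -/
theorem exists_glue [T2Space N] [SecondCountableTopology N] [Countable ι]
    (g : Bundle.ContinuousRiemannianMetric (Euc (2 * n))
      (fun x : N => TangentSpace (𝓡 (2 * n)) x))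
    (W : StrongNhdData (2 * n) N r) (hW : W.IsAt id) (hA : Separated A) :
    ∃ ρ : ι → ℝ, (∀ i, 0 < ρ i ∧ ρ i ≤ (A i).ε) ∧ ∀ p : ι → P, (∀ i, ‖p i‖ < ρ i) →
      ∃ φ : N ≃ₘ^∞⟮𝓡 (2 * n), 𝓡 (2 * n)⟯ N, ⇑φ = glue A p ∧ ⇑φ.symm = glue A (-p) ∧
        IsNearId Ω g W φ ∧ IsNearId Ω g W φ.symm := by
  classical
  rcases isEmpty_or_nonempty N with hN | hN
  · refine ⟨fun i => (A i).ε, fun i => ⟨(A i).ε_pos, le_rfl⟩, fun p _ =>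
      ⟨Diffeomorph.refl _ _ _, funext fun x => hN.elim x, funext fun x => hN.elim x, ?_, ?_⟩⟩ <;>
    exact ⟨fun x => hN.elim x, fun x => hN.elim x, fun k => ⟨fun x => hN.elim x,
      fun _ _ x => hN.elim x⟩, fun x => hN.elim x⟩
  obtain ⟨c, β, U, hcov, hUcov⟩ := exists_chart_bump_cover (2 * n) N
  obtain ⟨enc, henc⟩ := exists_injective_nat ι
  -- For one index `i` only finitely many requirements arise: the charts numbered up to `enc i`, the
  -- sets `W.K k` meeting a compact support, and the length estimate. Hence one radius `ρ i` serves
  -- them all.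
  have hev : ∀ i, ∀ᶠ q in 𝓝 (0 : P), q ∈ Metric.ball (0 : P) (A i).ε ∧
      (∀ l ∈ Finset.range (enc i + 1),
        MapsTo ((A i).F q) ((c l).symm '' tsupport (β l)) (c l).source ∧
        ContDiff ℝ ∞ ((A i).displacement (c l) (β l) q) ∧
        ∀ j ≤ enc i, ∀ y, ‖iteratedFDeriv ℝ j ((A i).displacement (c l) (β l) q) y‖ ≤
          (1 / 2 : ℝ) ^ (enc i)) ∧
      (∀ k ∈ {k | (W.K k ∩ (A i).S).Nonempty},
        JetClose (W.c k) (W.d k) W.s (W.ε k) (W.K k ∩ (A i).S) id ((A i).F q)) ∧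
      ∀ x ∈ (A i).S, ∀ v : Euc (2 * n),
        tangentLength g ((A i).F q x) (tmap ((A i).F q) x v) ≤ 2 * tangentLength g x v := by
    intro i
    refine (A i).eventually_mem_ball.and (.and ?_ (.and ?_ ((A i).eventually_tangentLength_le g)))
    · rw [Filter.eventually_all_finset]
      intro l _
      obtain ⟨h1, h2, h3, h4, -⟩ := hcov l
      exact (A i).eventually_displacement h1 h2 h3 h4 _ (by positivity)
    · rw [Filter.eventually_all_finite
        (W.locallyFinite_K.finite_nonempty_inter_compact (A i).isCompact_S)]
      intro k _
      exact (A i).eventually_jetClose (W.c_mem k) (W.d_mem k)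
        ((W.isCompact_K k).inter_right (A i).isCompact_S.isClosed)
        (inter_subset_left.trans (W.K_subset k)) (inter_subset_left.trans (hW k)) _ (W.ε_pos k)
  have hρ := fun i => Metric.eventually_nhds_iff_ball.1 (hev i)
  choose ρ hρ0 hρ using hρ
  have key : ∀ p : ι → P, (∀ i, ‖p i‖ < min (ρ i) (A i).ε) → IsNearId Ω g W (glue A p) := by
    intro p hp
    have hpρ := fun i => hρ i (p i) (by simpa using (hp i).trans_le (min_le_left _ _))
    have hpb : ∀ i, p i ∈ Metric.ball (0 : P) (A i).ε := fun i => (hpρ i).1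
    have hflat : ∀ x, (∀ i, x ∉ (A i).S) → IsFlatAt n (glue A p) x := by
      intro x hx J
      obtain ⟨l, hl⟩ := mem_iUnion.1 (hUcov ▸ mem_univ x)
      obtain ⟨h1, -, -, -, h5, h6, h7⟩ := hcov l
      exact ⟨c l, h1, h6 hl, exists_glue_eq_add hA enc henc hpb h5 h6 h7
        (fun i hi => (hpρ i).2.1 l (Finset.mem_range.2 (Nat.lt_succ_of_le hi))) hx hl J⟩
    have hloc : ∀ x, (∃ i, x ∈ (A i).S) ∨ ∀ i, x ∉ (A i).S := fun x => by
      by_cases h : ∃ i, x ∈ (A i).S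
      · exact Or.inl h
      · exact Or.inr (by simpa using h)
    refine ⟨fun x => ?_, ?_, fun k => ⟨fun x hx => ?_, fun j hj x hx => ?_⟩, fun x v => ?_⟩
    · rcases hloc x with ⟨i, hi⟩ | hx
      · exact ((A i).contMDiff_F (hpb i)).contMDiffAt.congr_of_eventuallyEq
          (glue_eventuallyEq hA hpb hi)
      · exact (hflat x hx).contMDiffAt
    · refine (isSymplectic_iff Ω).2 fun x u v => ?_
      rcases hloc x with ⟨i, hi⟩ | hx
      · rw [tmap_congr (glue_eventuallyEq hA hpb hi), glue_of_mem hA hi]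
        exact (isSymplectic_iff Ω).1 ((A i).symp _ (hpb i)) x u v
      · rw [(hflat x hx).tmap_eq, glue_of_notMem hx]
        rfl
    · rcases hloc x with ⟨i, hi⟩ | hxn
      · rw [glue_of_mem hA hi]
        exact ((hpρ i).2.2.1 k ⟨x, hx, hi⟩).1 ⟨hx, hi⟩
      · rw [glue_of_notMem hxn]
        exact hW k hx
    · rcases hloc x with ⟨i, hi⟩ | hxn
      · have h1 : W.d k ∘ glue A p ∘ (W.c k).symm =ᶠ[𝓝 (W.c k x)]
            W.d k ∘ (A i).F (p i) ∘ (W.c k).symm := by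
          have hxc := W.K_subset k hx
          have h2 := glue_eventuallyEq hA hpb hi
          rw [← (W.c k).left_inv hxc] at h2
          have h3 := ((W.c k).continuousAt_symm ((W.c k).map_source hxc)).eventually h2
          filter_upwards [h3] with y hy
          simp [hy]
        rw [(h1.iteratedFDeriv ℝ j).eq_of_nhds]
        exact ((hpρ i).2.2.1 k ⟨x, hx, hi⟩).2 j hj x ⟨hx, hi⟩
      · rw [(hflat x hxn).iteratedFDeriv_eq (W.c_mem k) (W.d_mem k) (W.K_subset k hx) (hW k hx)]
        simpa using W.ε_pos k
    · rcases hloc x with ⟨i, hi⟩ | hx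
      · rw [tmap_congr (glue_eventuallyEq hA hpb hi), glue_of_mem hA hi]
        exact (hpρ i).2.2.2 x hi v
      · rw [(hflat x hx).tmap_eq, glue_of_notMem hx]
        have := tangentLength_nonneg g x v
        simp only [ContinuousLinearMap.id_apply]
        linarith
  refine ⟨fun i => min (ρ i) (A i).ε, fun i => ⟨lt_min (hρ0 i) (A i).ε_pos, min_le_right _ _⟩,
    fun p hp => ?_⟩
  have hp' : ∀ i, ‖(-p) i‖ < min (ρ i) (A i).ε := fun i => by simpa using hp i
  have hpb : ∀ i, p i ∈ Metric.ball (0 : P) (A i).ε := fun i => by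
    simpa using (hp i).trans_le (min_le_right _ _)
  have hpb' : ∀ i, (-p) i ∈ Metric.ball (0 : P) (A i).ε := fun i => by
    simpa using (hp i).trans_le (min_le_right _ _)
  have h1 := key p hp
  have h2 := key (-p) hp'
  exact ⟨{ toFun := glue A p
           invFun := glue A (-p)
           left_inv := glue_neg hA hpb
           right_inv := fun x => by simpa using glue_neg hA hpb' x
           contMDiff_toFun := h1.contMDiff
           contMDiff_invFun := h2.contMDiff }, rfl, rfl, h1, h2⟩

end Glue
end SymplecticIFS
end

/-! ### Conjugation: integrability, bunching and strong closeness -/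

noncomputable section
namespace SymplecticIFS

section Conjugation

set_option linter.unusedSectionVars false

variable {n : ℕ} {N : Type*} [TopologicalSpace N] [ChartedSpace (Euc (2 * n)) N]
  [IsManifold (𝓡 (2 * n)) ∞ N] {Ω : SymplecticForm n N} {r : ℕ∞}

lemma tmap_apply_comp {f g : N → N} (hg : MDifferentiable (𝓡 (2 * n)) (𝓡 (2 * n)) g)
    (hf : MDifferentiable (𝓡 (2 * n)) (𝓡 (2 * n)) f) (x : N) (u : Euc (2 * n)) :
    tmap (g ∘ f) x u = tmap g (f x) (tmap f x u) := by
  rw [tmap_comp (hg _) (hf x)]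
  rfl

lemma IsSymplectic.comp {f g : N → N} (hg : IsSymplectic Ω g) (hf : IsSymplectic Ω f)
    (hgd : MDifferentiable (𝓡 (2 * n)) (𝓡 (2 * n)) g)
    (hfd : MDifferentiable (𝓡 (2 * n)) (𝓡 (2 * n)) f) : IsSymplectic Ω (g ∘ f) := by
  refine (isSymplectic_iff Ω).2 fun x u v => ?_
  rw [tmap_apply_comp hgd hfd, tmap_apply_comp hgd hfd, Function.comp_apply,
    (isSymplectic_iff Ω).1 hg, (isSymplectic_iff Ω).1 hf]

lemma contMDiff_mdifferentiable {f : N → N} (hf : ContMDiff (𝓡 (2 * n)) (𝓡 (2 * n)) ∞ f) :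
    MDifferentiable (𝓡 (2 * n)) (𝓡 (2 * n)) f := hf.mdifferentiable (by simp)

lemma tmap_diffeo_symm (φ : N ≃ₘ^∞⟮𝓡 (2 * n), 𝓡 (2 * n)⟯ N) (x : N) (u : Euc (2 * n)) :
    tmap φ (φ.symm x) (tmap φ.symm x u) = u := by
  rw [← tmap_apply_comp (contMDiff_mdifferentiable φ.contMDiff)
    (contMDiff_mdifferentiable φ.symm.contMDiff), show (φ ∘ φ.symm : N → N) = id from
    funext φ.apply_symm_apply, tmap_id]
  rfl

/-- Conjugation of a diffeomorphism by a smooth one. -/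
def conjDiffeo (φ : N ≃ₘ^∞⟮𝓡 (2 * n), 𝓡 (2 * n)⟯ N) (T : N ≃ₘ^r⟮𝓡 (2 * n), 𝓡 (2 * n)⟯ N) :
    N ≃ₘ^r⟮𝓡 (2 * n), 𝓡 (2 * n)⟯ N where
  toEquiv := (φ.symm.toEquiv.trans T.toEquiv).trans φ.toEquiv
  contMDiff_toFun := (φ.contMDiff.of_le (by exact_mod_cast le_top)).comp
    (T.contMDiff.comp (φ.symm.contMDiff.of_le (by exact_mod_cast le_top)))
  contMDiff_invFun := (φ.contMDiff.of_le (by exact_mod_cast le_top)).comp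
    (T.symm.contMDiff.comp (φ.symm.contMDiff.of_le (by exact_mod_cast le_top)))

variable (φ : N ≃ₘ^∞⟮𝓡 (2 * n), 𝓡 (2 * n)⟯ N) (T : N ≃ₘ^r⟮𝓡 (2 * n), 𝓡 (2 * n)⟯ N)

lemma coe_conjDiffeo : ⇑(conjDiffeo φ T) = φ ∘ T ∘ φ.symm := rfl

/-- Transport of action-angle coordinates by a symplectic diffeomorphism. -/
def ActionAngle.map (A : ActionAngle Ω) (hφ : IsSymplectic Ω φ) : ActionAngle Ω where
  carrier := φ '' A.carrier
  D := A.D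
  param := φ ∘ A.param
  isOpen_carrier := φ.toHomeomorph.isOpenMap _ A.isOpen_carrier
  D_cube := A.D_cube
  smooth := φ.contMDiff.comp_contMDiffOn A.smooth
  image_eq := by rw [image_comp, A.image_eq]
  param_eq_iff := fun I hI I' hI' θ θ' => by
    rw [← A.param_eq_iff I hI I' hI']
    exact φ.injective.eq_iff
  symplectic := fun I hI θ u v => by
    have hD : IsOpen A.D := by
      obtain ⟨e, -, he, -⟩ := A.D_cube
      exact he ▸ e.open_target
    have h1 : MDifferentiableAt 𝓘(ℝ, Euc n × Euc n) (𝓡 (2 * n)) A.param (I, θ) :=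
      (A.smooth.contMDiffAt ((hD.prod isOpen_univ).mem_nhds ⟨hI, mem_univ _⟩)).mdifferentiableAt
        (by simp)
    have h2 := mfderiv_comp (I, θ) (contMDiff_mdifferentiable φ.contMDiff _) h1
    rw [h2, ← A.symplectic I hI θ u v]
    exact hφ (A.param (I, θ)) _ _

lemma IsHypersurface.image {L : Set N} (hL : IsHypersurface (m := 2 * n) L) :
    IsHypersurface (m := 2 * n) (φ '' L) := by
  rintro _ ⟨p, hp, rfl⟩
  obtain ⟨V, u, hV, hpV, hu, hu', hLV⟩ := hL p hp
  have hmem : ∀ q ∈ φ '' V, φ.symm q ∈ V := by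
    rintro _ ⟨x, hx, rfl⟩
    simpa using hx
  refine ⟨φ '' V, u ∘ φ.symm, φ.toHomeomorph.isOpenMap _ hV, ⟨p, hpV, rfl⟩, ?_, ?_, ?_⟩
  · exact hu.comp (φ.symm.contMDiff.of_le (by exact_mod_cast le_top)).contMDiffOn hmem
  · intro q hq hcon
    have hq' := hmem q hq
    have h1 : MDifferentiableAt (𝓡 (2 * n)) 𝓘(ℝ, ℝ) u (φ.symm q) :=
      (hu.contMDiffAt (hV.mem_nhds hq')).mdifferentiableAt (by simp)
    have h2 := mfderiv_comp q h1 (contMDiff_mdifferentiable φ.symm.contMDiff q)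
    refine hu' _ hq' ?_
    ext v
    have h3 := tmap_diffeo_symm φ.symm (φ.symm q) v
    have h4 : tmap φ.symm q (tmap φ (φ.symm q) v) = v := by
      rwa [show φ.symm.symm (φ.symm q) = q from φ.apply_symm_apply q] at h3
    have h5 := congrArg (fun f : Euc (2 * n) →L[ℝ] ℝ => f (tmap φ (φ.symm q) v))
      (h2.symm.trans hcon)
    change mfderiv (𝓡 (2 * n)) 𝓘(ℝ, ℝ) u (φ.symm q) (tmap φ.symm q (tmap φ (φ.symm q) v)) = 0
      at h5
    rw [h4] at h5
    exact h5
  · ext q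
    constructor
    · rintro ⟨⟨x, hxL, rfl⟩, y, hyV, hxy⟩
      obtain rfl := φ.injective hxy
      exact ⟨⟨y, hyV, rfl⟩, by simpa using (hLV.subset ⟨hxL, hyV⟩).2⟩
    · rintro ⟨⟨x, hxV, rfl⟩, hx⟩
      have h1 : x ∈ L ∩ V := hLV.symm.subset ⟨hxV, by simpa using hx⟩
      exact ⟨⟨x, h1.1, rfl⟩, ⟨x, hxV, rfl⟩⟩

/-- Action-angle coordinates, hypersurfaces and local finiteness are carried over by `φ`; in the
transported coordinates the rotation vectors are unchanged. -/
lemma IsIntegrable.conj (hφ : IsSymplectic Ω φ) (hT : IsIntegrable Ω r T) :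
    IsIntegrable Ω r (conjDiffeo φ T) := by
  obtain ⟨ι, A, hcl, hdisj, hfin, hrot, L, hL, hsub⟩ := hT
  have hU : (⋃ i, φ '' (A i).carrier) = φ '' ⋃ i, (A i).carrier := (image_iUnion ..).symm
  refine ⟨ι, fun i => (A i).map φ hφ, ?_, fun i j hij => ?_, fun C hC => ?_, fun i => ?_,
    fun k => φ '' L k, fun k => (hL k).image φ, ?_⟩
  · change closure (⋃ i, φ '' (A i).carrier) = univ
    rw [hU]
    have := φ.toHomeomorph.image_closure (⋃ i, (A i).carrier)
    rw [hcl, image_univ_of_surjective φ.toHomeomorph.surjective] at this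
    exact this.symm
  · exact (disjoint_image_iff φ.injective).2 (hdisj i j hij)
  · refine (hfin (φ.symm '' C) (hC.image φ.symm.continuous)).subset ?_
    rintro i ⟨_, ⟨x, hx, rfl⟩, hxC⟩
    exact ⟨x, hx, φ x, hxC, by simp⟩
  · obtain ⟨α, hα, hrot⟩ := hrot i
    refine ⟨α, hα, fun I hI θ => ?_⟩
    change φ (T (φ.symm (φ ((A i).param (I, θ))))) = _
    rw [φ.symm_apply_apply, hrot I hI θ]
    rfl
  · change (⋃ i, φ '' (A i).carrier)ᶜ ⊆ _
    rw [hU, ← image_compl_eq (show Function.Bijective φ from φ.bijective), ← image_iUnion]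
    exact image_mono hsub

lemma tangentLength_smul (g : Bundle.ContinuousRiemannianMetric (Euc (2 * n))
    (fun x : N => TangentSpace (𝓡 (2 * n)) x)) (x : N) (a : ℝ) (v : Euc (2 * n)) :
    tangentLength g x (a • v) = |a| * tangentLength g x v := by
  have h1 : g.inner x (a • v) (a • v) = a ^ 2 * g.inner x v v := by
    have h2 := (g.inner x).map_smul a v
    have h3 := (g.inner x v).map_smul a v
    have h4 : g.inner x (a • v) (a • v) = (a • g.inner x v) (a • v) := congrArg (· (a • v)) h2
    rw [h4]
    have h5 : (a • g.inner x v) (a • v) = a • g.inner x v (a • v) := rfl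
    rw [h5, show g.inner x v (a • v) = a • g.inner x v v from h3, smul_eq_mul, smul_eq_mul]
    ring
  change √(g.inner x (a • v) (a • v)) = |a| * √(g.inner x v v)
  rw [h1, Real.sqrt_mul (sq_nonneg a), Real.sqrt_sq_eq_abs]

/-- Bunching is invariant under conjugation by maps with bounded distortion. -/
lemma IsBunched.conj (g : Bundle.ContinuousRiemannianMetric (Euc (2 * n))
    (fun x : N => TangentSpace (𝓡 (2 * n)) x)) (hr : 1 ≤ r) {C : ℝ} (hC : 0 < C)
    (h1 : ∀ (x : N) (v : Euc (2 * n)),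
      tangentLength g (φ x) (tmap φ x v) ≤ C * tangentLength g x v)
    (h2 : ∀ (x : N) (v : Euc (2 * n)),
      tangentLength g (φ.symm x) (tmap φ.symm x v) ≤ C * tangentLength g x v) {δ : ℝ}
    (hT : IsBunched g δ T) : IsBunched g δ (conjDiffeo φ T) := by
  obtain ⟨c, hc, hev⟩ := hT
  -- Passing to the conjugate costs the fixed factor `C ^ 4`: `C` twice in the numerator and twice
  -- in the denominator. It is absorbed by the exponential gained when `c` is replaced by the
  -- midpoint of `c` and `δ`.
  refine ⟨(c + δ) / 2, by linarith, ?_⟩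
  have hlim : ∀ᶠ k : ℕ in atTop, C ^ 4 ≤ Real.exp ((δ - c) / 2 * k) := by
    have : Tendsto (fun k : ℕ => Real.exp ((δ - c) / 2 * k)) atTop atTop :=
      Real.tendsto_exp_atTop.comp
        (Tendsto.const_mul_atTop (by linarith) tendsto_natCast_atTop_atTop)
    exact this.eventually_ge_atTop _
  have hφd := contMDiff_mdifferentiable φ.contMDiff
  have hφd' := contMDiff_mdifferentiable φ.symm.contMDiff
  have hTd : ∀ k : ℕ, MDifferentiable (𝓡 (2 * n)) (𝓡 (2 * n)) (T^[k]) := by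
    intro k
    have hT1 : MDifferentiable (𝓡 (2 * n)) (𝓡 (2 * n)) T :=
      T.contMDiff.mdifferentiable (by
        have : (r : WithTop ℕ∞) ≠ 0 := by
          intro h0
          have h0' : r = 0 := by exact_mod_cast h0
          simp [h0'] at hr
        exact this)
    induction k with
    | zero => exact mdifferentiable_id
    | succ k ih => rw [Function.iterate_succ']; exact hT1.comp ih
  have hiter : ∀ k : ℕ, (conjDiffeo φ T)^[k] = φ ∘ (T^[k] ∘ φ.symm) := by
    intro k
    funext x
    have h3 : Function.Semiconj φ T (conjDiffeo φ T) := fun y => by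
      simp [coe_conjDiffeo]
    have h4 := (h3.iterate_right k) (φ.symm x)
    rw [φ.apply_symm_apply] at h4
    exact h4.symm
  filter_upwards [hev, hlim] with k hk hCk
  suffices H : ∀ (x : N) (u v : Euc (2 * n)), tangentLength g x u = 1 →
      tangentLength g x v = 1 → tangentLength g _ (tmap ((conjDiffeo φ T)^[k]) x u) ≤
        Real.exp ((c + δ) / 2 * k) * tangentLength g _ (tmap ((conjDiffeo φ T)^[k]) x v) from H
  intro x u v hu hv
  have hD : ∀ w : Euc (2 * n), tmap ((conjDiffeo φ T)^[k]) x w =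
      tmap φ (T^[k] (φ.symm x)) (tmap (T^[k]) (φ.symm x) (tmap φ.symm x w)) := by
    intro w
    rw [hiter, tmap_apply_comp hφd ((hTd k).comp hφd'), tmap_apply_comp (hTd k) hφd']
    rfl
  have hpt : (conjDiffeo φ T)^[k] x = φ (T^[k] (φ.symm x)) := by rw [hiter]; rfl
  set y := φ.symm x with hy
  set u' : Euc (2 * n) := tmap φ.symm x u
  set v' : Euc (2 * n) := tmap φ.symm x v
  have hlow : ∀ w : Euc (2 * n), tangentLength g x w = 1 →
      C⁻¹ ≤ tangentLength g y (tmap φ.symm x w) ∧ tangentLength g y (tmap φ.symm x w) ≤ C := by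
    intro w hw
    have h3 := h1 y (tmap φ.symm x w)
    rw [tmap_diffeo_symm, hy, φ.apply_symm_apply, hw] at h3
    have h4 := h2 x w
    rw [hw, mul_one] at h4
    exact ⟨by rw [inv_le_iff_one_le_mul₀' hC]; exact h3, h4⟩
  obtain ⟨hu1, hu2⟩ := hlow u hu
  obtain ⟨hv1, hv2⟩ := hlow v hv
  have hCi : 0 < C⁻¹ := inv_pos.2 hC
  have hupos := hCi.trans_le hu1
  have hvpos := hCi.trans_le hv1
  set a := tangentLength g y u'
  set b := tangentLength g y v'
  have hunit : ∀ {w : Euc (2 * n)} {l : ℝ}, tangentLength g y w = l → 0 < l →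
      tangentLength g y (l⁻¹ • w) = 1 := by
    intro w l hw hl
    rw [tangentLength_smul, hw, abs_of_pos (inv_pos.2 hl), inv_mul_cancel₀ hl.ne']
  have hk' := hk y (a⁻¹ • u') (b⁻¹ • v') (hunit rfl hupos) (hunit rfl hvpos)
  change tangentLength g (T^[k] y) (tmap (T^[k]) y (a⁻¹ • u')) ≤
    _ * tangentLength g (T^[k] y) (tmap (T^[k]) y (b⁻¹ • v')) at hk'
  rw [map_smul, map_smul, tangentLength_smul, tangentLength_smul, abs_of_pos (inv_pos.2 hupos),
    abs_of_pos (inv_pos.2 hvpos)] at hk'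
  set p := tangentLength g (T^[k] y) (tmap (T^[k]) y u')
  set q := tangentLength g (T^[k] y) (tmap (T^[k]) y v') with hq
  have hq0 : 0 ≤ q := tangentLength_nonneg g _ _
  -- comparison of the numerators and of the denominators
  have hnum : tangentLength g ((conjDiffeo φ T)^[k] x) (tmap ((conjDiffeo φ T)^[k]) x u) ≤
      C * p := by
    rw [hD, hpt]; exact h1 _ _
  have hden : q ≤ C * tangentLength g ((conjDiffeo φ T)^[k] x)
      (tmap ((conjDiffeo φ T)^[k]) x v) := by
    have h3 := h2 (φ (T^[k] y)) (tmap φ (T^[k] y) (tmap (T^[k]) y v'))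
    have h4 := tmap_diffeo_symm φ.symm (T^[k] y) (tmap (T^[k]) y v')
    have h5 : tmap φ.symm (φ (T^[k] y)) (tmap φ (T^[k] y) (tmap (T^[k]) y v')) =
        tmap (T^[k]) y v' := h4
    rw [h5, φ.symm_apply_apply] at h3
    rw [hD, hpt]
    exact h3
  set s := tangentLength g ((conjDiffeo φ T)^[k] x) (tmap ((conjDiffeo φ T)^[k]) x v)
  have hs0 : 0 ≤ s := tangentLength_nonneg g _ _
  have hp : p ≤ C ^ 2 * (Real.exp (c * k) * q) := by
    have h3 : p = a * (a⁻¹ * p) := by field_simp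
    have h4 : b⁻¹ ≤ C := inv_le_of_inv_le₀ hC hv1
    calc p = a * (a⁻¹ * p) := h3
      _ ≤ C * (Real.exp (c * k) * (b⁻¹ * q)) :=
        mul_le_mul hu2 hk' (by
          have := tangentLength_nonneg g (T^[k] y) (tmap (T^[k]) y u')
          positivity) hC.le
      _ ≤ C * (Real.exp (c * k) * (C * q)) := by gcongr
      _ = _ := by ring
  calc _ ≤ C * p := hnum
    _ ≤ C * (C ^ 2 * (Real.exp (c * k) * (C * s))) := by gcongr; exact hp.trans (by gcongr)
    _ = C ^ 4 * Real.exp (c * k) * s := by ring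
    _ ≤ Real.exp ((δ - c) / 2 * k) * Real.exp (c * k) * s := by gcongr
    _ = Real.exp ((c + δ) / 2 * k) * s := by rw [← Real.exp_add]; ring_nf

/-- A neighbourhood of the identity such that the products of three of its members, and their
inverses, conjugate `T` to maps close to `T`. -/
lemma exists_strongNhd_conj [T2Space N] [SecondCountableTopology N]
    (W : StrongNhdData (2 * n) N r) (hW : W.IsAt T) :
    ∃ W' : StrongNhdData (2 * n) N r, W'.IsAt id ∧
      ∀ a b c a' b' c' : N → N, ContMDiff (𝓡 (2 * n)) (𝓡 (2 * n)) ∞ a →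
      ContMDiff (𝓡 (2 * n)) (𝓡 (2 * n)) ∞ b → ContMDiff (𝓡 (2 * n)) (𝓡 (2 * n)) ∞ c →
      ContMDiff (𝓡 (2 * n)) (𝓡 (2 * n)) ∞ a' → ContMDiff (𝓡 (2 * n)) (𝓡 (2 * n)) ∞ b' →
      ContMDiff (𝓡 (2 * n)) (𝓡 (2 * n)) ∞ c' → W'.Contains id a → W'.Contains id b →
      W'.Contains id c → W'.Contains id a' → W'.Contains id b' → W'.Contains id c' →
      W.Contains T ((a ∘ b ∘ c) ∘ T ∘ (c' ∘ b' ∘ a')) := by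
  obtain ⟨W₁, hW₁, h₁⟩ := exists_strongNhd_comp T W hW
  obtain ⟨W₂, hW₂, h₂⟩ := exists_strongNhd_comp (Diffeomorph.refl (𝓡 (2 * n)) N r) W₁ hW₁
  obtain ⟨W₃, hW₃, h₃⟩ := exists_strongNhd_comp (Diffeomorph.refl (𝓡 (2 * n)) N r) W₂ hW₂
  have hid : W₃.Contains id id := fun k => ⟨hW₃ k, fun j _ x _ => by
    simpa using W₃.ε_pos k⟩
  -- A single map is viewed as its product with the identity, so that a neighbourhood designed for
  -- products of two also controls single factors.
  have h₃' : ∀ a : N → N, ContMDiff (𝓡 (2 * n)) (𝓡 (2 * n)) ∞ a → W₃.Contains id a →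
      W₂.Contains id a := fun a ha h => h₃ a id ha contMDiff_id h hid
  refine ⟨W₃, hW₃, fun a b c a' b' c' ha hb hc ha' hb' hc' Ha Hb Hc Ha' Hb' Hc' => ?_⟩
  exact h₁ _ _ (ha.comp (hb.comp hc)) (hc'.comp (hb'.comp ha'))
    (h₂ a (b ∘ c) ha (hb.comp hc) (h₃' a ha Ha) (h₃ b c hb hc Hb Hc))
    (h₂ (c' ∘ b') a' (hc'.comp hb') ha' (h₃ c' b' hc' hb' Hc' Hb') (h₃' a' ha' Ha'))

end Conjugation
end SymplecticIFS
end

/-! ### Thin sets and avoidance by dimension count -/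

noncomputable section
namespace SymplecticIFS

set_option linter.unusedSectionVars false
section Thin

variable {E : Type} [NormedAddCommGroup E] [NormedSpace ℝ E] [FiniteDimensional ℝ E]

/-- Sets covered by countably many `C¹` images of pieces of proper subspaces. -/
def IsThin (S : Set E) : Prop :=
  ∃ (ι : Type) (_ : Countable ι) (H : ι → Submodule ℝ E) (γ : ι → E → E) (y : ι → E) (ρ : ι → ℝ),
    (∀ k, Module.finrank ℝ (H k) < Module.finrank ℝ E) ∧
    (∀ k, ContDiffOn ℝ 1 (γ k) (Metric.ball (y k) (ρ k))) ∧
    S ⊆ ⋃ k, γ k '' (Metric.ball (y k) (ρ k) ∩ H k)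

lemma IsThin.mono {S S' : Set E} (h : IsThin S) (hS : S' ⊆ S) : IsThin S' := by
  obtain ⟨ι, hι, H, γ, y, ρ, h1, h2, h3⟩ := h
  exact ⟨ι, hι, H, γ, y, ρ, h1, h2, hS.trans h3⟩

lemma IsThin.iUnion {κ : Type} [Countable κ] {S : κ → Set E} (h : ∀ k, IsThin (S k)) :
    IsThin (⋃ k, S k) := by
  choose ι hι H γ y ρ h1 h2 h3 using h
  refine ⟨Σ k, ι k, inferInstance, fun q => H q.1 q.2, fun q => γ q.1 q.2, fun q => y q.1 q.2,
    fun q => ρ q.1 q.2, fun q => h1 _ _, fun q => h2 _ _, iUnion_subset fun k x hx => ?_⟩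
  obtain ⟨i, hi⟩ := mem_iUnion.1 (h3 k hx)
  exact mem_iUnion.2 ⟨⟨k, i⟩, hi⟩

lemma IsThin.union {S S' : Set E} (h : IsThin S) (h' : IsThin S') : IsThin (S ∪ S') := by
  rw [union_eq_iUnion]
  exact IsThin.iUnion fun b => by cases b <;> assumption

/-- Straightening of a regular level set. -/
lemma exists_straightening {u : E → ℝ} {z : E} (hu : ContDiffAt ℝ 1 u z) (h : fderiv ℝ u z ≠ 0) :
    ∃ (H : Submodule ℝ E) (γ : E → E) (y : E) (ρ : ℝ) (V : Set E),
      Module.finrank ℝ H < Module.finrank ℝ E ∧ ContDiffOn ℝ 1 γ (Metric.ball y ρ) ∧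
      V ∈ 𝓝 z ∧ ∀ w ∈ V, u w = 0 → w ∈ γ '' (Metric.ball y ρ ∩ H) := by
  obtain ⟨v, hv⟩ : ∃ v, fderiv ℝ u z v ≠ 0 := by
    by_contra! hcon
    exact h (ContinuousLinearMap.ext hcon)
  have hv0 : v ≠ 0 := fun h0 => hv (by rw [h0, map_zero])
  obtain ⟨l, hl⟩ : ∃ l : E →L[ℝ] ℝ, l v = 1 := by
    obtain ⟨f, -, hf⟩ := exists_dual_vector ℝ v (norm_ne_zero_iff.2 hv0)
    have hn : ‖v‖ ≠ 0 := norm_ne_zero_iff.2 hv0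
    exact ⟨‖v‖⁻¹ • f, by simp [hf, hn]⟩
  -- The map moves points along `v` only, by the amount that makes `l ∘ Ψ = u`. It is a local
  -- diffeomorphism since `u` has nonzero derivative along `v`, and it carries the zero set of `u`
  -- into `ker l`.
  let Ψ : E → E := fun w => w + (u w - l w) • v
  have hΨ : ContDiffAt ℝ 1 Ψ z :=
    contDiffAt_id.add ((hu.sub l.contDiff.contDiffAt).smul contDiffAt_const)
  have hlΨ : ∀ w, l (Ψ w) = u w := fun w => by simp [Ψ, hl]
  have hΨ' : HasFDerivAt Ψ (ContinuousLinearMap.id ℝ E +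
      (fderiv ℝ u z - l).smulRight v) z :=
    (hasFDerivAt_id z).add (((hu.differentiableAt (by simp)).hasFDerivAt.sub
      l.hasFDerivAt).smul_const v)
  set D : E →L[ℝ] E := ContinuousLinearMap.id ℝ E + (fderiv ℝ u z - l).smulRight v with hD
  have hinj : Function.Injective D := by
    rw [injective_iff_map_eq_zero]
    intro w hw
    have h1 : w + (fderiv ℝ u z w - l w) • v = 0 := by simpa [hD] using hw
    have h2 := congrArg l h1
    simp only [map_add, map_smul, hl, smul_eq_mul, mul_one, map_zero] at h2
    have h3 := congrArg (fderiv ℝ u z) h1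
    simp only [map_add, map_smul, smul_eq_mul, map_zero] at h3
    have h4 : fderiv ℝ u z w = 0 := by linarith
    rw [h4, zero_add] at h3
    have h5 : (0 - l w) = 0 := by
      rcases mul_eq_zero.1 h3 with h5 | h5
      · exact h5
      · exact absurd h5 hv
    rw [h4, h5] at h1
    simpa using h1
  let D' : E ≃L[ℝ] E :=
    (LinearEquiv.ofInjectiveEndo (D : E →ₗ[ℝ] E) hinj).toContinuousLinearEquiv
  have hΨD : HasFDerivAt Ψ (D' : E →L[ℝ] E) z := by
    have : (D' : E →L[ℝ] E) = D := by ext w; rfl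
    rwa [this]
  let e := hΨ.toOpenPartialHomeomorph Ψ hΨD (by simp)
  have hz : z ∈ e.source := hΨ.mem_toOpenPartialHomeomorph_source hΨD (by simp)
  have hsymm : ContDiffAt ℝ 1 e.symm (e z) := by
    refine e.contDiffAt_symm (f₀' := D') (e.map_source hz) ?_ ?_
    · rw [e.left_inv hz]; exact hΨD
    · rw [e.left_inv hz]; exact hΨ
  obtain ⟨t, ht, htc⟩ := hsymm.contDiffOn (m := 1) le_rfl (by simp)
  obtain ⟨ρ, hρ, hρt⟩ := Metric.mem_nhds_iff.1 ht
  refine ⟨LinearMap.ker (l : E →ₗ[ℝ] ℝ), e.symm, e z, ρ,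
    e.source ∩ e ⁻¹' Metric.ball (e z) ρ, ?_, htc.mono hρt, ?_, ?_⟩
  · refine Submodule.finrank_lt ?_
    intro htop
    have : v ∈ LinearMap.ker (l : E →ₗ[ℝ] ℝ) := htop ▸ Submodule.mem_top
    rw [LinearMap.mem_ker] at this
    exact one_ne_zero (hl.symm.trans this)
  · exact (e.isOpen_inter_preimage Metric.isOpen_ball).mem_nhds ⟨hz, Metric.mem_ball_self hρ⟩
  · intro w hw hw0
    refine ⟨e w, ⟨hw.2, ?_⟩, e.left_inv hw.1⟩
    change l (Ψ w) = 0
    rw [hlΨ, hw0]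

/-- Sets which are locally contained in regular level sets of `C¹` functions are thin. -/
lemma isThin_of_forall {S : Set E} (h : ∀ z ∈ S, ∃ (u : E → ℝ) (V : Set E), V ∈ 𝓝 z ∧
    ContDiffAt ℝ 1 u z ∧ fderiv ℝ u z ≠ 0 ∧ ∀ w ∈ S ∩ V, u w = 0) : IsThin S := by
  have h' : ∀ z : E, ∃ (H : Submodule ℝ E) (γ : E → E) (y : E) (ρ : ℝ) (V : Set E), z ∈ S →
      Module.finrank ℝ H < Module.finrank ℝ E ∧ ContDiffOn ℝ 1 γ (Metric.ball y ρ) ∧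
      V ∈ 𝓝 z ∧ S ∩ V ⊆ γ '' (Metric.ball y ρ ∩ H) := by
    intro z
    by_cases hz : z ∈ S
    · obtain ⟨u, V, hV, hu, hu', huS⟩ := h z hz
      obtain ⟨H, γ, y, ρ, V', h1, h2, h3, h4⟩ := exists_straightening hu hu'
      exact ⟨H, γ, y, ρ, V ∩ V', fun _ => ⟨h1, h2, inter_mem hV h3,
        fun w hw => h4 w hw.2.2 (huS w ⟨hw.1, hw.2.1⟩)⟩⟩
    · exact ⟨⊥, id, 0, 0, ∅, fun hz' => absurd hz' hz⟩
  choose H γ y ρ V hV using h'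
  obtain ⟨t, htS, htc, ht⟩ := TopologicalSpace.countable_cover_nhdsWithin
    (f := V) (s := S) fun z hz => mem_nhdsWithin_of_mem_nhds (hV z hz).2.2.1
  refine ⟨t, htc.to_subtype, fun z => H z, fun z => γ z, fun z => y z, fun z => ρ z,
    fun z => (hV z (htS z.2)).1, fun z => (hV z (htS z.2)).2.1, fun x hx => ?_⟩
  obtain ⟨z, hz, hxz⟩ := mem_iUnion₂.1 (ht hx)
  exact mem_iUnion.2 ⟨⟨z, hz⟩, (hV z (htS hz)).2.2.2 ⟨hx, hxz⟩⟩

lemma IsThin.measure_zero [MeasurableSpace E] [BorelSpace E] (μ : Measure E)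
    [μ.IsAddHaarMeasure] {S : Set E} (h : IsThin S) : μ S = 0 := by
  obtain ⟨ι, hι, H, γ, y, ρ, h1, h2, h3⟩ := h
  refine measure_mono_null h3 (measure_iUnion_null fun k => ?_)
  refine addHaar_image_eq_zero_of_differentiableOn_of_addHaar_eq_zero μ
    (((h2 k).differentiableOn (by simp)).mono inter_subset_left)
    (measure_mono_null inter_subset_right (Measure.addHaar_submodule μ (H k) fun htop => ?_))
  have := h1 k
  rw [htop, finrank_top] at this
  exact lt_irrefl _ this

/-- Translates with sufficiently many independent components avoid thin sets simultaneously for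
all values of a low-dimensional parameter. -/
lemma dense_avoid_thin {X : Type} [NormedAddCommGroup X] [NormedSpace ℝ X]
    [FiniteDimensional ℝ X] {B : Set E} (hB : IsThin B) {M : ℕ} (hM : Module.finrank ℝ X < M)
    (τ : Fin M → X → E) (hτ : ∀ l, ContDiff ℝ 1 (τ l)) :
    Dense {p : Fin M → E | ∃ J : X, ∀ l, p l + τ l J ∈ B}ᶜ := by
  obtain ⟨ι, hι, H, γ, y, ρ, h1, h2, h3⟩ := hB
  rcases isEmpty_or_nonempty ι with he | ⟨⟨i₀⟩⟩
  · have hM0 : 0 < M := (Nat.zero_le _).trans_lt hM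
    have : {p : Fin M → E | ∃ J : X, ∀ l, p l + τ l J ∈ B} = ∅ := by
      refine eq_empty_of_forall_notMem fun p ⟨J, hJ⟩ => ?_
      simpa using h3 (hJ ⟨0, hM0⟩)
    rw [this, compl_empty]
    exact dense_univ
  apply dense_compl_of_dimH_lt_finrank
  -- Once the piece covering each component is chosen, a bad tuple is a `C¹` function of `J` and of
  -- one point in each of the `M` subspaces. There are countably many choices.
  let s : ∀ k : Fin M → ι, Set (X × ∀ l, H (k l)) := fun k =>
    {q | ∀ l, (q.2 l : E) ∈ Metric.ball (y (k l)) (ρ (k l))}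
  let f : ∀ k : Fin M → ι, (X × ∀ l, H (k l)) → Fin M → E := fun k q l =>
    γ (k l) (q.2 l) - τ l q.1
  have hsub : {p : Fin M → E | ∃ J : X, ∀ l, p l + τ l J ∈ B} ⊆ ⋃ k, f k '' s k := by
    rintro p ⟨J, hJ⟩
    have := fun l => mem_iUnion.1 (h3 (hJ l))
    choose k hk using this
    choose w hw hwp using hk
    refine mem_iUnion.2 ⟨k, (J, fun l => ⟨w l, (hw l).2⟩), fun l => (hw l).1, ?_⟩
    funext l
    simp [f, hwp l]
  have hconv : ∀ k, Convex ℝ (s k) := by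
    intro k
    have : s k = ⋂ l, ((H (k l)).subtype ∘ₗ LinearMap.proj l ∘ₗ LinearMap.snd ℝ X _) ⁻¹'
        Metric.ball (y (k l)) (ρ (k l)) := by
      ext q; simp [s]
    rw [this]
    exact convex_iInter fun l => (convex_ball _ _).linear_preimage _
  have hf : ∀ k, ContDiffOn ℝ 1 (f k) (s k) := by
    intro k
    refine contDiffOn_pi.2 fun l => ?_
    have hlin : ContDiff ℝ 1 fun q : X × ∀ l, H (k l) => (q.2 l : E) :=
      ((H (k l)).subtypeL.contDiff).comp ((ContinuousLinearMap.proj (R := ℝ) (φ := fun l => H (k l)) l).contDiff.comp contDiff_snd)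
    exact ((h2 (k l)).comp hlin.contDiffOn fun q (hq : q ∈ s k) => hq l).sub
      ((hτ l).comp contDiff_fst).contDiffOn
  -- Each of the `M` subspaces loses at least one dimension, while `J` restores fewer than `M`. This
  -- is where `hM` enters.
  have hle : ∀ k, dimH (f k '' s k) ≤ ((Module.finrank ℝ E * M - 1 : ℕ) : ENNReal) := by
    intro k
    refine ((hf k).dimH_image_le (hconv k) le_rfl).trans ((dimH_mono (subset_univ _)).trans ?_)
    rw [Real.dimH_univ_eq_finrank]
    have hrank : Module.finrank ℝ (X × ∀ l, H (k l)) + 1 ≤ Module.finrank ℝ E * M := by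
      rw [Module.finrank_prod, Module.finrank_pi_fintype]
      have h4 : ∑ l, Module.finrank ℝ (H (k l)) + M ≤ Module.finrank ℝ E * M := by
        calc ∑ l, Module.finrank ℝ (H (k l)) + M
            = ∑ l, (Module.finrank ℝ (H (k l)) + 1) := by simp [Finset.sum_add_distrib]
          _ ≤ ∑ _l : Fin M, Module.finrank ℝ E := Finset.sum_le_sum fun l _ => h1 (k l)
          _ = _ := by simp [mul_comm]
      omega
    exact_mod_cast (by omega : Module.finrank ℝ (X × ∀ l, H (k l)) ≤ Module.finrank ℝ E * M - 1)
  have hdim : Module.finrank ℝ (Fin M → E) = Module.finrank ℝ E * M := by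
    simp [Module.finrank_pi_fintype, mul_comm]
  refine ((dimH_mono hsub).trans_eq (dimH_iUnion _)).trans_lt ?_
  rw [hdim]
  have hpos : 0 < Module.finrank ℝ E * M :=
    Nat.mul_pos ((Nat.zero_le _).trans_lt (h1 i₀)) ((Nat.zero_le _).trans_lt hM)
  refine (iSup_le hle).trans_lt ?_
  exact_mod_cast (by omega : Module.finrank ℝ E * M - 1 < Module.finrank ℝ E * M)

end Thin
end SymplecticIFS
end

/-! ### Null sets on a manifold and the conull interior -/

noncomputable section
namespace SymplecticIFS

section Null

variable {m : ℕ} {N : Type*} [TopologicalSpace N] [ChartedSpace (Euc m) N]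

lemma IsLebesgueNull.mono {A B : Set N} (hB : IsLebesgueNull (m := m) B) (h : A ⊆ B) :
    IsLebesgueNull (m := m) A := fun e he =>
  measure_mono_null (image_mono (inter_subset_inter_left _ h)) (hB e he)

lemma IsLebesgueNull.iUnion {κ : Type*} [Countable κ] {A : κ → Set N}
    (h : ∀ k, IsLebesgueNull (m := m) (A k)) : IsLebesgueNull (m := m) (⋃ k, A k) := by
  intro e he
  rw [iUnion_inter, image_iUnion]
  exact measure_iUnion_null fun k => h k e he

lemma IsLebesgueNull.union {A B : Set N} (hA : IsLebesgueNull (m := m) A)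
    (hB : IsLebesgueNull (m := m) B) : IsLebesgueNull (m := m) (A ∪ B) := by
  rw [union_eq_iUnion]
  exact IsLebesgueNull.iUnion fun b => by cases b <;> assumption

/-- Composition with a submersion keeps the differential of a local defining function nonzero. -/
lemma IsHypersurface.isThin_preimage {E : Type} [NormedAddCommGroup E] [NormedSpace ℝ E]
    [FiniteDimensional ℝ E] {L : Set N} (hL : IsHypersurface (m := m) L) {F : E → N} {G : Set E}
    (hF : ∀ z ∈ G, ContMDiffAt 𝓘(ℝ, E) (𝓡 m) 1 F z)
    (hF' : ∀ z ∈ G, Function.Surjective (mfderiv 𝓘(ℝ, E) (𝓡 m) F z)) :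
    IsThin {z | z ∈ G ∧ F z ∈ L} := by
  refine isThin_of_forall fun z hz => ?_
  obtain ⟨V, u, hV, hzV, hu, hu', hLV⟩ := hL (F z) hz.2
  have huz : ContMDiffAt (𝓡 m) 𝓘(ℝ, ℝ) 1 u (F z) := hu.contMDiffAt (hV.mem_nhds hzV)
  refine ⟨u ∘ F, F ⁻¹' V, (hF z hz.1).continuousAt.preimage_mem_nhds (hV.mem_nhds hzV),
    (huz.comp z (hF z hz.1)).contDiffAt, ?_, ?_⟩
  · intro h0
    rw [← mfderiv_eq_fderiv, mfderiv_comp z (huz.mdifferentiableAt (by simp))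
      ((hF z hz.1).mdifferentiableAt (by simp))] at h0
    refine hu' (F z) hzV (ContinuousLinearMap.ext fun w => ?_)
    obtain ⟨v, rfl⟩ := hF' z hz.1 w
    exact congrArg (fun f : E →L[ℝ] ℝ => f v) h0
  · rintro w ⟨hw, hwV⟩
    have : F w ∈ L ∩ V := ⟨hw.2, hwV⟩
    rw [hLV] at this
    exact this.2

lemma IsHypersurface.isLebesgueNull [IsManifold (𝓡 m) ∞ N] {L : Set N}
    (hL : IsHypersurface (m := m) L) : IsLebesgueNull (m := m) L := by
  intro e he
  have h1 : IsThin {z | z ∈ e.target ∧ e.symm z ∈ L} := by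
    refine hL.isThin_preimage (fun z hz => ((contMDiffOn_symm_of_mem_maximalAtlas he).contMDiffAt
      (e.open_target.mem_nhds hz)).of_le (by simp)) fun z hz v => ?_
    refine ⟨tmap e (e.symm z) v, ?_⟩
    have := tmap_symm_tmap_chart he (e.map_target hz) v
    rwa [e.right_inv hz] at this
  refine (h1.mono ?_).measure_zero volume
  rintro _ ⟨x, hx, rfl⟩
  exact ⟨e.map_source hx.2, by rw [e.left_inv hx.2]; exact hx.1⟩

/-- A chart precomposed with `φ⁻¹` is again a chart of the maximal atlas, so the definition of null
sets can be tested there. -/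
lemma IsLebesgueNull.preimage [IsManifold (𝓡 m) ∞ N] {A : Set N}
    (hA : IsLebesgueNull (m := m) A) (φ : N ≃ₘ^∞⟮𝓡 m, 𝓡 m⟯ N) :
    IsLebesgueNull (m := m) (φ ⁻¹' A) := by
  intro e he
  let e' := φ.symm.toHomeomorph.toOpenPartialHomeomorph.trans e
  have h1 : ∀ x, e' x = e (φ.symm x) := fun x => rfl
  have h2 : ∀ y, e'.symm y = φ (e.symm y) := fun x => rfl
  have hs : e'.source = φ.symm ⁻¹' e.source := by
    ext x; simp [e']
  have ht : e'.target = e.target := by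
    ext x; simp [e']
  have he' : e' ∈ IsManifold.maximalAtlas (𝓡 m) ∞ N := by
    rw [IsManifold.mem_maximalAtlas_iff_contMDiffOn, hs, ht]
    exact ⟨(contMDiffOn_of_mem_maximalAtlas he).comp φ.symm.contMDiff.contMDiffOn fun x hx => hx,
      φ.contMDiff.comp_contMDiffOn (contMDiffOn_symm_of_mem_maximalAtlas he)⟩
  refine measure_mono_null ?_ (hA e' he')
  rintro _ ⟨x, hx, rfl⟩
  exact ⟨φ x, ⟨hx.1, by rw [hs]; simpa using hx.2⟩, by rw [h1]; simp⟩

/-- A nonempty open set is not a null set. -/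
lemma IsLebesgueNull.eq_empty_of_isOpen [IsManifold (𝓡 m) ∞ N] {A : Set N}
    (hA : IsLebesgueNull (m := m) A) (hAo : IsOpen A) : A = ∅ := by
  by_contra hne
  obtain ⟨x, hx⟩ := nonempty_iff_ne_empty.2 hne
  have h1 := hA (chartAt (Euc m) x) (IsManifold.chart_mem_maximalAtlas x)
  have h2 := (chartAt (Euc m) x).isOpen_image_of_subset_source
    (hAo.inter (chartAt (Euc m) x).open_source) inter_subset_right
  exact (h2.measure_pos volume ⟨_, mem_image_of_mem _ ⟨hx, mem_chart_source _ x⟩⟩).ne' h1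

/-- The largest open set in which `Q` has full measure. -/
def conullInterior (m : ℕ) {N : Type*} [TopologicalSpace N] [ChartedSpace (Euc m) N]
    (Q : Set N) : Set N :=
  ⋃₀ {U | IsOpen U ∧ IsLebesgueNull (m := m) (U \ Q)}

lemma isOpen_conullInterior (Q : Set N) : IsOpen (conullInterior m Q) :=
  isOpen_sUnion fun _ h => h.1

lemma subset_conullInterior {U Q : Set N} (hU : IsOpen U)
    (h : IsLebesgueNull (m := m) (U \ Q)) : U ⊆ conullInterior m Q :=
  subset_sUnion_of_mem ⟨hU, h⟩

/-- By the Lindelöf property, countably many of the open sets in the union already cover it. -/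
lemma isLebesgueNull_conullInterior_diff [SecondCountableTopology N] (Q : Set N) :
    IsLebesgueNull (m := m) (conullInterior m Q \ Q) := by
  obtain ⟨T, hT, hTs, hTU⟩ := TopologicalSpace.isOpen_sUnion_countable
    {U | IsOpen U ∧ IsLebesgueNull (m := m) (U \ Q)} fun _ h => h.1
  have : Countable T := hT.to_subtype
  rw [conullInterior, ← hTU, sUnion_eq_iUnion, iUnion_sdiff]
  exact IsLebesgueNull.iUnion fun U => (hTs U.2).2

lemma IsOpen.subset_conullInterior {Q : Set N} (hQ : IsOpen Q) : Q ⊆ conullInterior m Q :=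
  SymplecticIFS.subset_conullInterior hQ fun e _ => by simp

lemma preimage_conullInterior [IsManifold (𝓡 m) ∞ N] (φ : N ≃ₘ^∞⟮𝓡 m, 𝓡 m⟯ N) (Q : Set N) :
    φ ⁻¹' conullInterior m Q = conullInterior m (φ ⁻¹' Q) := by
  have key : ∀ (φ : N ≃ₘ^∞⟮𝓡 m, 𝓡 m⟯ N) (Q : Set N),
      φ ⁻¹' conullInterior m Q ⊆ conullInterior m (φ ⁻¹' Q) := by
    intro φ Q x hx
    obtain ⟨U, ⟨hU, hUQ⟩, hxU⟩ := hx
    exact subset_conullInterior (hU.preimage φ.continuous) (hUQ.preimage φ) hxU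
  refine (key φ Q).antisymm fun x hx => ?_
  have h1 := key φ.symm (φ ⁻¹' Q) (a := φ x) (by simpa using hx)
  rw [← preimage_comp] at h1
  have : (φ ∘ φ.symm : N → N) = id := funext φ.apply_symm_apply
  rwa [this, preimage_id] at h1

end Null
end SymplecticIFS
end

/-! ### Action-angle coordinates as smooth symplectic charts -/

noncomputable section
namespace SymplecticIFS

/-- An identification of `ℝⁿ × ℝⁿ` with `ℝ²ⁿ`. -/
def prodEquiv (n : ℕ) : (Euc n × Euc n) ≃L[ℝ] Euc (2 * n) :=
  ContinuousLinearEquiv.ofFinrankEq (by simp [two_mul])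

/-- The standard symplectic form of `ℝⁿ × ℝⁿ`. -/
def stdForm {n : ℕ} (u v : Euc n × Euc n) : ℝ := ∑ j, (u.1 j * v.2 j - v.1 j * u.2 j)

lemma stdForm_nondegenerate {n : ℕ} {u : Euc n × Euc n} (h : ∀ v, stdForm u v = 0) : u = 0 := by
  refine Prod.ext ?_ ?_
  · ext j
    have := h (0, EuclideanSpace.single j 1)
    simpa [stdForm] using this
  · ext j
    have := h (EuclideanSpace.single j 1, 0)
    simpa [stdForm] using this

namespace ActionAngle

variable {n : ℕ} {N : Type*} [TopologicalSpace N] [ChartedSpace (Euc (2 * n)) N]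
  {Ω : SymplecticForm n N} (A : ActionAngle Ω)

lemma isOpen_D : IsOpen A.D := by
  obtain ⟨e, -, h, -, -⟩ := A.D_cube
  exact h ▸ e.open_target

lemma isConnected_D : IsConnected A.D := by
  obtain ⟨e, h, h', hc, -⟩ := A.D_cube
  rw [← h', ← e.image_source_eq_target]
  refine IsConnected.image ?_ e e.continuousOn
  rw [h]
  refine ⟨⟨WithLp.toLp 2 fun _ => 1 / 2, fun j => by constructor <;> norm_num⟩,
    Convex.isPreconnected ?_⟩
  intro x hx y hy a b ha hb hab j
  have := (convex_Ioo (0 : ℝ) 1) (hx j) (hy j) ha hb hab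
  simpa using this

lemma contMDiffAt_param {I : Euc n} (hI : I ∈ A.D) (θ : Euc n) :
    ContMDiffAt 𝓘(ℝ, Euc n × Euc n) (𝓡 (2 * n)) ∞ A.param (I, θ) :=
  A.smooth.contMDiffAt ((A.isOpen_D.prod isOpen_univ).mem_nhds ⟨hI, mem_univ _⟩)

lemma param_mem {I : Euc n} (hI : I ∈ A.D) (θ : Euc n) : A.param (I, θ) ∈ A.carrier := by
  rw [← A.image_eq]
  exact mem_image_of_mem _ ⟨hI, mem_univ _⟩

lemma exists_param {x : N} (hx : x ∈ A.carrier) : ∃ I ∈ A.D, ∃ θ, A.param (I, θ) = x := by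
  rw [← A.image_eq] at hx
  obtain ⟨⟨I, θ⟩, h, rfl⟩ := hx
  exact ⟨I, h.1, θ, rfl⟩

/-- The derivative of the parametrization. -/
def dparam (z : Euc n × Euc n) : Euc n × Euc n →L[ℝ] Euc (2 * n) :=
  mfderiv 𝓘(ℝ, Euc n × Euc n) (𝓡 (2 * n)) A.param z

lemma at_dparam {I : Euc n} (hI : I ∈ A.D) (θ : Euc n) (u v : Euc n × Euc n) :
    Ω.at (A.param (I, θ)) ![A.dparam (I, θ) u, A.dparam (I, θ) v] = stdForm u v :=
  A.symplectic I hI θ u v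

/-- The derivative pulls the symplectic form back to the standard one, which is nondegenerate. -/
lemma dparam_injective {I : Euc n} (hI : I ∈ A.D) (θ : Euc n) :
    Function.Injective (A.dparam (I, θ)) := by
  rw [injective_iff_map_eq_zero]
  intro u hu
  refine stdForm_nondegenerate fun v => ?_
  rw [← A.at_dparam hI θ, hu]
  exact (Ω.at (A.param (I, θ))).map_coord_zero 0 rfl

/-- The derivative of the parametrization as a linear equivalence. -/
def dparamEquiv {I : Euc n} (hI : I ∈ A.D) (θ : Euc n) : (Euc n × Euc n) ≃L[ℝ] Euc (2 * n) :=
  (LinearEquiv.ofInjectiveOfFinrankEq (A.dparam (I, θ) : _ →ₗ[ℝ] _) (A.dparam_injective hI θ)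
    (by simp [two_mul])).toContinuousLinearEquiv

lemma coe_dparamEquiv {I : Euc n} (hI : I ∈ A.D) (θ : Euc n) :
    (A.dparamEquiv hI θ : Euc n × Euc n →L[ℝ] Euc (2 * n)) = A.dparam (I, θ) :=
  ContinuousLinearMap.ext fun _ => rfl

lemma dparam_surjective {I : Euc n} (hI : I ∈ A.D) (θ : Euc n) :
    Function.Surjective (A.dparam (I, θ)) := by
  rw [← coe_dparamEquiv A hI θ]
  exact (A.dparamEquiv hI θ).surjective

set_option linter.unusedSectionVars false
variable [IsManifold (𝓡 (2 * n)) ∞ N]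

lemma hasFDerivAt_chart_param {c : OpenPartialHomeomorph N (Euc (2 * n))}
    (hc : c ∈ IsManifold.maximalAtlas (𝓡 (2 * n)) ∞ N) {I : Euc n} (hI : I ∈ A.D) (θ : Euc n)
    (hx : A.param (I, θ) ∈ c.source) :
    ∃ T : (Euc n × Euc n) ≃L[ℝ] Euc (2 * n),
      HasFDerivAt (c ∘ A.param) (T : Euc n × Euc n →L[ℝ] Euc (2 * n)) (I, θ) := by
  have h1 : HasMFDerivAt (𝓡 (2 * n)) (𝓡 (2 * n)) c (A.param (I, θ)) (tmap c (A.param (I, θ))) :=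
    (mdifferentiableAt_chart hc hx).hasMFDerivAt
  have h2 : HasMFDerivAt 𝓘(ℝ, Euc n × Euc n) (𝓡 (2 * n)) A.param (I, θ) (A.dparam (I, θ)) :=
    ((A.contMDiffAt_param hI θ).mdifferentiableAt (by simp)).hasMFDerivAt
  have h3 := (h1.comp (I, θ) h2).hasFDerivAt
  have hinj : Function.Injective ((tmap c (A.param (I, θ))).comp (A.dparam (I, θ))) := by
    refine Function.Injective.comp (g := tmap c (A.param (I, θ))) ?_ (A.dparam_injective hI θ)
    exact Function.LeftInverse.injective (tmap_symm_tmap_chart hc hx)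
  refine ⟨(LinearEquiv.ofInjectiveOfFinrankEq
    ((tmap c (A.param (I, θ))).comp (A.dparam (I, θ)) : _ →ₗ[ℝ] _) hinj
    (by simp [two_mul])).toContinuousLinearEquiv, ?_⟩
  exact h3

lemma contDiffAt_chart_param {c : OpenPartialHomeomorph N (Euc (2 * n))}
    (hc : c ∈ IsManifold.maximalAtlas (𝓡 (2 * n)) ∞ N) {I : Euc n} (hI : I ∈ A.D) (θ : Euc n)
    (hx : A.param (I, θ) ∈ c.source) : ContDiffAt ℝ ∞ (c ∘ A.param) (I, θ) :=
  (((contMDiffOn_of_mem_maximalAtlas hc).contMDiffAt (c.open_source.mem_nhds hx)).comp (I, θ)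
    (A.contMDiffAt_param hI θ)).contDiffAt

lemma map_nhds_param {I : Euc n} (hI : I ∈ A.D) (θ : Euc n) :
    Filter.map A.param (𝓝 (I, θ)) = 𝓝 (A.param (I, θ)) := by
  set c := chartAt (Euc (2 * n)) (A.param (I, θ)) with hcdef
  have hc : c ∈ IsManifold.maximalAtlas (𝓡 (2 * n)) ∞ N := IsManifold.chart_mem_maximalAtlas _
  have hx : A.param (I, θ) ∈ c.source := mem_chart_source _ _
  obtain ⟨T, hT⟩ := A.hasFDerivAt_chart_param hc hI θ hx
  have h1 := ((A.contDiffAt_chart_param hc hI θ hx).hasStrictFDerivAt' hT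
    (by simp)).map_nhds_eq_of_equiv
  have h2 : A.param =ᶠ[𝓝 (I, θ)] c.symm ∘ (c ∘ A.param) := by
    filter_upwards [(A.contMDiffAt_param hI θ).continuousAt.preimage_mem_nhds
      (c.open_source.mem_nhds hx)] with z hz
    exact (c.left_inv hz).symm
  rw [Filter.map_congr h2, ← Filter.map_map, h1, Function.comp_apply, c.symm_map_nhds_eq hx]

lemma isOpen_image_param {U : Set (Euc n × Euc n)} (hU : IsOpen U) (hUD : U ⊆ A.D ×ˢ univ) :
    IsOpen (A.param '' U) := by
  rw [isOpen_iff_mem_nhds]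
  rintro _ ⟨⟨I, θ⟩, hz, rfl⟩
  rw [← A.map_nhds_param (hUD hz).1 θ]
  exact image_mem_map (hU.mem_nhds hz)

/-- Angles in a ball of radius `1 / 2` differ by less than `1` in each coordinate, whereas equal
values of `param` force integer differences. -/
lemma injOn_param (θ₀ : Euc n) : InjOn A.param (A.D ×ˢ Metric.ball θ₀ (1 / 2)) := by
  rintro ⟨I, θ⟩ ⟨hI, hθ⟩ ⟨I', θ'⟩ ⟨hI', hθ'⟩ h
  obtain ⟨rfl, hk⟩ := (A.param_eq_iff I hI I' hI' θ θ').1 h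
  refine Prod.ext rfl ?_
  ext j
  obtain ⟨k, hk⟩ := hk j
  have h1 : |θ' j - θ j| < 1 := by
    have h2 : ‖(θ' - θ) j‖ ≤ ‖θ' - θ‖ := PiLp.norm_apply_le _ j
    have h3 : dist θ' θ < 1 := by
      have := dist_triangle_right θ' θ θ₀
      rw [Metric.mem_ball] at hθ hθ'
      simp only at hθ hθ'
      linarith
    rw [dist_eq_norm] at h3
    exact h2.trans_lt h3
  rw [hk] at h1
  have h4 : |k| < 1 := (Int.cast_lt (R := ℝ)).1 (by simpa using h1)
  rw [Int.abs_lt_one_iff] at h4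
  rw [h4] at hk
  simp only [Int.cast_zero] at hk
  simpa using (sub_eq_zero.1 hk).symm

/-- Smooth charts given by action-angle coordinates. -/
lemma exists_chart (θ₀ : Euc n) : ∃ e ∈ IsManifold.maximalAtlas (𝓡 (2 * n)) ∞ N,
    e.target = (prodEquiv n).symm ⁻¹' (A.D ×ˢ Metric.ball θ₀ (1 / 2)) ∧
    e.source = A.param '' (A.D ×ˢ Metric.ball θ₀ (1 / 2)) ∧
    ⇑e.symm = A.param ∘ (prodEquiv n).symm := by
  set B := A.D ×ˢ Metric.ball θ₀ (1 / 2) with hB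
  have hBo : IsOpen B := A.isOpen_D.prod Metric.isOpen_ball
  have hBs : B ⊆ A.D ×ˢ univ := prod_mono_right (subset_univ _)
  set S := (prodEquiv n).symm ⁻¹' B with hS
  have hSo : IsOpen S := hBo.preimage (prodEquiv n).symm.continuous
  set F := A.param ∘ (prodEquiv n).symm with hF
  have himg : ∀ U : Set (Euc (2 * n)), F '' U = A.param '' ((prodEquiv n).symm '' U) :=
    fun U => image_comp _ _ _
  have himg' : ∀ U : Set (Euc (2 * n)), (prodEquiv n).symm '' U = prodEquiv n ⁻¹' U := fun U =>
    (prodEquiv n).symm.toEquiv.image_eq_preimage_symm U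
  have hinj : InjOn F S :=
    (A.injOn_param θ₀).comp (prodEquiv n).symm.injective.injOn fun x hx => hx
  have hsm : ContMDiffOn (𝓡 (2 * n)) (𝓡 (2 * n)) ∞ F S :=
    (A.smooth.mono hBs).comp (prodEquiv n).symm.contDiff.contMDiff.contMDiffOn fun x hx => hx
  let e0 : OpenPartialHomeomorph (Euc (2 * n)) N :=
    OpenPartialHomeomorph.ofContinuousOpenRestrict
      (hinj.bijOn_image.toPartialEquiv F S (F '' S)) hsm.continuousOn (by
        intro U hU
        have h1 : (S.domRestrict F) '' U = F '' (Subtype.val '' U) := by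
          rw [← image_comp]; rfl
        change IsOpen (S.domRestrict F '' U)
        rw [h1, himg, himg']
        refine A.isOpen_image_param ((hSo.isOpenMap_subtype_val U hU).preimage
          (prodEquiv n).continuous) ?_
        rintro z ⟨w, -, hw⟩
        refine hBs ?_
        have := w.2
        rw [hw] at this
        simpa [hS] using this) hSo
  have h0 : ⇑e0 = F := rfl
  have hs0 : e0.source = S := rfl
  refine ⟨e0.symm, ?_, rfl, ?_, rfl⟩
  · rw [IsManifold.mem_maximalAtlas_iff_contMDiffOn]
    refine ⟨fun x hx => ContMDiffAt.contMDiffWithinAt ?_, hsm⟩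
    obtain ⟨y, hy, rfl⟩ : ∃ y ∈ e0.source, e0 y = x := ⟨e0.symm x, e0.map_target hx, e0.right_inv hx⟩
    set c := chartAt (Euc (2 * n)) (e0 y) with hcdef
    have hc : c ∈ IsManifold.maximalAtlas (𝓡 (2 * n)) ∞ N := IsManifold.chart_mem_maximalAtlas _
    have hxc : e0 y ∈ c.source := mem_chart_source _ _
    have hyB : (prodEquiv n).symm y ∈ B := hy
    set z := (prodEquiv n).symm y with hz
    obtain ⟨T, hT⟩ := A.hasFDerivAt_chart_param hc (I := z.1) hyB.1 z.2 hxc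
    have hcd := A.contDiffAt_chart_param hc (I := z.1) hyB.1 z.2 hxc
    have hsrc : c (e0 y) ∈ (e0.trans c).target := (e0.trans c).map_source ⟨hy, hxc⟩
    have hsy : (e0.trans c).symm (c (e0 y)) = y := (e0.trans c).left_inv ⟨hy, hxc⟩
    have h1 : ContDiffAt ℝ ∞ (e0.trans c).symm (c (e0 y)) := by
      refine (e0.trans c).contDiffAt_symm (f₀' := (prodEquiv n).symm.trans T) hsrc ?_ ?_
      · rw [hsy]
        exact HasFDerivAt.comp (g := c ∘ A.param) y hT (prodEquiv n).symm.hasFDerivAt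
      · rw [hsy]
        exact ContDiffAt.comp (g := c ∘ A.param) y hcd (prodEquiv n).symm.contDiff.contDiffAt
    have h2 : ContMDiffAt (𝓡 (2 * n)) (𝓡 (2 * n)) ∞ ((e0.trans c).symm ∘ c) (e0 y) :=
      h1.contMDiffAt.comp (e0 y) ((contMDiffOn_of_mem_maximalAtlas hc).contMDiffAt
        (c.open_source.mem_nhds hxc))
    refine h2.congr_of_eventuallyEq ?_
    filter_upwards [c.open_source.mem_nhds hxc] with w hw
    change e0.symm w = e0.symm (c.symm (c w))
    rw [c.left_inv hw]
  · change F '' S = _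
    rw [himg, hS, image_preimage_eq _ (prodEquiv n).symm.surjective]

/-- Hamilton's equations in these charts become the standard ones. Vectors are carried by
`prodEquiv`, an arbitrary linear isomorphism not required to be symplectic for any fixed form. -/
lemma localForm_chart {e : OpenPartialHomeomorph N (Euc (2 * n))}
    (hsymm : ⇑e.symm = A.param ∘ (prodEquiv n).symm) {z : Euc n × Euc n} (hz : z.1 ∈ A.D)
    (u v : Euc n × Euc n) :
    localForm Ω.form e (prodEquiv n z) ![prodEquiv n u, prodEquiv n v] = stdForm u v := by
  have h1 : ∀ u, tmap e.symm (prodEquiv n z) (prodEquiv n u) = A.dparam z u := by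
    intro u
    have h2 : HasMFDerivAt 𝓘(ℝ, Euc n × Euc n) (𝓡 (2 * n)) A.param ((prodEquiv n).symm
        (prodEquiv n z)) (A.dparam z) := by
      rw [(prodEquiv n).symm_apply_apply]
      exact ((A.contMDiffAt_param hz z.2).mdifferentiableAt (by simp)).hasMFDerivAt
    have h3 : HasMFDerivAt (𝓡 (2 * n)) 𝓘(ℝ, Euc n × Euc n) (prodEquiv n).symm (prodEquiv n z)
        ((prodEquiv n).symm : Euc (2 * n) →L[ℝ] Euc n × Euc n) :=
      (prodEquiv n).symm.hasFDerivAt.hasMFDerivAt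
    have h4 : tmap e.symm (prodEquiv n z) =
        (A.dparam z).comp ((prodEquiv n).symm : Euc (2 * n) →L[ℝ] Euc n × Euc n) := by
      rw [hsymm]
      exact (h2.comp (prodEquiv n z) h3).mfderiv
    rw [h4]
    simp
  rw [localForm_apply, h1, h1, hsymm, Function.comp_apply, (prodEquiv n).symm_apply_apply]
  exact A.at_dparam hz z.2 u v

open Classical in
/-- The action coordinates. -/
def act (x : N) : Euc n := if h : ∃ I ∈ A.D, ∃ θ, A.param (I, θ) = x then h.choose else 0

omit [IsManifold (𝓡 (2 * n)) ∞ N] in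
lemma act_param {I : Euc n} (hI : I ∈ A.D) (θ : Euc n) : A.act (A.param (I, θ)) = I := by
  have h : ∃ I' ∈ A.D, ∃ θ', A.param (I', θ') = A.param (I, θ) := ⟨I, hI, θ, rfl⟩
  rw [act, dif_pos h]
  obtain ⟨h1, θ', h2⟩ := h.choose_spec
  exact ((A.param_eq_iff _ h1 _ hI _ _).1 h2).1

omit [IsManifold (𝓡 (2 * n)) ∞ N] in
lemma act_mem {x : N} (hx : x ∈ A.carrier) : A.act x ∈ A.D ∧ ∃ θ, A.param (A.act x, θ) = x := by
  obtain ⟨I, hI, θ, rfl⟩ := A.exists_param hx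
  rw [A.act_param hI]
  exact ⟨hI, θ, rfl⟩

lemma contMDiffAt_act {x : N} (hx : x ∈ A.carrier) :
    ContMDiffAt (𝓡 (2 * n)) 𝓘(ℝ, Euc n) ∞ A.act x := by
  obtain ⟨I, hI, θ, rfl⟩ := A.exists_param hx
  obtain ⟨e, he, het, hes, hsymm⟩ := A.exists_chart θ
  have hxe : A.param (I, θ) ∈ e.source :=
    hes ▸ mem_image_of_mem _ ⟨hI, Metric.mem_ball_self (by norm_num)⟩
  have h1 : ContMDiffAt (𝓡 (2 * n)) 𝓘(ℝ, Euc n) ∞ ((fun y => ((prodEquiv n).symm y).1) ∘ e)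
      (A.param (I, θ)) :=
    (contDiff_fst.comp (prodEquiv n).symm.contDiff).contMDiff.contMDiffAt.comp _
      ((contMDiffOn_of_mem_maximalAtlas he).contMDiffAt (e.open_source.mem_nhds hxe))
  refine h1.congr_of_eventuallyEq ?_
  filter_upwards [e.open_source.mem_nhds hxe] with y hy
  have h2 := e.map_source hy
  rw [het] at h2
  have h3 := e.left_inv hy
  rw [hsymm] at h3
  conv_lhs => rw [← h3]
  exact A.act_param h2.1 _

end ActionAngle
end SymplecticIFS
end

/-! ### Almost every rotation is nonresonant; saturation by tori -/

noncomputable section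
namespace SymplecticIFS

/-- The positive multiples of `α` are dense modulo `ℤⁿ`. -/
def IsNonresonant {n : ℕ} (α : Euc n) : Prop :=
  ∀ W : Set (Euc n), IsOpen W → W.Nonempty →
    ∃ k : ℕ, 0 < k ∧ ∃ m : Fin n → ℤ, (k : ℝ) • α + WithLp.toLp 2 (fun j => (m j : ℝ)) ∈ W

lemma norm_le_of_forall_abs_le_one {n : ℕ} {v : Euc n} (h : ∀ j, |v j| ≤ 1) : ‖v‖ ≤ n := by
  rw [EuclideanSpace.norm_eq]
  refine Real.sqrt_le_iff.2 ⟨by positivity, ?_⟩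
  calc ∑ j, ‖v j‖ ^ 2 ≤ ∑ _j : Fin n, (1 : ℝ) := Finset.sum_le_sum fun j _ => by
        have := h j
        rw [Real.norm_eq_abs]
        nlinarith [abs_nonneg (v j)]
    _ = n := by simp
    _ ≤ (n : ℝ) ^ 2 := by
        rcases Nat.eq_zero_or_pos n with rfl | h
        · simp
        · exact le_self_pow₀ (by exact_mod_cast h) (by norm_num)

/-- Around any `x`, the ball of radius `(C + ρ) / (k + 1)` contains a ball of radius `ρ / (k + 1)`
of vectors whose `(k + 1)`-th multiple, shifted by an integer vector, lies in the given ball. The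
set of avoiding vectors thus misses a fixed proportion of these balls, and has no density point. -/
lemma measure_multiples_avoid_ball {n : ℕ} (w : Euc n) {ρ : ℝ} (hρ : 0 < ρ) :
    volume {α : Euc n | ∀ k : ℕ, 0 < k → ∀ m : Fin n → ℤ,
      (k : ℝ) • α + WithLp.toLp 2 (fun j => (m j : ℝ)) ∉ Metric.closedBall w ρ} = 0 := by
  set R := {α : Euc n | ∀ k : ℕ, 0 < k → ∀ m : Fin n → ℤ,
      (k : ℝ) • α + WithLp.toLp 2 (fun j => (m j : ℝ)) ∉ Metric.closedBall w ρ} with hR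
  by_contra hne
  have : NeZero (volume.restrict R) := ⟨by rwa [Ne, Measure.restrict_eq_zero]⟩
  obtain ⟨x, hx⟩ := (Besicovitch.ae_tendsto_measure_inter_div volume R).exists
  -- The summand `n` bounds the norm of the vector of fractional parts of `(k + 1) • x`, so some
  -- integer translate of `w` is within `C` of `(k + 1) • x`.
  set C : ℝ := ‖w‖ + n with hC
  have hC0 : 0 ≤ C := by positivity
  set t : ℝ := ρ / (C + ρ) with ht
  have ht0 : 0 < t := by positivity
  set q : ENNReal := ENNReal.ofReal (t ^ Module.finrank ℝ (Euc n)) with hq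
  have hq0 : q ≠ 0 := by
    rw [hq, Ne, ENNReal.ofReal_eq_zero, not_le]
    positivity
  set s : ℕ → ℝ := fun k => (C + ρ) / (k + 1) with hs
  have hs0 : ∀ k, 0 < s k := fun k => by positivity
  have hlim : Tendsto s atTop (𝓝[>] 0) := by
    rw [tendsto_nhdsWithin_iff]
    refine ⟨?_, Eventually.of_forall hs0⟩
    simpa [hs, div_eq_mul_inv] using (tendsto_one_div_add_atTop_nhds_zero_nat (𝕜 := ℝ)).const_mul (C + ρ)
  have hle : ∀ k, volume (R ∩ Metric.closedBall x (s k)) / volume (Metric.closedBall x (s k)) + q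
      ≤ 1 := by
    intro k
    have hk : (0 : ℝ) < (k : ℝ) + 1 := by positivity
    set m : Fin n → ℤ := fun j => -⌊((k : ℝ) + 1) * x j⌋ with hm
    set M : Euc n := WithLp.toLp 2 (fun j => (m j : ℝ)) with hM
    set y : Euc n := ((k : ℝ) + 1)⁻¹ • (w - M) with hy
    have h1 : ‖w - M - ((k : ℝ) + 1) • x‖ ≤ C := by
      have h2 : ‖-M - ((k : ℝ) + 1) • x‖ ≤ n := by
        refine norm_le_of_forall_abs_le_one fun j => ?_
        have h3 : (-M - ((k : ℝ) + 1) • x) j = -Int.fract (((k : ℝ) + 1) * x j) := by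
          rw [Int.fract]
          simp [hM, hm, -Int.self_sub_floor]
        rw [h3, abs_neg, abs_of_nonneg (Int.fract_nonneg _)]
        exact (Int.fract_lt_one _).le
      calc ‖w - M - ((k : ℝ) + 1) • x‖ = ‖w + (-M - ((k : ℝ) + 1) • x)‖ := by congr 1; abel
        _ ≤ _ := (norm_add_le _ _).trans (by linarith)
    have h4 : dist y x ≤ C / (k + 1) := by
      have h5 : y - x = ((k : ℝ) + 1)⁻¹ • (w - M - ((k : ℝ) + 1) • x) := by
        rw [smul_sub _ (w - M), smul_smul, inv_mul_cancel₀ hk.ne', one_smul]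
      rw [dist_eq_norm, h5, norm_smul, Real.norm_of_nonneg (by positivity), inv_mul_eq_div]
      gcongr
    have hts : t * s k = ρ / (k + 1) := by
      rw [ht, hs]
      field_simp
    have hsub : Metric.closedBall y (t * s k) ⊆ Metric.closedBall x (s k) := by
      refine Metric.closedBall_subset_closedBall' ?_
      rw [hts]
      calc ρ / (k + 1) + dist y x ≤ ρ / (k + 1) + C / (k + 1) := by gcongr
        _ = s k := by rw [hs]; ring
    have hdisj : Disjoint (R ∩ Metric.closedBall x (s k)) (Metric.closedBall y (t * s k)) := by
      rw [disjoint_left]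
      rintro α ⟨hα, -⟩ hαy
      refine hα (k + 1) k.succ_pos m ?_
      rw [Metric.mem_closedBall, dist_eq_norm, hts] at hαy
      rw [Metric.mem_closedBall, dist_eq_norm]
      have h6 : ((k + 1 : ℕ) : ℝ) • α + M - w = ((k : ℝ) + 1) • (α - y) := by
        rw [smul_sub, hy, smul_smul, mul_inv_cancel₀ hk.ne', one_smul]
        push_cast
        abel
      rw [h6, norm_smul, Real.norm_of_nonneg hk.le]
      calc ((k : ℝ) + 1) * ‖α - y‖ ≤ ((k : ℝ) + 1) * (ρ / (k + 1)) := by gcongr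
        _ = ρ := by field_simp
    have hμ : volume (Metric.closedBall y (t * s k)) = q * volume (Metric.closedBall x (s k)) := by
      rw [Measure.addHaar_closedBall_mul _ _ ht0.le (hs0 k).le,
        Measure.addHaar_closedBall_center volume x]
    have h7 : volume (R ∩ Metric.closedBall x (s k)) + q * volume (Metric.closedBall x (s k)) ≤
        volume (Metric.closedBall x (s k)) := by
      rw [← hμ, ← measure_union hdisj Metric.isClosed_closedBall.measurableSet]
      exact measure_mono (union_subset inter_subset_right hsub)
    have h8 : volume (Metric.closedBall x (s k)) ≠ 0 :=
      (Metric.measure_closedBall_pos volume x (hs0 k)).ne'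
    have h9 : volume (Metric.closedBall x (s k)) ≠ ⊤ := measure_closedBall_lt_top.ne
    calc _ = (volume (R ∩ Metric.closedBall x (s k)) + q * volume (Metric.closedBall x (s k))) /
          volume (Metric.closedBall x (s k)) := by
          rw [ENNReal.add_div, ENNReal.mul_div_cancel_right h8 h9]
      _ ≤ volume (Metric.closedBall x (s k)) / volume (Metric.closedBall x (s k)) := by gcongr
      _ = 1 := ENNReal.div_self h8 h9
  have h10 : (1 : ENNReal) + q ≤ 1 :=
    le_of_tendsto ((hx.comp hlim).add_const q) (Eventually.of_forall hle)
  exact absurd h10 (not_le.2 (ENNReal.lt_add_right ENNReal.one_ne_top hq0))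

lemma ae_isNonresonant (n : ℕ) : ∀ᵐ α : Euc n, IsNonresonant α := by
  have h1 : ∀ V : TopologicalSpace.countableBasis (Euc n), ∀ᵐ α : Euc n,
      ∃ k : ℕ, 0 < k ∧ ∃ m : Fin n → ℤ,
        (k : ℝ) • α + WithLp.toLp 2 (fun j => (m j : ℝ)) ∈ (V : Set (Euc n)) := by
    intro V
    obtain ⟨w, hw⟩ := TopologicalSpace.nonempty_of_mem_countableBasis V.2
    obtain ⟨ρ, hρ, hρV⟩ := Metric.nhds_basis_closedBall.mem_iff.1
      ((TopologicalSpace.isOpen_of_mem_countableBasis V.2).mem_nhds hw)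
    have h2 := measure_multiples_avoid_ball w hρ
    rw [measure_eq_zero_iff_ae_notMem] at h2
    filter_upwards [h2] with α hα
    by_contra! hcon
    exact hα fun k hk m hm => hcon k hk m (hρV hm)
  have : Countable (TopologicalSpace.countableBasis (Euc n)) :=
    (TopologicalSpace.countable_countableBasis _).to_subtype
  filter_upwards [ae_all_iff.2 h1] with α hα W hW hne
  obtain ⟨w, hw⟩ := hne
  obtain ⟨V, hV, -, hVW⟩ := (TopologicalSpace.isBasis_countableBasis (Euc n)).exists_subset_of_mem_open
    hw hW
  obtain ⟨k, hk, m, hm⟩ := hα ⟨V, hV⟩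
  exact ⟨k, hk, m, hVW hm⟩

lemma ae_isNonresonant_smul (n : ℕ) {c : ℝ} (hc : c ≠ 0) :
    ∀ᵐ α : Euc n, IsNonresonant (c • α) := by
  have h := ae_isNonresonant n
  rw [ae_iff] at h ⊢
  have := Measure.addHaar_preimage_smul (volume : Measure (Euc n)) hc {α | ¬ IsNonresonant α}
  rw [h, mul_zero] at this
  exact this

/-- Locally the preimage is the image of a null set under a differentiable inverse branch; this is
how nonresonance for almost every vector becomes nonresonance for almost every action. -/
lemma measure_preimage_localDiffeomorph {n : ℕ} {r : ℕ∞} (hr : 1 ≤ r) {α : Euc n → Euc n}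
    {D : Set (Euc n)} (hα : IsLocalDiffeomorphOn 𝓘(ℝ, Euc n) 𝓘(ℝ, Euc n) r α D)
    {Z : Set (Euc n)} (hZ : volume Z = 0) : volume {I ∈ D | α I ∈ Z} = 0 := by
  refine measure_null_of_locally_null _ fun I hI => ?_
  obtain ⟨Φ, hΦ, hΦα⟩ := hα ⟨I, hI.1⟩
  refine ⟨Φ.source ∩ {I ∈ D | α I ∈ Z}, inter_comm Φ.source _ ▸ inter_mem_nhdsWithin _ (Φ.open_source.mem_nhds hΦ), ?_⟩
  have h1 : volume (Φ.symm '' (Φ.target ∩ Z)) = 0 := by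
    refine addHaar_image_eq_zero_of_differentiableOn_of_addHaar_eq_zero volume ?_
      (measure_mono_null inter_subset_right hZ)
    have h2 : ContDiffOn ℝ r Φ.symm Φ.target := Φ.symm.contMDiffOn.contDiffOn
    exact (h2.differentiableOn (by
      have : (1 : WithTop ℕ∞) ≤ r := by exact_mod_cast hr
      exact (zero_lt_one.trans_le this).ne')).mono inter_subset_left
  refine measure_mono_null ?_ h1
  rintro J ⟨hJ, -, hJZ⟩
  rw [hΦα hJ] at hJZ
  exact ⟨Φ J, ⟨Φ.map_source hJ, hJZ⟩, Φ.left_inv hJ⟩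

/-- The pushforward of Lebesgue measure by a linear isomorphism is a Haar measure, hence has the
same null sets as Lebesgue measure. -/
lemma volume_preimage_prodEquiv {n : ℕ} {S : Set (Euc n × Euc n)} :
    volume (prodEquiv n '' S) = 0 ↔ volume S = 0 := by
  set μ : Measure (Euc (2 * n)) := Measure.map (prodEquiv n) volume with hμ
  have h0 : (volume : Measure (Euc n × Euc n)).IsAddHaarMeasure :=
    Measure.prod.instIsAddHaarMeasure volume volume
  have h1 : μ.IsAddHaarMeasure := (prodEquiv n).isAddHaarMeasure_map volume
  have h2 : μ (prodEquiv n '' S) = volume S := by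
    refine ((prodEquiv n).toHomeomorph.measurableEmbedding.map_apply volume _).trans ?_
    exact congrArg _ (preimage_image_eq S (prodEquiv n).injective)
  rw [← h2]
  exact ⟨fun h => (Measure.absolutelyContinuous_isAddHaarMeasure μ volume) h,
    fun h => (Measure.absolutelyContinuous_isAddHaarMeasure volume μ) h⟩

namespace ActionAngle

variable {n : ℕ} {N : Type*} [TopologicalSpace N] [ChartedSpace (Euc (2 * n)) N]
  {Ω : SymplecticForm n N} (A : ActionAngle Ω) [IsManifold (𝓡 (2 * n)) ∞ N]

lemma volume_preimage_param {S : Set N} (hS : IsLebesgueNull (m := 2 * n) S) :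
    volume {z : Euc n × Euc n | z.1 ∈ A.D ∧ A.param z ∈ S} = 0 := by
  refine measure_null_of_locally_null _ fun z hz => ?_
  obtain ⟨e, he, het, hes, hsymm⟩ := A.exists_chart z.2
  refine ⟨_, inter_mem_nhdsWithin _ ((A.isOpen_D.prod Metric.isOpen_ball).mem_nhds
    ⟨hz.1, Metric.mem_ball_self (show (0 : ℝ) < 1 / 2 by norm_num)⟩), ?_⟩
  rw [← volume_preimage_prodEquiv]
  refine measure_mono_null ?_ (hS e he)
  rintro _ ⟨w, ⟨⟨-, hwS⟩, hwB⟩, rfl⟩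
  have h1 : prodEquiv n w ∈ e.target := by rw [het]; simpa using hwB
  have h2 : e.symm (prodEquiv n w) = A.param w := by rw [hsymm]; simp
  exact ⟨A.param w, ⟨hwS, h2 ▸ e.map_target h1⟩, by rw [← h2, e.right_inv h1]⟩

lemma isLebesgueNull_image_param {T : Set (Euc n × Euc n)} (hT : volume T = 0) :
    IsLebesgueNull (m := 2 * n) (A.param '' (T ∩ A.D ×ˢ univ)) := by
  intro c hc
  set G := prodEquiv n '' {z | z ∈ T ∧ z.1 ∈ A.D ∧ A.param z ∈ c.source} with hG
  have h1 : volume G = 0 :=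
    measure_mono_null (image_mono fun z hz => hz.1) (volume_preimage_prodEquiv.2 hT)
  refine measure_mono_null ?_ (addHaar_image_eq_zero_of_differentiableOn_of_addHaar_eq_zero
    (f := (c ∘ A.param) ∘ (prodEquiv n).symm) volume ?_ h1)
  · rintro _ ⟨_, ⟨⟨z, hz, rfl⟩, hzc⟩, rfl⟩
    exact ⟨prodEquiv n z, ⟨z, ⟨hz.1, hz.2.1, hzc⟩, rfl⟩, by simp⟩
  · rintro _ ⟨z, hz, rfl⟩
    refine DifferentiableAt.differentiableWithinAt (DifferentiableAt.comp (g := c ∘ A.param) _ ?_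
      (prodEquiv n).symm.differentiableAt)
    rw [(prodEquiv n).symm_apply_apply]
    exact (A.contDiffAt_chart_param hc hz.2.1 z.2 hz.2.2).differentiableAt (by simp)

/-- The set in which an invariant open set has full measure is a union of invariant tori. -/
lemma conullInterior_saturated [SecondCountableTopology N] {r : ℕ∞} (hr : 1 ≤ r) {α : Euc n → Euc n}
    (hα : IsLocalDiffeomorphOn 𝓘(ℝ, Euc n) 𝓘(ℝ, Euc n) r α A.D) {Q : Set N} (hQ : IsOpen Q)
    {c : ℝ} (hc : c ≠ 0)
    (hQα : ∀ I ∈ A.D, ∀ θ, A.param (I, θ + c • α I) ∈ Q → A.param (I, θ) ∈ Q)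
    {I : Euc n} (hI : I ∈ A.D) {θ : Euc n} (h : A.param (I, θ) ∈ conullInterior (2 * n) Q)
    (θ' : Euc n) : A.param (I, θ') ∈ conullInterior (2 * n) Q := by
  obtain ⟨V, hV, W, hW, hVW⟩ := mem_nhds_prod_iff.1 ((A.contMDiffAt_param hI θ).continuousAt
    ((isOpen_conullInterior Q).mem_nhds h))
  obtain ⟨V', hV'V, hV'o, hIV'⟩ := mem_nhds_iff.1 (inter_mem hV (A.isOpen_D.mem_nhds hI))
  have h1 := A.volume_preimage_param (isLebesgueNull_conullInterior_diff (m := 2 * n) Q)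
  have h2 := Measure.measure_ae_null_of_prod_null (μ := volume) (ν := volume) h1
  have h3 : ∀ᵐ J : Euc n, J ∈ A.D → IsNonresonant (c • α J) := by
    have := measure_preimage_localDiffeomorph hr hα (ae_iff.1 (ae_isNonresonant_smul n hc))
    rw [ae_iff]
    refine measure_mono_null (fun J hJ => ?_) this
    rw [mem_ofPred_eq, Classical.not_imp] at hJ
    exact hJ
  have hiter : ∀ J ∈ A.D, ∀ k : ℕ, ∀ τ, A.param (J, τ + (k : ℝ) • (c • α J)) ∈ Q →
      A.param (J, τ) ∈ Q := by
    intro J hJ k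
    induction k with
    | zero => intro τ hτ; simpa using hτ
    | succ k ih =>
      intro τ hτ
      refine hQα J hJ τ (ih _ ?_)
      convert hτ using 3
      push_cast
      module
  have h4 : ∀ᵐ J : Euc n, J ∈ V' → ∀ τ, A.param (J, τ) ∈ Q := by
    filter_upwards [h2, h3] with J hJ2 hJ3 hJV τ
    have hJD : J ∈ A.D := (hV'V hJV).2
    -- By Fubini the complement of `Q` is null in almost every torus near the given point, while `W`
    -- has positive measure.
    obtain ⟨τ₁, hτ₁W, hτ₁⟩ : ∃ τ₁ ∈ W, A.param (J, τ₁) ∈ Q := by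
      by_contra! hcon
      refine (Measure.measure_pos_of_mem_nhds volume hW).ne' (measure_mono_null (fun τ₁ hτ₁ => ?_) hJ2)
      exact ⟨hJD, hVW ⟨(hV'V hJV).1, hτ₁⟩, hcon τ₁ hτ₁⟩
    have hcont : Continuous fun τ₂ : Euc n => A.param (J, τ₂) := continuous_iff_continuousAt.2
      fun τ₂ => (A.contMDiffAt_param hJD τ₂).continuousAt.comp
        (Continuous.prodMk_right J).continuousAt
    -- Some positive multiple of the rotation takes `τ` close to `τ₁`, into the open set `Q`; the
    -- hypothesis on `Q` then brings membership back to `τ`.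
    obtain ⟨k, -, m, hm⟩ := hJ3 hJD ((fun τ₂ => τ + τ₂) ⁻¹' ((fun τ₂ => A.param (J, τ₂)) ⁻¹' Q))
      ((hQ.preimage hcont).preimage (continuous_const_add τ)) ⟨τ₁ - τ, by simpa using hτ₁⟩
    refine hiter J hJD k τ ?_
    rw [mem_preimage, mem_preimage] at hm
    convert hm using 1
    refine (A.param_eq_iff J hJD J hJD _ _).2 ⟨rfl, fun j => ⟨m j, ?_⟩⟩
    simp
  have h5 : IsOpen (A.param '' (V' ×ˢ univ)) :=
    A.isOpen_image_param (hV'o.prod isOpen_univ) (prod_mono_left fun J hJ => (hV'V hJ).2)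
  refine subset_conullInterior h5 ?_ (mem_image_of_mem _ ⟨hIV', mem_univ θ'⟩)
  have h6 : volume ({J : Euc n | ¬ (J ∈ V' → ∀ τ, A.param (J, τ) ∈ Q)} ×ˢ (univ : Set (Euc n)))
      = 0 := by
    rw [Measure.volume_eq_prod, Measure.prod_prod, ae_iff.1 h4, zero_mul]
  refine (A.isLebesgueNull_image_param h6).mono ?_
  rintro _ ⟨⟨⟨J, τ⟩, hJ, rfl⟩, hJQ⟩
  exact ⟨(J, τ), ⟨⟨fun hcon => hJQ (hcon hJ.1 τ), mem_univ _⟩, (hV'V hJ.1).2, mem_univ _⟩, rfl⟩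

end ActionAngle
end SymplecticIFS
end

/-! ### Explicit twist families -/

noncomputable section
namespace SymplecticIFS

/-- The linear family of Hamiltonians `-⟨a, I⟩ + ⟨b, θ - θ₀⟩ + (s / 2) ‖θ - θ₀‖²` with parameter
`(b, a, s)`. -/
def twistHamiltonian {n : ℕ} (θ₀ : Euc n) (z : Euc n × Euc n) : (Euc n × Euc n × ℝ) →L[ℝ] ℝ :=
  -(innerSL ℝ z.1 ∘L ContinuousLinearMap.fst ℝ (Euc n) ℝ ∘L
      ContinuousLinearMap.snd ℝ (Euc n) (Euc n × ℝ)) +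
    innerSL ℝ (z.2 - θ₀) ∘L ContinuousLinearMap.fst ℝ (Euc n) (Euc n × ℝ) +
    (‖z.2 - θ₀‖ ^ 2 / 2) • (ContinuousLinearMap.snd ℝ (Euc n) ℝ ∘L
      ContinuousLinearMap.snd ℝ (Euc n) (Euc n × ℝ))

lemma twistHamiltonian_apply {n : ℕ} (θ₀ : Euc n) (z : Euc n × Euc n) (b a : Euc n) (s : ℝ) :
    twistHamiltonian θ₀ z (b, a, s) =
      -inner ℝ z.1 a + inner ℝ (z.2 - θ₀) b + ‖z.2 - θ₀‖ ^ 2 / 2 * s := by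
  simp [twistHamiltonian, inner_sub_left]

lemma contDiff_twistHamiltonian {n : ℕ} (θ₀ : Euc n) : ContDiff ℝ ∞ (twistHamiltonian θ₀) := by
  have h1 : ContDiff ℝ ∞ fun z : Euc n × Euc n => z.2 - θ₀ := contDiff_snd.sub contDiff_const
  exact ((((innerSL ℝ).contDiff.comp contDiff_fst).clm_comp contDiff_const).neg.add
    (((innerSL ℝ).contDiff.comp h1).clm_comp contDiff_const)).add
    (((h1.norm_sq ℝ).div_const 2).smul contDiff_const)

/-- Identifies the Hamiltonian vector field as `(b + s • (θ - θ₀), a)`: a translation in both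
variables plus a shear of the actions along the angles. -/
lemma hasDerivAt_twistHamiltonian {n : ℕ} (θ₀ : Euc n) (z v : Euc n × Euc n) (b a : Euc n) (s : ℝ) :
    HasDerivAt (fun t : ℝ => twistHamiltonian θ₀ (z + t • v) (b, a, s))
      (stdForm (b + s • (z.2 - θ₀), a) v) 0 := by
  have h1 : (fun t : ℝ => twistHamiltonian θ₀ (z + t • v) (b, a, s)) = fun t =>
      twistHamiltonian θ₀ z (b, a, s) + t * (-inner ℝ v.1 a + inner ℝ v.2 b +
        s * inner ℝ (z.2 - θ₀) v.2) + t ^ 2 * (‖v.2‖ ^ 2 / 2 * s) := by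
    funext t
    rw [twistHamiltonian_apply, twistHamiltonian_apply]
    have h2 : (z + t • v).2 - θ₀ = (z.2 - θ₀) + t • v.2 := by
      simp only [Prod.snd_add, Prod.smul_snd]
      abel
    rw [h2, norm_add_sq_real]
    simp only [Prod.fst_add, Prod.smul_fst, inner_add_left, inner_smul_left, inner_smul_right,
      norm_smul, mul_pow, Real.norm_eq_abs, sq_abs, RCLike.conj_to_real]
    ring
  have h3 : stdForm (b + s • (z.2 - θ₀), a) v =
      -inner ℝ v.1 a + inner ℝ v.2 b + s * inner ℝ (z.2 - θ₀) v.2 := by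
    simp only [stdForm, PiLp.inner_apply, RCLike.inner_apply, conj_trivial, Finset.mul_sum,
      ← Finset.sum_neg_distrib, ← Finset.sum_add_distrib]
    refine Finset.sum_congr rfl fun j _ => ?_
    simp only [PiLp.add_apply, PiLp.smul_apply, PiLp.sub_apply, smul_eq_mul]
    ring
  rw [h1, h3]
  have h4 := (((hasDerivAt_id (0 : ℝ)).mul_const (-inner ℝ v.1 a + inner ℝ v.2 b +
        s * inner ℝ (z.2 - θ₀) v.2)).const_add (twistHamiltonian θ₀ z (b, a, s))).add
        (((hasDerivAt_id (0 : ℝ)).pow 2).mul_const (‖v.2‖ ^ 2 / 2 * s))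
  refine HasDerivAt.congr_deriv h4 ?_
  simp

namespace ActionAngle

variable {n : ℕ} {N : Type*} [TopologicalSpace N] [ChartedSpace (Euc (2 * n)) N]
  {Ω : SymplecticForm n N} (A : ActionAngle Ω) [IsManifold (𝓡 (2 * n)) ∞ N]

/-- A family of symplectic diffeomorphisms supported near `{θ = θ₀}`, with an explicit
expression there. -/
theorem exists_twistFamily [T2Space N] {R : Set (Euc n)} (hR : IsCompact R) (hRD : R ⊆ A.D)
    (θ₀ : Euc n) {ρ : ℝ} (hρ : 0 < ρ) (hρ' : ρ < 1 / 2) :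
    ∃ F : SympFamily Ω (Euc n × Euc n × ℝ), F.S ⊆ A.param '' (A.D ×ˢ Metric.ball θ₀ ρ) ∧
      (∀ p ∈ Metric.ball 0 F.ε, ∀ x ∈ A.carrier, F.F p x ∈ A.carrier) ∧
      ∃ δ, 0 < δ ∧ δ ≤ F.ε ∧ ∀ b a : Euc n, ∀ s : ℝ, ‖b‖ < δ → ‖a‖ < δ → |s| < δ →
        ∀ I ∈ R, ∀ θ ∈ Metric.ball θ₀ δ, I + b + s • (θ - θ₀) + (s / 2) • a ∈ A.D ∧
          F.F (b, a, s) (A.param (I, θ)) =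
            A.param (I + b + s • (θ - θ₀) + (s / 2) • a, θ + a) := by
  obtain ⟨e, he, het, hes, hsymm⟩ := A.exists_chart θ₀
  set B := A.D ×ˢ Metric.ball θ₀ ρ with hB
  have hBo : IsOpen B := A.isOpen_D.prod Metric.isOpen_ball
  have hK : IsCompact (prodEquiv n '' (R ×ˢ {θ₀})) :=
    (hR.prod isCompact_singleton).image (prodEquiv n).continuous
  have hBo' : IsOpen (prodEquiv n '' B) := (prodEquiv n).toHomeomorph.isOpenMap _ hBo
  obtain ⟨L, hL, hKL, hLB⟩ := exists_compact_between hK hBo'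
    (image_mono (prod_mono hRD (singleton_subset_iff.2 (Metric.mem_ball_self hρ))))
  obtain ⟨χ, hχ1, hχ0, -⟩ := exists_contMDiffMap_one_nhds_of_subset_interior (n := ⊤)
    𝓘(ℝ, Euc (2 * n)) hK.isClosed hKL
  have hχs : ContDiff ℝ ∞ χ := χ.contMDiff.contDiff
  set h : Euc (2 * n) → (Euc n × Euc n × ℝ) →L[ℝ] ℝ :=
    fun y => χ y • twistHamiltonian θ₀ ((prodEquiv n).symm y) with hh
  have hhs : ContDiff ℝ ∞ h :=
    hχs.smul ((contDiff_twistHamiltonian θ₀).comp (prodEquiv n).symm.contDiff)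
  have hts : tsupport h ⊆ L := closure_minimal (fun y hy => by
    by_contra hcon
    exact hy (by simp [hh, hχ0 y hcon])) hL.isClosed
  have hcs : HasCompactSupport h := hL.of_isClosed_subset (isClosed_tsupport h) hts
  have hBt : prodEquiv n '' B ⊆ e.target := by
    rw [het]
    rintro _ ⟨z, hz, rfl⟩
    rw [mem_preimage, (prodEquiv n).symm_apply_apply]
    exact ⟨hz.1, Metric.ball_subset_ball hρ'.le hz.2⟩
  obtain ⟨F, hFS, hFe, hFsol, -⟩ := exists_sympFamily (Ω := Ω) he hhs hcs ((hts.trans hLB).trans hBt)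
  have hSB : F.S ⊆ A.param '' B := by
    rw [hFS]
    rintro _ ⟨y, hy, rfl⟩
    obtain ⟨z, hz, rfl⟩ := hLB (hts hy)
    exact ⟨z, hz, by rw [hsymm]; simp⟩
  have hecar : e.source ⊆ A.carrier := by
    rw [hes, ← A.image_eq]
    exact image_mono (prod_mono_right (subset_univ _))
  refine ⟨F, hSB, fun p hp x hx => ?_, ?_⟩
  · by_cases hxe : x ∈ e.source
    · exact hecar (hFe p hp x hxe)
    · rw [F.fix p hp x fun hxS => hxe ?_]
      · exact hx
      · rw [hes]
        exact (hSB.trans (image_mono (prod_mono_right (Metric.ball_subset_ball hρ'.le)))) hxS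
  obtain ⟨O, hO, hKO, hOχ⟩ := mem_nhdsSet_iff_exists.1 hχ1
  have hOO : IsOpen (prodEquiv n ⁻¹' O ∩ B) := (hO.preimage (prodEquiv n).continuous).inter hBo
  obtain ⟨δ', hδ', hδ'O⟩ := (hR.prod (isCompact_singleton (x := θ₀))).exists_cthickening_subset_open
    hOO fun z hz => ⟨hKO (mem_image_of_mem _ hz),
      hRD hz.1, by rw [show z.2 = θ₀ from hz.2]; exact Metric.mem_ball_self hρ⟩
  -- The bound `1` absorbs products of small quantities; `δ' / 4` keeps the sums of at most three
  -- terms below within the `δ'`-neighbourhood where the cut-off equals `1`.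
  refine ⟨min F.ε (min 1 (δ' / 4)), lt_min F.ε_pos (lt_min one_pos (by positivity)),
    min_le_left _ _, fun b a s hb ha hs I hI θ hθ => ?_⟩
  set δ := min F.ε (min 1 (δ' / 4)) with hδ
  have hδ1 : δ ≤ 1 := (min_le_right _ _).trans (min_le_left _ _)
  have hδ4 : δ ≤ δ' / 4 := (min_le_right _ _).trans (min_le_right _ _)
  have hδ0 : 0 < δ := lt_min F.ε_pos (lt_min one_pos (by positivity))
  rw [Metric.mem_ball, dist_eq_norm] at hθ
  -- The integral curve in closed form: the angle moves with constant speed `a`, and the action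
  -- speed is affine in the angle, which produces the term quadratic in `t`.
  set c : ℝ → Euc n × Euc n := fun t =>
    (I + t • b + s • (t • (θ - θ₀)) + (t ^ 2 * (s / 2)) • a, θ + t • a) with hc
  have hcmem : ∀ t ∈ Icc (0 : ℝ) 1, c t ∈ prodEquiv n ⁻¹' O ∩ B := by
    intro t ht
    refine hδ'O (Metric.mem_cthickening_of_dist_le _ (I, θ₀) _ _ ⟨hI, rfl⟩ ?_)
    have e1 : ‖t • b‖ ≤ δ := by
      rw [norm_smul, Real.norm_of_nonneg ht.1]
      nlinarith [norm_nonneg b, ht.1, ht.2]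
    have e2 : ‖t • a‖ ≤ δ := by
      rw [norm_smul, Real.norm_of_nonneg ht.1]
      nlinarith [norm_nonneg a, ht.1, ht.2]
    have e3 : ‖t • (θ - θ₀)‖ ≤ δ := by
      rw [norm_smul, Real.norm_of_nonneg ht.1]
      nlinarith [norm_nonneg (θ - θ₀), ht.1, ht.2]
    have e4 : ‖s • (t • (θ - θ₀))‖ ≤ δ := by
      rw [norm_smul, Real.norm_eq_abs]
      nlinarith [norm_nonneg (t • (θ - θ₀)), abs_nonneg s]
    have e5 : ‖(t ^ 2 * (s / 2)) • a‖ ≤ δ := by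
      have : (t ^ 2 * (s / 2)) • a = (t * (s / 2)) • (t • a) := by rw [smul_smul]; ring_nf
      rw [this, norm_smul, norm_mul, norm_div, Real.norm_of_nonneg ht.1, Real.norm_eq_abs]
      have h2 : t * (|s| / ‖(2 : ℝ)‖) ≤ 1 := by
        rw [Real.norm_of_nonneg (by norm_num : (0 : ℝ) ≤ 2)]
        nlinarith [abs_nonneg s, ht.1, ht.2]
      nlinarith [norm_nonneg (t • a)]
    rw [dist_eq_norm, Prod.norm_def]
    refine max_le ?_ ?_
    · have : (c t - (I, θ₀)).1 = t • b + s • (t • (θ - θ₀)) + (t ^ 2 * (s / 2)) • a := by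
        simp only [hc, Prod.fst_sub]
        abel
      rw [this]
      refine (norm_add_le _ _).trans ?_
      have := norm_add_le (t • b) (s • (t • (θ - θ₀)))
      linarith
    · have : (c t - (I, θ₀)).2 = (θ - θ₀) + t • a := by
        simp only [hc, Prod.snd_sub]
        abel
      rw [this]
      refine (norm_add_le _ _).trans ?_
      linarith
  have hp : (b, a, s) ∈ Metric.ball (0 : Euc n × Euc n × ℝ) F.ε := by
    have : δ ≤ F.ε := min_le_left _ _
    rw [mem_ball_zero_iff, Prod.norm_def, Prod.norm_def]
    exact max_lt (hb.trans_le this) (max_lt (ha.trans_le this) (hs.trans_le this))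
  have hc1 : c 1 = (I + b + s • (θ - θ₀) + (s / 2) • a, θ + a) := by simp [hc]
  have hc0 : c 0 = (I, θ) := by simp [hc]
  have hsy : ∀ z, e.symm (prodEquiv n z) = A.param z := fun z => by rw [hsymm]; simp
  refine ⟨?_, ?_⟩
  · have := (hcmem 1 ⟨zero_le_one, le_rfl⟩).2.1
    rwa [hc1] at this
  have key := hFsol (b, a, s) hp (fun t => prodEquiv n (c t)) fun t ht => ?_
  · simp only [hsy, hc0, hc1] at key
    exact key
  set c' : Euc n × Euc n := (b + s • ((θ + t • a) - θ₀), a) with hc'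
  have hder : HasDerivAt c c' t := by
    have d1 : HasDerivAt (fun t : ℝ => t • b) b t := by simpa using (hasDerivAt_id t).smul_const b
    have d2 : HasDerivAt (fun t : ℝ => t • a) a t := by simpa using (hasDerivAt_id t).smul_const a
    have d3 : HasDerivAt (fun t : ℝ => s • (t • (θ - θ₀))) (s • (θ - θ₀)) t := by
      refine HasDerivAt.congr_deriv (((hasDerivAt_id t).smul_const (θ - θ₀)).const_smul s) ?_
      simp
    have d4 : HasDerivAt (fun t : ℝ => (t ^ 2 * (s / 2)) • a) ((t * s) • a) t := by
      refine HasDerivAt.congr_deriv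
        ((((hasDerivAt_id t).pow 2).mul_const (s / 2)).smul_const a) ?_
      congr 1
      simp
      ring
    have d5 := (((d1.const_add I).add d3).add d4).prodMk (d2.const_add θ)
    refine HasDerivAt.congr_deriv (f := c) d5 ?_
    refine Prod.ext ?_ rfl
    simp only [hc']
    module
  refine ⟨hBt (mem_image_of_mem _ (hcmem t ht).2), prodEquiv n c',
    (prodEquiv n).hasFDerivAt.comp_hasDerivAt t hder, fun w => ?_⟩
  obtain ⟨v, rfl⟩ := (prodEquiv n).surjective w
  rw [A.localForm_chart hsymm (hcmem t ht).2.1]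
  have g1 : HasDerivAt (fun τ : ℝ => h (prodEquiv n (c t) + τ • prodEquiv n v) (b, a, s))
      (fderiv ℝ h (prodEquiv n (c t)) (prodEquiv n v) (b, a, s)) 0 := by
    have g2 := ((hhs.differentiable (by simp)) (prodEquiv n (c t))).hasFDerivAt.hasLineDerivAt
      (prodEquiv n v)
    exact ((ContinuousLinearMap.apply ℝ ℝ ((b, a, s) : Euc n × Euc n × ℝ)).hasFDerivAt
      ).comp_hasDerivAt (0 : ℝ) g2
  have g3 : (fun τ : ℝ => h (prodEquiv n (c t) + τ • prodEquiv n v) (b, a, s)) =ᶠ[𝓝 0]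
      fun τ : ℝ => twistHamiltonian θ₀ (c t + τ • v) (b, a, s) := by
    have g4 : ∀ᶠ τ : ℝ in 𝓝 0, prodEquiv n (c t + τ • v) ∈ O := by
      have : ContinuousAt (fun τ : ℝ => prodEquiv n (c t + τ • v)) 0 := by fun_prop
      refine this (hO.mem_nhds ?_)
      simpa using (hcmem t ht).1
    filter_upwards [g4] with τ hτ
    rw [← map_smul, ← map_add]
    simp only [hh]
    rw [show χ (prodEquiv n (c t + τ • v)) = 1 from hOχ hτ, one_smul,
      (prodEquiv n).symm_apply_apply]
  exact (hasDerivAt_twistHamiltonian θ₀ (c t) v b a s).unique (g1.congr_of_eventuallyEq g3.symm)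

end ActionAngle
end SymplecticIFS
end

/-! ### The set of bad positions and twists is thin -/

noncomputable section
namespace SymplecticIFS

lemma exists_iterate_derivative_eval_ne_zero {p : Polynomial ℝ} (hp : p ≠ 0) (s : ℝ) :
    ∃ m : ℕ, (Polynomial.derivative^[m] p).eval s ≠ 0 := by
  by_contra! hcon
  refine hp (Polynomial.eq_zero_of_hasseDeriv_eq_zero p s fun m => ?_)
  have h1 := hcon m
  rw [← Polynomial.factorial_smul_hasseDeriv, LinearMap.smul_apply, Polynomial.eval_smul] at h1
  rcases smul_eq_zero.1 h1 with h | h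
  · exact absurd h m.factorial_ne_zero
  · exact h

/-- Iterated partial derivatives with respect to a last real variable. -/
def sndDeriv {E : Type} [NormedAddCommGroup E] [NormedSpace ℝ E] (g : E × ℝ → ℝ) : ℕ → E × ℝ → ℝ
  | 0 => g
  | m + 1 => fun z => fderiv ℝ (sndDeriv g m) z (0, 1)

/-- Every zero in the last variable has finite multiplicity. If the first nonvanishing derivative
has order `m + 1`, the zero lies on a level set of the `m`-th derivative which is regular there.
Sorting zeros by `m` gives countably many pieces. -/
lemma isThin_polynomial_zeros {E : Type} [NormedAddCommGroup E] [NormedSpace ℝ E]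
    [FiniteDimensional ℝ E] {G : Set E} {g : E × ℝ → ℝ}
    (hg : ∀ z : E × ℝ, z.1 ∈ G → ContDiffAt ℝ ∞ g z) (p : E → Polynomial ℝ)
    (hp : ∀ y ∈ G, ∀ s, g (y, s) = (p y).eval s) (h0 : ∀ y ∈ G, p y ≠ 0) :
    IsThin {z : E × ℝ | z.1 ∈ G ∧ g z = 0} := by
  have hsm : ∀ m, ∀ z : E × ℝ, z.1 ∈ G → ContDiffAt ℝ ∞ (sndDeriv g m) z := by
    intro m
    induction m with
    | zero => exact hg
    | succ m ih => exact fun z hz => ((ih z hz).fderiv_right (by simp)).clm_apply contDiffAt_const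
  have hval : ∀ m, ∀ y ∈ G, ∀ s, sndDeriv g m (y, s) = (Polynomial.derivative^[m] (p y)).eval s := by
    intro m
    induction m with
    | zero => exact hp
    | succ m ih =>
      intro y hy s
      have h1 : HasDerivAt (fun t : ℝ => ((y, t) : E × ℝ)) (0, 1) s :=
        (hasDerivAt_const s y).prodMk (hasDerivAt_id s)
      have h2 := (((hsm m (y, s) hy).differentiableAt (by simp)).hasFDerivAt).comp_hasDerivAt s h1
      have h3 : sndDeriv g m ∘ (fun t : ℝ => ((y, t) : E × ℝ)) =
          fun t => (Polynomial.derivative^[m] (p y)).eval t := funext fun t => ih y hy t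
      rw [h3] at h2
      rw [Function.iterate_succ_apply']
      exact h2.unique (Polynomial.hasDerivAt _ s)
  refine (IsThin.iUnion (S := fun m : ℕ => {z : E × ℝ | z.1 ∈ G ∧ sndDeriv g m z = 0 ∧
    sndDeriv g (m + 1) z ≠ 0}) fun m => ?_).mono ?_
  · refine isThin_of_forall fun z hz => ⟨sndDeriv g m, univ, univ_mem,
      (hsm m z hz.1).of_le (by simp), fun h => hz.2.2 ?_, fun w hw => hw.1.2.1⟩
    change fderiv ℝ (sndDeriv g m) z (0, 1) = 0
    rw [h]
    rfl
  · classical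
    rintro ⟨y, s⟩ ⟨hy, hz⟩
    have hex := exists_iterate_derivative_eval_ne_zero (h0 y hy) s
    obtain ⟨m, hm⟩ : ∃ m, Nat.find hex = m + 1 := Nat.exists_eq_succ_of_ne_zero fun h => by
      have := Nat.find_spec hex
      rw [h, ← hval 0 y hy s] at this
      exact this hz
    refine mem_iUnion.2 ⟨m, hy, ?_, ?_⟩
    · rw [hval m y hy]
      by_contra hne
      have := Nat.find_min' hex hne
      omega
    · rw [hval (m + 1) y hy, ← hm]
      exact Nat.find_spec hex

section TwistMatrix

variable {n : ℕ}

/-- The matrix of `w ↦ D (s w, w)`. -/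
def twistMatrix (D : Euc n × Euc n →L[ℝ] Euc n) (s : ℝ) : Matrix (Fin n) (Fin n) ℝ :=
  fun j k => s * D (EuclideanSpace.single k 1, 0) j + D (0, EuclideanSpace.single k 1) j

lemma twistMatrix_mulVec (D : Euc n × Euc n →L[ℝ] Euc n) (s : ℝ) (w : Euc n) :
    (twistMatrix D s).mulVec w = D (s • w, w) := by
  have h1 : w = ∑ k, w k • EuclideanSpace.single k (1 : ℝ) := by
    ext j
    simp [Finset.sum_apply, Pi.single_apply]
  have h2 : (s • w, w) = ∑ k, w k • (s • ((EuclideanSpace.single k (1 : ℝ), 0) : Euc n × Euc n) +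
      (0, EuclideanSpace.single k (1 : ℝ))) := by
    refine Prod.ext ?_ ?_
    · rw [Prod.fst_sum]
      conv_lhs => rw [h1]
      simp only [Finset.smul_sum, Prod.smul_fst, Prod.fst_add, add_zero]
      exact Finset.sum_congr rfl fun k _ => smul_comm _ _ _
    · rw [Prod.snd_sum]
      conv_lhs => rw [h1]
      simp
  ext j
  rw [h2, map_sum]
  simp only [Matrix.mulVec, dotProduct, twistMatrix, map_smul, map_add, WithLp.ofLp_sum,
    Finset.sum_apply, PiLp.smul_apply, PiLp.add_apply, smul_eq_mul]
  exact Finset.sum_congr rfl fun k _ => mul_comm _ _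

/-- The determinant of the twist matrix as a polynomial. -/
def twistPolynomial (D : Euc n × Euc n →L[ℝ] Euc n) : Polynomial ℝ :=
  Matrix.det (Matrix.of fun j k : Fin n =>
    Polynomial.X * Polynomial.C (D (EuclideanSpace.single k 1, 0) j) +
      Polynomial.C (D (0, EuclideanSpace.single k 1) j))

lemma twistPolynomial_eval (D : Euc n × Euc n →L[ℝ] Euc n) (s : ℝ) :
    (twistPolynomial D).eval s = (twistMatrix D s).det := by
  rw [twistPolynomial, ← Polynomial.coe_evalRingHom, RingHom.map_det]
  congr 1
  ext j k
  simp [twistMatrix]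
  exact mul_comm _ _

lemma twistMatrix_injective {D : Euc n × Euc n →L[ℝ] Euc n} {s : ℝ}
    (h : (twistMatrix D s).det ≠ 0) {w : Euc n} (hw : D (s • w, w) = 0) : w = 0 := by
  have h1 : (twistMatrix D s).mulVec w = 0 := by
    rw [twistMatrix_mulVec, hw]
    rfl
  by_contra hne
  refine h (Matrix.exists_mulVec_eq_zero_iff.1 ⟨w, fun h0 => hne ?_, h1⟩)
  ext j
  exact congrFun h0 j

/-- If the determinant vanished identically, every real `s` would give a nonzero `w s` with `(s • w
s, w s)` in the kernel of `D`. Isotropy of the kernel reads `(s - t) * ⟪w s, w t⟫ = 0`, so these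
vectors would form an infinite orthogonal family in a finite-dimensional space. -/
lemma twistPolynomial_ne_zero {D : Euc n × Euc n →L[ℝ] Euc n}
    (hD : ∀ u v, D u = 0 → D v = 0 → stdForm u v = 0) : twistPolynomial D ≠ 0 := by
  intro h0
  have h1 : ∀ s : ℝ, ∃ w : Euc n, w ≠ 0 ∧ D (s • w, w) = 0 := by
    intro s
    have h2 : (twistMatrix D s).det = 0 := by rw [← twistPolynomial_eval, h0, Polynomial.eval_zero]
    obtain ⟨w, hw, hw'⟩ := Matrix.exists_mulVec_eq_zero_iff.2 h2
    refine ⟨WithLp.toLp 2 w, fun h => hw (by simpa using congrArg WithLp.ofLp h), ?_⟩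
    have h3 := twistMatrix_mulVec D s (WithLp.toLp 2 w)
    ext j
    rw [← h3]
    exact congrFun hw' j
  choose w hw hwD using h1
  have h2 : LinearIndependent ℝ w := by
    refine linearIndependent_of_ne_zero_of_inner_eq_zero hw fun s t hst => ?_
    have h3 := hD _ _ (hwD s) (hwD t)
    have h4 : stdForm (s • w s, w s) (t • w t, w t) = (s - t) * inner ℝ (w s) (w t) := by
      simp only [stdForm, PiLp.inner_apply, RCLike.inner_apply, conj_trivial, Finset.mul_sum,
        PiLp.smul_apply, smul_eq_mul]
      exact Finset.sum_congr rfl fun j _ => by ring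
    rw [h4] at h3
    exact (mul_eq_zero.1 h3).resolve_left (sub_ne_zero.2 hst)
  have : Finite ℝ := h2.finite_of_isNoetherian
  exact not_finite ℝ

end TwistMatrix

section Bad

set_option linter.unusedSectionVars false

variable {n : ℕ} {N : Type*} [TopologicalSpace N] [ChartedSpace (Euc (2 * n)) N]
  {Ω : SymplecticForm n N} [IsManifold (𝓡 (2 * n)) ∞ N] (B C : ActionAngle Ω)
  {ψ : N ≃ₘ^∞⟮𝓡 (2 * n), 𝓡 (2 * n)⟯ N}

lemma ActionAngle.contDiffAt_act_comp_param (ψ : N ≃ₘ^∞⟮𝓡 (2 * n), 𝓡 (2 * n)⟯ N)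
    {y : Euc n × Euc n} (hy : y.1 ∈ B.D)
    (hyC : ψ (B.param y) ∈ C.carrier) : ContDiffAt ℝ ∞ (C.act ∘ ψ ∘ B.param) y :=
  ((C.contMDiffAt_act hyC).comp y ((ψ.contMDiff _).comp y (B.contMDiffAt_param hy y.2))).contDiffAt

/-- Vectors killed by the derivative of the actions are tangent to the angle tori, on which the
symplectic form vanishes; `ψ` and both parametrizations are symplectic. -/
lemma ActionAngle.isotropic_ker (hψ : IsSymplectic Ω ψ) {y : Euc n × Euc n} (hy : y.1 ∈ B.D)
    (hyC : ψ (B.param y) ∈ C.carrier) {u v : Euc n × Euc n}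
    (hu : fderiv ℝ (C.act ∘ ψ ∘ B.param) y u = 0) (hv : fderiv ℝ (C.act ∘ ψ ∘ B.param) y v = 0) :
    stdForm u v = 0 := by
  obtain ⟨D1, h1⟩ : ∃ D1 : Euc (2 * n) →L[ℝ] Euc n,
      HasMFDerivAt (𝓡 (2 * n)) 𝓘(ℝ, Euc n) C.act (ψ (B.param y)) D1 :=
    ⟨_, ((C.contMDiffAt_act hyC).mdifferentiableAt (by simp)).hasMFDerivAt⟩
  have h2 : HasMFDerivAt (𝓡 (2 * n)) (𝓡 (2 * n)) ψ (B.param y) (tmap ψ (B.param y)) :=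
    (contMDiff_mdifferentiable ψ.contMDiff _).hasMFDerivAt
  have h3 : HasMFDerivAt 𝓘(ℝ, Euc n × Euc n) (𝓡 (2 * n)) B.param y (B.dparam y) :=
    ((B.contMDiffAt_param hy y.2).mdifferentiableAt (by simp)).hasMFDerivAt
  have h4 : fderiv ℝ (C.act ∘ ψ ∘ B.param) y =
      D1.comp ((tmap ψ (B.param y)).comp (B.dparam y)) := by
    rw [← mfderiv_eq_fderiv]
    exact (h1.comp y (h2.comp y h3)).mfderiv
  obtain ⟨J, hJ, τ, hx⟩ := C.exists_param hyC
  rw [← hx] at h1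
  have h5 : HasMFDerivAt 𝓘(ℝ, Euc n × Euc n) (𝓡 (2 * n)) C.param (J, τ) (C.dparam (J, τ)) :=
    ((C.contMDiffAt_param hJ τ).mdifferentiableAt (by simp)).hasMFDerivAt
  have h6 : D1.comp (C.dparam (J, τ)) = ContinuousLinearMap.fst ℝ (Euc n) (Euc n) := by
    have h7 : HasFDerivAt (C.act ∘ C.param) (D1.comp (C.dparam (J, τ))) (J, τ) :=
      (h1.comp (J, τ) h5).hasFDerivAt
    have h8 : HasFDerivAt (C.act ∘ C.param) (ContinuousLinearMap.fst ℝ (Euc n) (Euc n)) (J, τ) := by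
      refine hasFDerivAt_fst.congr_of_eventuallyEq ?_
      filter_upwards [(C.isOpen_D.prod isOpen_univ).mem_nhds
        (show (J, τ) ∈ C.D ×ˢ univ from ⟨hJ, mem_univ _⟩)] with z hz
      exact C.act_param hz.1 z.2
    exact h7.unique h8
  have h9 : ∀ u, fderiv ℝ (C.act ∘ ψ ∘ B.param) y u = 0 →
      ∃ u' : Euc n × Euc n, u'.1 = 0 ∧ C.dparam (J, τ) u' = tmap ψ (B.param y) (B.dparam y u) := by
    intro u hu
    obtain ⟨u', hu'⟩ := C.dparam_surjective hJ τ (tmap ψ (B.param y) (B.dparam y u))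
    refine ⟨u', ?_, hu'⟩
    rw [h4] at hu
    have h10 := congrArg (fun f : Euc n × Euc n →L[ℝ] Euc n => f u') h6
    simp only [ContinuousLinearMap.comp_apply, ContinuousLinearMap.coe_fst'] at h10 hu
    rw [← h10, hu', hu]
  obtain ⟨u', hu0, hu'⟩ := h9 u hu
  obtain ⟨v', hv0, hv'⟩ := h9 v hv
  have h11 := C.at_dparam hJ τ u' v'
  rw [hu', hv', hx, (isSymplectic_iff Ω).1 hψ] at h11
  have h12 := B.at_dparam hy y.2 u v
  rw [Prod.mk.eta] at h12
  rw [h12] at h11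
  rw [h11]
  simp [stdForm, hu0, hv0]

variable {ι : Type} (A : ι → ActionAngle Ω)

/-- The positions and twists for which the image under `ψ` of an angle torus does not locally
project diffeomorphically to the actions. -/
def badSet (ψ : N → N) : Set ((Euc n × Euc n) × ℝ) :=
  {z | z.1.1 ∈ B.D ∧ ∀ j, ψ (B.param z.1) ∈ (A j).carrier →
    (twistMatrix (fderiv ℝ ((A j).act ∘ ψ ∘ B.param) z.1) z.2).det = 0}

/-- A bad position either maps outside all the domains, hence into a hypersurface pulled back by a
submersion, or maps into a domain where the twist determinant, a nonzero polynomial in `s`,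
vanishes. -/
lemma isThin_badSet [Countable ι] (hψ : IsSymplectic Ω ψ) {L : ℕ → Set N}
    (hL : ∀ k, IsHypersurface (m := 2 * n) (L k)) (hcov : (⋃ i, (A i).carrier)ᶜ ⊆ ⋃ k, L k) :
    IsThin (badSet B A ψ) := by
  have h1 : ∀ k, IsThin {z : (Euc n × Euc n) × ℝ | z ∈ {z : (Euc n × Euc n) × ℝ | z.1.1 ∈ B.D} ∧
      (ψ ∘ B.param ∘ Prod.fst) z ∈ L k} := by
    intro k
    refine (hL k).isThin_preimage (fun z hz => ?_) fun z hz => ?_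
    · exact ((ψ.contMDiff _).comp z ((B.contMDiffAt_param hz z.1.2).comp z
        contDiff_fst.contMDiff.contMDiffAt)).of_le (by simp)
    · have h2 : HasMFDerivAt (𝓡 (2 * n)) (𝓡 (2 * n)) ψ (B.param z.1) (tmap ψ (B.param z.1)) :=
        (contMDiff_mdifferentiable ψ.contMDiff _).hasMFDerivAt
      have h3 : HasMFDerivAt 𝓘(ℝ, Euc n × Euc n) (𝓡 (2 * n)) B.param z.1 (B.dparam z.1) :=
        ((B.contMDiffAt_param hz z.1.2).mdifferentiableAt (by simp)).hasMFDerivAt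
      have h4 : HasMFDerivAt 𝓘(ℝ, (Euc n × Euc n) × ℝ) 𝓘(ℝ, Euc n × Euc n) Prod.fst z
          (ContinuousLinearMap.fst ℝ (Euc n × Euc n) ℝ) := hasFDerivAt_fst.hasMFDerivAt
      have h5 : mfderiv 𝓘(ℝ, (Euc n × Euc n) × ℝ) (𝓡 (2 * n)) (ψ ∘ B.param ∘ Prod.fst) z =
          (tmap ψ (B.param z.1)).comp ((B.dparam z.1).comp
            (ContinuousLinearMap.fst ℝ (Euc n × Euc n) ℝ)) := (h2.comp z (h3.comp z h4)).mfderiv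
      rw [h5]
      have h6 : Function.Surjective (tmap ψ (B.param z.1)) := fun w => by
        have := tmap_diffeo_symm ψ (ψ (B.param z.1)) w
        rw [ψ.symm_apply_apply] at this
        exact ⟨_, this⟩
      exact h6.comp ((B.dparam_surjective hz z.1.2).comp Prod.fst_surjective)
  have h2 : ∀ j, IsThin {z : (Euc n × Euc n) × ℝ |
      z.1 ∈ {y : Euc n × Euc n | y.1 ∈ B.D ∧ ψ (B.param y) ∈ (A j).carrier} ∧
      (fun z : (Euc n × Euc n) × ℝ =>
        (twistMatrix (fderiv ℝ ((A j).act ∘ ψ ∘ B.param) z.1) z.2).det) z = 0} := by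
    intro j
    refine isThin_polynomial_zeros (fun z hz => ?_)
      (fun y => twistPolynomial (fderiv ℝ ((A j).act ∘ ψ ∘ B.param) y))
      (fun y hy s => (twistPolynomial_eval _ s).symm)
      (fun y hy => twistPolynomial_ne_zero fun u v hu hv =>
        B.isotropic_ker (A j) hψ hy.1 hy.2 hu hv)
    · have h3 : ∀ u : Euc n × Euc n, ∀ l, ContDiffAt ℝ ∞ (fun z : (Euc n × Euc n) × ℝ =>
          (fderiv ℝ ((A j).act ∘ ψ ∘ B.param) z.1 u) l) z := fun u l => by
        have h4 : ContDiffAt ℝ ∞ (fderiv ℝ ((A j).act ∘ ψ ∘ B.param)) z.1 :=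
          (B.contDiffAt_act_comp_param (A j) ψ hz.1 hz.2).fderiv_right (by simp)
        have h5 : ContDiffAt ℝ ∞ (fun z : (Euc n × Euc n) × ℝ =>
            fderiv ℝ ((A j).act ∘ ψ ∘ B.param) z.1 u) z :=
          (h4.comp z contDiffAt_fst).clm_apply contDiffAt_const
        exact (EuclideanSpace.proj (𝕜 := ℝ) l).contDiff.contDiffAt.comp z h5
      simp only [Matrix.det_apply, twistMatrix]
      refine ContDiffAt.sum fun σ _ => ContDiffAt.const_smul _ (contDiffAt_prod fun k _ => ?_)
      exact (contDiffAt_snd.mul (h3 _ _)).add (h3 _ _)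
  refine ((IsThin.iUnion h1).union (IsThin.iUnion h2)).mono fun z hz => ?_
  by_cases h : ∃ j, ψ (B.param z.1) ∈ (A j).carrier
  · obtain ⟨j, hj⟩ := h
    exact Or.inr (mem_iUnion.2 ⟨j, ⟨hz.1, hj⟩, hz.2 j hj⟩)
  · obtain ⟨k, hk⟩ := mem_iUnion.1 (hcov (show ψ (B.param z.1) ∈ (⋃ i, (A i).carrier)ᶜ by
      simpa using h))
    exact Or.inl (mem_iUnion.2 ⟨k, hz.1, hk⟩)

end Bad
end SymplecticIFS
end

/-! ### Making all tori good -/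

noncomputable section
namespace SymplecticIFS

section Twist

set_option linter.unusedSectionVars false

variable {n : ℕ} {N : Type*} [TopologicalSpace N] [ChartedSpace (Euc (2 * n)) N]
  {Ω : SymplecticForm n N} [IsManifold (𝓡 (2 * n)) ∞ N] {ι : Type} (A : ι → ActionAngle Ω)

/-- The torus of action `J` is mapped by `f` to a set whose actions contain an open set. -/
def IsGood (f : N → N) (i : ι) (J : Euc n) : Prop :=
  ∃ j, ∃ V : Set (Euc n), IsOpen V ∧ V.Nonempty ∧ V ⊆ (A j).D ∧
    ∀ I ∈ V, ∃ θ τ, f ((A i).param (J, θ)) = (A j).param (I, τ)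

/-- Along the torus, the map from angles to actions of the image has derivative `w ↦ D (s • w, w)`
at `θ₀`. Outside the bad set this is invertible for some domain, so the inverse function theorem
gives an open set of actions. -/
lemma isGood_of_notMem_badSet (ψ : N ≃ₘ^∞⟮𝓡 (2 * n), 𝓡 (2 * n)⟯ N) {c : N → N} {i : ι}
    {J θ₀ b a : Euc n} {s δ : ℝ} (hδ : 0 < δ)
    (hc : ∀ θ ∈ Metric.ball θ₀ δ, c ((A i).param (J, θ)) =
      (A i).param (J + b + s • (θ - θ₀) + (s / 2) • a, θ + a))
    (hD : J + b + (s / 2) • a ∈ (A i).D)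
    (hbad : ((J + b + (s / 2) • a, θ₀ + a), s) ∉ badSet (A i) A ψ) : IsGood A (ψ ∘ c) i J := by
  obtain ⟨j, hj, hdet⟩ : ∃ j, ψ ((A i).param (J + b + (s / 2) • a, θ₀ + a)) ∈ (A j).carrier ∧
      (twistMatrix (fderiv ℝ ((A j).act ∘ ψ ∘ (A i).param) (J + b + (s / 2) • a, θ₀ + a)) s).det
        ≠ 0 := by
    by_contra! hcon
    exact hbad ⟨hD, hcon⟩
  set y : Euc n × Euc n := (J + b + (s / 2) • a, θ₀ + a) with hy
  set f := (A j).act ∘ ψ ∘ (A i).param with hf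
  set κ : Euc n → Euc n × Euc n := fun θ => (J + b + s • (θ - θ₀) + (s / 2) • a, θ + a) with hκ
  have hκ0 : κ θ₀ = y := by simp [hκ, hy]
  have hfd : HasStrictFDerivAt f (fderiv ℝ f y) (κ θ₀) := by
    rw [hκ0]
    exact ((A i).contDiffAt_act_comp_param (A j) ψ hD hj).hasStrictFDerivAt (by simp)
  have hκd : HasStrictFDerivAt κ ((s • ContinuousLinearMap.id ℝ (Euc n)).prod
      (ContinuousLinearMap.id ℝ (Euc n))) θ₀ :=
    (((((hasStrictFDerivAt_id θ₀).sub_const θ₀).const_smul s).const_add (J + b)).add_const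
      ((s / 2) • a)).prodMk ((hasStrictFDerivAt_id θ₀).add_const a)
  set D' : Euc n →L[ℝ] Euc n := (fderiv ℝ f y).comp ((s • ContinuousLinearMap.id ℝ (Euc n)).prod
      (ContinuousLinearMap.id ℝ (Euc n))) with hD'
  have hinj : Function.Injective D' := by
    rw [injective_iff_map_eq_zero]
    intro w hw
    exact twistMatrix_injective hdet hw
  let T : Euc n ≃L[ℝ] Euc n :=
    (LinearEquiv.ofInjectiveEndo (D' : Euc n →ₗ[ℝ] Euc n) hinj).toContinuousLinearEquiv
  have hT : HasStrictFDerivAt (f ∘ κ) (T : Euc n →L[ℝ] Euc n) θ₀ := hfd.comp θ₀ hκd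
  have hmap := hT.map_nhds_eq_of_equiv
  have hκc : ContinuousAt (fun θ => ψ ((A i).param (κ θ))) θ₀ := by
    refine ψ.continuous.continuousAt.comp (ContinuousAt.comp (g := (A i).param) ?_
      hκd.hasFDerivAt.continuousAt)
    rw [hκ0]
    exact ((A i).contMDiffAt_param hD _).continuousAt
  have hκj : ∀ᶠ θ in 𝓝 θ₀, ψ ((A i).param (κ θ)) ∈ (A j).carrier := by
    refine hκc ((A j).isOpen_carrier.mem_nhds ?_)
    change ψ ((A i).param (κ θ₀)) ∈ _
    rw [hκ0]
    exact hj
  have hfy : (f ∘ κ) θ₀ ∈ (A j).D := by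
    rw [Function.comp_apply, hκ0]
    exact ((A j).act_mem hj).1
  have h1 : (f ∘ κ) '' (Metric.ball θ₀ δ ∩ {θ | ψ ((A i).param (κ θ)) ∈ (A j).carrier}) ∈
      𝓝 ((f ∘ κ) θ₀) := by
    rw [← hmap]
    exact image_mem_map (inter_mem (Metric.ball_mem_nhds _ hδ) hκj)
  obtain ⟨V, hV, hVo, hV0⟩ := mem_nhds_iff.1 (inter_mem h1 ((A j).isOpen_D.mem_nhds hfy))
  refine ⟨j, V, hVo, ⟨_, hV0⟩, fun I hI => (hV hI).2, fun I hI => ?_⟩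
  obtain ⟨θ', ⟨hθδ, hθj⟩, rfl⟩ := (hV hI).1
  obtain ⟨-, τ, hτ⟩ := (A j).act_mem hθj
  refine ⟨θ', τ, ?_⟩
  rw [Function.comp_apply, hc θ' hθδ]
  exact hτ.symm

/-- Centres of a sequence of disjoint balls in the unit cube. -/
def slotCenter (hn : 0 < n) (k : ℕ) : Euc n := EuclideanSpace.single ⟨0, hn⟩ ((1 / 2 : ℝ) ^ k / 4)

/-- Between slots `k < k'` the first angle coordinate drops by an amount strictly between `0` and
`1`, so no integer translation can identify two points. -/
lemma disjoint_slot (B : ActionAngle Ω) (hn : 0 < n) {k k' : ℕ} (h : k ≠ k') :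
    Disjoint (B.param '' (B.D ×ˢ Metric.ball (slotCenter hn k) ((1 / 2 : ℝ) ^ k / 16)))
      (B.param '' (B.D ×ˢ Metric.ball (slotCenter hn k') ((1 / 2 : ℝ) ^ k' / 16))) := by
  wlog hlt : k < k' generalizing k k' with H
  · exact (H h.symm (lt_of_le_of_ne (not_lt.1 hlt) h.symm)).symm
  rw [disjoint_left]
  rintro _ ⟨⟨I, θ⟩, ⟨hI, hθ⟩, rfl⟩ ⟨⟨I', θ'⟩, ⟨hI', hθ'⟩, heq⟩
  obtain ⟨-, hk⟩ := (B.param_eq_iff I hI I' hI' θ θ').1 heq.symm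
  obtain ⟨m, hm⟩ := hk ⟨0, hn⟩
  have h1 : ∀ (l : ℕ) (τ : Euc n), τ ∈ Metric.ball (slotCenter hn l) ((1 / 2 : ℝ) ^ l / 16) →
      |τ ⟨0, hn⟩ - (1 / 2 : ℝ) ^ l / 4| < (1 / 2 : ℝ) ^ l / 16 := by
    intro l τ hτ
    rw [Metric.mem_ball, dist_eq_norm] at hτ
    have h2 : ‖(τ - slotCenter hn l) ⟨0, hn⟩‖ ≤ ‖τ - slotCenter hn l‖ := PiLp.norm_apply_le _ _
    have h3 : (τ - slotCenter hn l) ⟨0, hn⟩ = τ ⟨0, hn⟩ - (1 / 2 : ℝ) ^ l / 4 := by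
      simp [slotCenter]
    rw [h3] at h2
    exact h2.trans_lt hτ
  have h4 := abs_lt.1 (h1 k θ hθ)
  have h5 := abs_lt.1 (h1 k' θ' hθ')
  have h6 : (1 / 2 : ℝ) ^ k' ≤ (1 / 2 : ℝ) ^ k / 2 := by
    calc (1 / 2 : ℝ) ^ k' ≤ (1 / 2 : ℝ) ^ (k + 1) :=
          pow_le_pow_of_le_one (by norm_num) (by norm_num) hlt
      _ = _ := by rw [pow_succ]; ring
  have h7 : (0 : ℝ) < (1 / 2 : ℝ) ^ k' := by positivity
  have h8 : (1 / 2 : ℝ) ^ k ≤ 1 := pow_le_one₀ (by norm_num) (by norm_num)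
  have h9 : (m : ℝ) < 0 := by rw [← hm]; linarith [h4.1, h5.2]
  have h10 : (-1 : ℝ) < m := by rw [← hm]; linarith [h4.2, h5.1]
  have h11 : m < 0 := by exact_mod_cast h9
  have h12 : -1 < m := by exact_mod_cast h10
  omega

lemma glue_eq_of_forall_ne {P : Type} [NormedAddCommGroup P] [NormedSpace ℝ P] {κ : Type*}
    {F : κ → SympFamily Ω P} (hF : Separated F) {p : κ → P}
    (hp : ∀ k, p k ∈ Metric.ball (0 : P) (F k).ε) {k : κ} {x : N}
    (hx : ∀ k', k' ≠ k → x ∉ (F k').S) : glue F p x = (F k).F (p k) x := by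
  by_cases h : x ∈ (F k).S
  · exact glue_of_mem hF h
  · rw [(F k).fix _ (hp k) x h]
    refine glue_of_notMem fun k' => ?_
    rcases eq_or_ne k' k with rfl | hne
    · exact h
    · exact hx k' hne

lemma glue_mem_carrier {P : Type} [NormedAddCommGroup P] [NormedSpace ℝ P] {κ : Type*}
    {F : κ → SympFamily Ω P} (hF : Separated F) {p : κ → P}
    (hp : ∀ k, p k ∈ Metric.ball (0 : P) (F k).ε) {U : Set N}
    (hU : ∀ k, ∀ q ∈ Metric.ball (0 : P) (F k).ε, ∀ x ∈ U, (F k).F q x ∈ U) {x : N} (hx : x ∈ U) :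
    glue F p x ∈ U := by
  by_cases h : ∃ k, x ∈ (F k).S
  · obtain ⟨k, hk⟩ := h
    rw [glue_of_mem hF hk]
    exact hU k _ (hp k) x hx
  · rw [glue_of_notMem (by simpa using h)]
    exact hx

/-- Every symplectic diffeomorphism can be composed with a small one, preserving the domains of
the action-angle coordinates, so that all the tori become good. -/
theorem exists_twist [T2Space N] [SecondCountableTopology N] [Countable ι] (hn : 0 < n)
    (hdisj : ∀ i j, i ≠ j → Disjoint (A i).carrier (A j).carrier) {L : ℕ → Set N}
    (hL : ∀ k, IsHypersurface (m := 2 * n) (L k)) (hcov : (⋃ i, (A i).carrier)ᶜ ⊆ ⋃ k, L k)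
    (g : Bundle.ContinuousRiemannianMetric (Euc (2 * n))
      (fun x : N => TangentSpace (𝓡 (2 * n)) x)) {r : ℕ∞}
    (W : StrongNhdData (2 * n) N r) (hW : W.IsAt id)
    (ψ : N ≃ₘ^∞⟮𝓡 (2 * n), 𝓡 (2 * n)⟯ N) (hψ : IsSymplectic Ω ψ) :
    ∃ c : N ≃ₘ^∞⟮𝓡 (2 * n), 𝓡 (2 * n)⟯ N, IsNearId Ω g W c ∧ IsNearId Ω g W c.symm ∧
      (∀ x, (∀ i, x ∉ (A i).carrier) → c x = x) ∧
      (∀ i x, c x ∈ (A i).carrier ↔ x ∈ (A i).carrier) ∧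
      ∀ i, ∀ J ∈ (A i).D, IsGood A (ψ ∘ c) i J := by
  -- The explicit twist formula is available only over compact sets of actions, so each `D` is
  -- exhausted by countably many of them.
  have hR : ∀ i, ∃ R : ℕ → Set (Euc n), (∀ a, IsCompact (R a) ∧ R a ⊆ (A i).D) ∧
      ∀ J ∈ (A i).D, ∃ a, J ∈ R a := by
    intro i
    obtain ⟨F, hF1, hF2, hF3, hF4⟩ := (A i).isOpen_D.exists_iUnion_isClosed
    refine ⟨fun a => F a ∩ Metric.closedBall 0 a, fun a =>
      ⟨(isCompact_closedBall _ _).inter_left (hF1 a), inter_subset_left.trans (hF2 a)⟩,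
      fun J hJ => ?_⟩
    rw [← hF3] at hJ
    obtain ⟨a, ha⟩ := mem_iUnion.1 hJ
    obtain ⟨b, hb⟩ := exists_nat_ge ‖J‖
    refine ⟨max a b, hF4 (le_max_left _ _) ha, ?_⟩
    rw [mem_closedBall_zero_iff]
    exact hb.trans (by exact_mod_cast le_max_right _ _)
  choose R hRc hRJ using hR
  -- Each compact set of actions gets `n + 1` slots of its own. The slots accumulate at angle zero,
  -- so the supports are not locally finite there and the flat gluing is needed.
  set slot : ℕ × Fin (n + 1) → ℕ := ⇑(Nat.divModEquiv (n + 1)).symm with hslot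
  have hrad : ∀ k : ℕ, (0 : ℝ) < (1 / 2 : ℝ) ^ k / 16 ∧ (1 / 2 : ℝ) ^ k / 16 < 1 / 2 := fun k => by
    have : (1 / 2 : ℝ) ^ k ≤ 1 := pow_le_one₀ (by norm_num) (by norm_num)
    exact ⟨by positivity, by linarith⟩
  have hfam := fun κ : ι × ℕ × Fin (n + 1) => (A κ.1).exists_twistFamily (hRc κ.1 κ.2.1).1
    (hRc κ.1 κ.2.1).2 (slotCenter hn (slot κ.2)) (hrad (slot κ.2)).1 (hrad (slot κ.2)).2
  choose F hFS hFpres δ hδ0 hδε hFδ using hfam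
  set U : ι × ℕ × Fin (n + 1) → Set N := fun κ => (A κ.1).param ''
    ((A κ.1).D ×ˢ Metric.ball (slotCenter hn (slot κ.2)) ((1 / 2 : ℝ) ^ slot κ.2 / 16)) with hU
  have hUcar : ∀ κ, U κ ⊆ (A κ.1).carrier := fun κ => by
    rw [← (A κ.1).image_eq]
    exact image_mono (prod_mono_right (subset_univ _))
  have hUdisj : ∀ κ κ', κ ≠ κ' → Disjoint (U κ) (U κ') := by
    rintro ⟨i, l⟩ ⟨i', l'⟩ hne
    rcases eq_or_ne i i' with rfl | hi
    · exact disjoint_slot (A i) hn fun h =>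
        hne (congrArg (Prod.mk i) ((Nat.divModEquiv (n + 1)).symm.injective h))
    · exact (hdisj i i' hi).mono (hUcar _) (hUcar _)
  have hUo : ∀ κ, IsOpen (U κ) := fun κ => (A κ.1).isOpen_image_param
    ((A κ.1).isOpen_D.prod Metric.isOpen_ball) (prod_mono_right (subset_univ _))
  have hsep : Separated F := by
    refine ⟨fun κ κ' h => (hUdisj κ κ' h).mono (hFS κ) (hFS κ'), fun κ x hx =>
      ⟨U κ, (hUo κ).mem_nhds (hFS κ hx), (finite_singleton κ).subset ?_⟩⟩
    rintro κ' ⟨y, hy, hyU⟩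
    by_contra hne
    exact disjoint_left.1 (hUdisj κ' κ hne) (hFS κ' hy) hyU
  obtain ⟨ρ, hρ, hglue⟩ := exists_glue g W hW hsep
  -- Converts a displacement at the centre of the slot and a twist into `(b, a, s)`; the correction
  -- removes the term `(s / 2) • a` of the time-one map. The centre is then displaced by exactly
  -- `q.1`, as the avoidance lemma requires.
  set param : (Euc n × Euc n) × ℝ → Euc n × Euc n × ℝ :=
    fun q => (q.1.1 - (q.2 / 2) • q.1.2, q.1.2, q.2) with hparam
  have hparamc : Continuous param := by
    rw [hparam]
    fun_prop
  -- The actions `J` form an `n`-dimensional family and there are `n + 1` independent slots, so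
  -- arbitrarily small parameters leave at least one slot good for every `J`.
  have hq : ∀ i a, ∃ q : Fin (n + 1) → (Euc n × Euc n) × ℝ,
      (∀ l, ‖param (q l)‖ < min (ρ (i, a, l)) (δ (i, a, l))) ∧
      ∀ J : Euc n, ∃ l, q l + ((J, slotCenter hn (slot (a, l))), 0) ∉ badSet (A i) A ψ := by
    intro i a
    have hdense := dense_avoid_thin (X := Euc n) (isThin_badSet (A i) A hψ hL hcov)
      (M := n + 1) (by simp) (fun l J => ((J, slotCenter hn (slot (a, l))), 0))
      (fun l => (contDiff_id.prodMk contDiff_const).prodMk contDiff_const)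
    have hopen : IsOpen {q : Fin (n + 1) → (Euc n × Euc n) × ℝ |
        ∀ l, ‖param (q l)‖ < min (ρ (i, a, l)) (δ (i, a, l))} := by
      have : {q : Fin (n + 1) → (Euc n × Euc n) × ℝ |
        ∀ l, ‖param (q l)‖ < min (ρ (i, a, l)) (δ (i, a, l))} =
          ⋂ l, {q | ‖param (q l)‖ < min (ρ (i, a, l)) (δ (i, a, l))} := by
        ext q
        simp
      rw [this]
      exact isOpen_iInter_of_finite fun l => isOpen_lt
        ((hparamc.comp (continuous_apply l)).norm) continuous_const
    obtain ⟨q, hq1, hq2⟩ := hdense.inter_open_nonempty _ hopen ⟨0, fun l => by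
      simpa [hparam] using ⟨(hρ (i, a, l)).1, hδ0 (i, a, l)⟩⟩
    refine ⟨q, hq1, fun J => ?_⟩
    by_contra! hcon
    exact hq2 ⟨J, hcon⟩
  choose q hqs hqJ using hq
  set p : ι × ℕ × Fin (n + 1) → Euc n × Euc n × ℝ := fun κ => param (q κ.1 κ.2.1 κ.2.2) with hp
  have hpρ : ∀ κ, ‖p κ‖ < ρ κ := fun κ => (hqs κ.1 κ.2.1 κ.2.2).trans_le (min_le_left _ _)
  have hpδ : ∀ κ, ‖p κ‖ < δ κ := fun κ => (hqs κ.1 κ.2.1 κ.2.2).trans_le (min_le_right _ _)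
  have hpε : ∀ κ, p κ ∈ Metric.ball 0 (F κ).ε := fun κ => by
    rw [mem_ball_zero_iff]
    exact (hpρ κ).trans_le (hρ κ).2
  have hpε' : ∀ κ, (-p) κ ∈ Metric.ball 0 (F κ).ε := fun κ => by simpa using hpε κ
  obtain ⟨c, hc, hc', hnear, hnear'⟩ := hglue p hpρ
  have hpres : ∀ i, ∀ κ, ∀ t ∈ Metric.ball 0 (F κ).ε, ∀ x ∈ (A i).carrier,
      (F κ).F t x ∈ (A i).carrier := by
    intro i κ t ht x hx
    by_cases hxS : x ∈ (F κ).S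
    · have hi : κ.1 = i := by
        by_contra hne
        exact disjoint_left.1 (hdisj _ _ hne) (hUcar κ (hFS κ hxS)) hx
      subst hi
      exact hFpres κ t ht x hx
    · rw [(F κ).fix t ht x hxS]
      exact hx
  refine ⟨c, hnear, hnear', fun x hx => ?_, fun i x => ⟨fun h => ?_, fun h => ?_⟩,
    fun i J hJ => ?_⟩
  · rw [hc]
    exact glue_of_notMem fun κ hκ => hx κ.1 (hUcar κ (hFS κ hκ))
  · have := glue_mem_carrier hsep hpε' (hpres i) h
    rwa [← hc', c.symm_apply_apply] at this
  · rw [hc]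
    exact glue_mem_carrier hsep hpε (hpres i) h
  · obtain ⟨a, ha⟩ := hRJ i J hJ
    obtain ⟨l, hl⟩ := hqJ i a J
    set κ : ι × ℕ × Fin (n + 1) := (i, a, l) with hκ
    have hpκ : p κ = ((p κ).1, (p κ).2.1, (p κ).2.2) := rfl
    have hb : ‖(p κ).1‖ < δ κ := (norm_fst_le _).trans_lt (hpδ κ)
    have ha' : ‖(p κ).2.1‖ < δ κ := (norm_fst_le _).trans_lt ((norm_snd_le _).trans_lt (hpδ κ))
    have hs : |(p κ).2.2| < δ κ := (norm_snd_le _).trans_lt ((norm_snd_le _).trans_lt (hpδ κ))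
    have key := hFδ κ _ _ _ hb ha' hs J ha
    have hz : q i a l + ((J, slotCenter hn (slot (a, l))), 0) =
        ((J + (p κ).1 + ((p κ).2.2 / 2) • (p κ).2.1, slotCenter hn (slot κ.2) + (p κ).2.1),
          (p κ).2.2) := by
      refine Prod.ext (Prod.ext ?_ ?_) ?_ <;> simp only [hp, hparam, hκ, Prod.fst_add, Prod.snd_add]
      · abel
      · abel
      · simp
    rw [hz] at hl
    -- The radius is also bounded by that of the slot, where no other family acts.
    refine isGood_of_notMem_badSet A ψ (δ := min (δ κ) ((1 / 2 : ℝ) ^ slot κ.2 / 16))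
      (lt_min (hδ0 κ) (hrad _).1) (fun θ hθ => ?_) ?_ hl
    · rw [Metric.mem_ball, lt_min_iff] at hθ
      rw [hc, glue_eq_of_forall_ne hsep hpε (k := κ)]
      · exact (key θ hθ.1).2
      · intro κ' hne hx
        exact disjoint_left.1 (hUdisj κ' κ hne) (hFS κ' hx)
          (mem_image_of_mem _ ⟨hJ, hθ.2⟩)
    · simpa using (key _ (Metric.mem_ball_self (hδ0 κ))).1

end Twist
end SymplecticIFS
end

/-! ### Pushing points of intersections of closures into the domains -/

noncomputable section
namespace SymplecticIFS

/-- Balls of half the distance to the nearest other point of the set are disjoint. -/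
lemma exists_disjoint_nhds {X : Type*} [TopologicalSpace X] [TopologicalSpace.MetrizableSpace X]
    {S : Set X} (hS : ∀ p ∈ S, ∃ U ∈ 𝓝 p, (U ∩ S).Finite) :
    ∃ V : X → Set X, (∀ p, IsOpen (V p) ∧ p ∈ V p) ∧
      ∀ p ∈ S, ∀ q ∈ S, p ≠ q → Disjoint (V p) (V q) := by
  let _ := TopologicalSpace.metrizableSpaceMetric X
  have h1 : ∀ p, ∃ r : ℝ, 0 < r ∧ (p ∈ S → Metric.ball p r ∩ S ⊆ {p}) := by
    intro p
    by_cases hp : p ∈ S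
    · obtain ⟨U, hU, hfin⟩ := hS p hp
      have h2 : U \ ((U ∩ S) \ {p}) ∈ 𝓝 p := by
        refine inter_mem hU ((hfin.subset sdiff_subset).isClosed.isOpen_compl.mem_nhds ?_)
        simp
      obtain ⟨r, hr, hrU⟩ := Metric.mem_nhds_iff.1 h2
      refine ⟨r, hr, fun _ q hq => ?_⟩
      by_contra hne
      exact (hrU hq.1).2 ⟨⟨(hrU hq.1).1, hq.2⟩, hne⟩
    · exact ⟨1, one_pos, fun h => absurd h hp⟩
  choose r hr hrS using h1
  refine ⟨fun p => Metric.ball p (r p / 2), fun p => ⟨Metric.isOpen_ball,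
    Metric.mem_ball_self (by linarith [hr p])⟩, fun p hp q hq hne => ?_⟩
  refine Metric.ball_disjoint_ball ?_
  have h3 : r p ≤ dist p q := by
    by_contra! hlt
    exact hne (hrS p hp ⟨by rwa [Metric.mem_ball, dist_comm], hq⟩ : q = p).symm
  have h4 : r q ≤ dist p q := by
    by_contra! hlt
    exact hne (hrS q hq ⟨hlt, hp⟩ : p = q)
  linarith

section Crossing

set_option linter.unusedSectionVars false

variable {n : ℕ} {N : Type*} [TopologicalSpace N] [ChartedSpace (Euc (2 * n)) N]
  {Ω : SymplecticForm n N} [IsManifold (𝓡 (2 * n)) ∞ N]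

lemma SympFamily.continuousAt_param {P : Type} [NormedAddCommGroup P] [NormedSpace ℝ P]
    (F : SympFamily Ω P) (x : N) : ContinuousAt (fun t => F.F t x) 0 :=
  ContinuousAt.comp (g := fun z : P × N => F.F z.1 z.2) (f := fun t => (t, x)) (x := 0)
    (F.continuousAt_uncurry x) (continuousAt_id.prodMk continuousAt_const)

/-- Families of symplectic diffeomorphisms with small support which move a given point in all
directions. -/
lemma exists_translationFamily [T2Space N] {x : N} {V : Set N} (hV : IsOpen V) (hx : x ∈ V) :
    ∃ F : SympFamily Ω (Euc (2 * n)), F.S ⊆ V ∧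
      ∀ O ∈ 𝓝 (0 : Euc (2 * n)), (fun t => F.F t x) '' O ∈ 𝓝 x := by
  set e := chartAt (Euc (2 * n)) x with hedef
  have he : e ∈ IsManifold.maximalAtlas (𝓡 (2 * n)) ∞ N := IsManifold.chart_mem_maximalAtlas x
  have hxe : x ∈ e.source := mem_chart_source _ x
  have hT : IsOpen (e.target ∩ e.symm ⁻¹' V) := e.symm.isOpen_inter_preimage hV
  obtain ⟨R, hR, hRT⟩ := Metric.nhds_basis_closedBall.mem_iff.1 (hT.mem_nhds
    (show e x ∈ e.target ∩ e.symm ⁻¹' V from ⟨e.map_source hxe, by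
      rw [mem_preimage, e.left_inv hxe]; exact hx⟩))
  let χ : ContDiffBump (e x) := ⟨R / 2, R, by positivity, by linarith⟩
  -- Near the centre the Hamiltonian with parameter `t` is `⟪y, t⟫`. Its differential determines
  -- `t`, so by nondegeneracy the initial velocities fill all directions.
  set h : Euc (2 * n) → Euc (2 * n) →L[ℝ] ℝ := fun y => χ y • innerSL ℝ y with hh
  have hhs : ContDiff ℝ ∞ h := χ.contDiff.smul (innerSL ℝ).contDiff
  have hts : tsupport h ⊆ Metric.closedBall (e x) R :=
    (tsupport_smul_subset_left χ _).trans χ.tsupport_eq.subset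
  have hcs : HasCompactSupport h :=
    (isCompact_closedBall _ _).of_isClosed_subset (isClosed_tsupport h) hts
  obtain ⟨F, hFS, -, -, hFder⟩ := exists_sympFamily (Ω := Ω) he hhs hcs
    (hts.trans (hRT.trans inter_subset_left))
  refine ⟨F, ?_, ?_⟩
  · rw [hFS]
    rintro _ ⟨y, hy, rfl⟩
    exact (hRT (hts hy)).2
  have hfd : ∀ w t, fderiv ℝ h (e x) w t = inner ℝ w t := by
    intro w t
    have h1 : h =ᶠ[𝓝 (e x)] innerSL ℝ := by
      filter_upwards [χ.eventuallyEq_one] with y hy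
      rw [hh]
      simp only
      rw [hy, Pi.one_apply, one_smul]
    rw [h1.fderiv_eq, ContinuousLinearMap.fderiv]
    rfl
  have hGs : ContDiffAt ℝ ∞ (fun t => e (F.F t x)) 0 := by
    have h1 : ContMDiffAt 𝓘(ℝ, Euc (2 * n)) (𝓡 (2 * n)) ∞ (fun t => F.F t x) 0 :=
      ContMDiffAt.comp (g := fun z : Euc (2 * n) × N => F.F z.1 z.2) 0
        (F.contMDiffAt_uncurry (z := (0, x)) (Metric.mem_ball_self F.ε_pos))
        (contMDiffAt_id.prodMk contMDiffAt_const)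
    refine ContMDiffAt.contDiffAt (ContMDiffAt.comp (g := e) 0 ?_ h1)
    rw [F.zero x]
    exact (contMDiffOn_of_mem_maximalAtlas he).contMDiffAt (e.open_source.mem_nhds hxe)
  set D := fderiv ℝ (fun t => e (F.F t x)) 0 with hD
  have hGd : HasFDerivAt (fun t => e (F.F t x)) D 0 :=
    (hGs.differentiableAt (by simp)).hasFDerivAt
  have hinj : Function.Injective D := by
    rw [injective_iff_map_eq_zero]
    intro t ht
    -- The velocity is known only for parameters in the ball of the family; by linearity of `D` a
    -- multiple of `t` serves as well.
    obtain ⟨c, hc0, hc⟩ : ∃ c : ℝ, c ≠ 0 ∧ c • t ∈ Metric.ball (0 : Euc (2 * n)) F.ε := by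
      refine ⟨F.ε / (‖t‖ + 1), (div_pos F.ε_pos (by positivity)).ne', ?_⟩
      rw [mem_ball_zero_iff, norm_smul, Real.norm_of_nonneg (div_pos F.ε_pos (by positivity)).le,
        div_mul_eq_mul_div, div_lt_iff₀ (by positivity)]
      nlinarith [F.ε_pos, norm_nonneg t]
    obtain ⟨v, hv, hvw⟩ := hFder (c • t) hc x hxe
    have h2 : HasDerivAt (fun τ : ℝ => e (F.F (τ • c • t) x)) (D (c • t)) 0 := by
      have h3 : HasDerivAt (fun τ : ℝ => τ • c • t) (c • t) 0 := by
        simpa using (hasDerivAt_id (0 : ℝ)).smul_const (c • t)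
      refine HasFDerivAt.comp_hasDerivAt (l := fun t => e (F.F t x)) (0 : ℝ) ?_ h3
      simpa using hGd
    have h4 : v = 0 := by
      rw [hv.unique h2, map_smul, ht, smul_zero]
    have h5 : inner ℝ t (c • t) = 0 := by
      rw [← hfd, ← hvw, h4]
      exact (localForm Ω.form e (e x)).map_coord_zero 0 rfl
    rw [inner_smul_right] at h5
    exact inner_self_eq_zero.1 ((mul_eq_zero.1 h5).resolve_left hc0)
  let T : Euc (2 * n) ≃L[ℝ] Euc (2 * n) :=
    (LinearEquiv.ofInjectiveEndo (D : Euc (2 * n) →ₗ[ℝ] Euc (2 * n)) hinj).toContinuousLinearEquiv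
  have hstrict : HasStrictFDerivAt (fun t => e (F.F t x)) (T : Euc (2 * n) →L[ℝ] Euc (2 * n)) 0 :=
    hGs.hasStrictFDerivAt (by simp)
  have hmap := hstrict.map_nhds_eq_of_equiv
  intro O hO
  have hcont := F.continuousAt_param x
  have h6 : (fun t => F.F t x) ⁻¹' e.source ∈ 𝓝 (0 : Euc (2 * n)) :=
    hcont.preimage_mem_nhds (by rw [F.zero x]; exact e.open_source.mem_nhds hxe)
  have h7 : (fun t => e (F.F t x)) '' (O ∩ (fun t => F.F t x) ⁻¹' e.source) ∈ 𝓝 (e x) := by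
    have := image_mem_map (m := fun t => e (F.F t x)) (inter_mem hO h6)
    rwa [hmap, F.zero x] at this
  have h8 := (e.continuousAt hxe).preimage_mem_nhds h7
  filter_upwards [h8, e.open_source.mem_nhds hxe] with y hy hye
  obtain ⟨t, ⟨htO, hts⟩, hty⟩ := hy
  exact ⟨t, htO, e.injOn hts hye hty⟩

variable {ι : Type} (A : ι → ActionAngle Ω)

/-- Small symplectic diffeomorphisms which push points of intersections of closures of the domains
of the action-angle coordinates into these domains. -/
theorem exists_crossing [T2Space N] [SecondCountableTopology N] [Countable ι]
    (hdense : closure (⋃ i, (A i).carrier) = univ)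
    (hfin : ∀ C : Set N, IsCompact C → {i | ((A i).carrier ∩ C).Nonempty}.Finite)
    (hne : ∀ i, (A i).carrier.Nonempty)
    (g : Bundle.ContinuousRiemannianMetric (Euc (2 * n))
      (fun x : N => TangentSpace (𝓡 (2 * n)) x)) {r : ℕ∞}
    (W : StrongNhdData (2 * n) N r) (hW : W.IsAt id) :
    ∃ ψ : N ≃ₘ^∞⟮𝓡 (2 * n), 𝓡 (2 * n)⟯ N, IsNearId Ω g W ψ ∧ IsNearId Ω g W ψ.symm ∧
      (∀ j, ∃ x ∈ (A j).carrier, ψ x ∈ (A j).carrier) ∧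
      ∀ i j, (closure (A i).carrier ∩ closure (A j).carrier).Nonempty →
        ∃ x ∈ closure (A i).carrier ∩ closure (A j).carrier, ∃ l, ψ x ∈ (A l).carrier := by
  have : LocallyCompactSpace N := ChartedSpace.locallyCompactSpace (Euc (2 * n)) N
  have : TopologicalSpace.MetrizableSpace N := Manifold.metrizableSpace (𝓡 (2 * n)) N
  choose q hq using hne
  let K := {z : ι × ι // (closure (A z.1).carrier ∩ closure (A z.2).carrier).Nonempty}
  choose pt hpt using fun z : K => z.2
  set S : Set N := range pt with hS
  have hScount : Countable S := (countable_range pt).to_subtype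
  have hSfin : ∀ x ∈ S, ∃ U ∈ 𝓝 x, (U ∩ S).Finite := by
    intro x _
    obtain ⟨C, hC, hxC⟩ := exists_compact_mem_nhds x
    refine ⟨interior C, interior_mem_nhds.2 hxC, ?_⟩
    -- A domain whose closure has a point in the interior of `C` meets `C`, which leaves finitely
    -- many pairs of indices.
    have h1 : {z : K | pt z ∈ interior C}.Finite := by
      refine Finite.subset ((((hfin C hC).prod (hfin C hC)).preimage
        Subtype.val_injective.injOn)) fun z hz => ?_
      have h2 : ∀ i, pt z ∈ closure (A i).carrier → i ∈ {i | ((A i).carrier ∩ C).Nonempty} := by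
        intro i hi
        obtain ⟨y, hy, hyi⟩ := mem_closure_iff.1 hi _ isOpen_interior hz
        exact ⟨y, hyi, interior_subset hy⟩
      exact ⟨h2 _ (hpt z).1, h2 _ (hpt z).2⟩
    refine (h1.image pt).subset ?_
    rintro _ ⟨hxC, z, rfl⟩
    exact ⟨z, hxC, rfl⟩
  obtain ⟨V, hV, hVdisj⟩ := exists_disjoint_nhds hSfin
  choose F hFV hFO using fun s : S => exists_translationFamily (Ω := Ω) (hV s).1 (hV s).2
  have hVd : ∀ s s' : S, s ≠ s' → Disjoint (V s) (V s') := fun s s' h =>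
    hVdisj s s.2 s' s'.2 fun h' => h (Subtype.ext h')
  have hsep : Separated F := by
    refine ⟨fun s s' h => (hVd s s' h).mono (hFV s) (hFV s'), fun s x hx =>
      ⟨V s, (hV s).1.mem_nhds (hFV s hx), (finite_singleton s).subset ?_⟩⟩
    rintro s' ⟨y, hy, hyU⟩
    by_contra hne
    exact disjoint_left.1 (hVd s' s hne) (hFV s' hy) hyU
  obtain ⟨ρ, hρ, hglue⟩ := exists_glue g W hW hsep
  -- Small parameters move the chosen point over a neighbourhood of itself, which meets the dense
  -- union of the domains. The base points `q j` of the finitely many domains touched by the support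
  -- stay in their domains.
  have ht : ∀ s : S, ∃ t : Euc (2 * n), ‖t‖ < ρ s ∧ (∃ l, (F s).F t s ∈ (A l).carrier) ∧
      ∀ j ∈ {j | ((A j).carrier ∩ (F s).S).Nonempty}, (F s).F t (q j) ∈ (A j).carrier := by
    intro s
    have h1 : ∀ᶠ t in 𝓝 (0 : Euc (2 * n)),
        ∀ j ∈ {j | ((A j).carrier ∩ (F s).S).Nonempty}, (F s).F t (q j) ∈ (A j).carrier := by
      rw [Filter.eventually_all_finite (hfin _ (F s).isCompact_S)]
      intro j _
      refine (F s).continuousAt_param (q j) ((A j).isOpen_carrier.mem_nhds ?_)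
      simp only [(F s).zero]
      exact hq j
    have h3 := hFO s _ (inter_mem h1 (Metric.ball_mem_nhds 0 (hρ s).1))
    have h4 : (s : N) ∈ closure (⋃ i, (A i).carrier) := hdense ▸ mem_univ _
    obtain ⟨y, ⟨t, ⟨ht1, ht2⟩, rfl⟩, hy⟩ := mem_closure_iff_nhds.1 h4 _ h3
    obtain ⟨l, hl⟩ := mem_iUnion.1 hy
    exact ⟨t, by simpa using ht2, ⟨l, hl⟩, ht1⟩
  choose t htρ htl htq using ht
  have htε : ∀ s, t s ∈ Metric.ball 0 (F s).ε := fun s => by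
    rw [mem_ball_zero_iff]
    exact (htρ s).trans_le (hρ s).2
  obtain ⟨ψ, hψ, -, hn, hn'⟩ := hglue t htρ
  refine ⟨ψ, hn, hn', fun j => ⟨q j, hq j, ?_⟩, fun i j hij => ?_⟩
  · rw [hψ]
    by_cases h : ∃ s, q j ∈ (F s).S
    · obtain ⟨s, hs⟩ := h
      rw [glue_of_mem hsep hs]
      exact htq s j ⟨q j, hq j, hs⟩
    · rw [glue_of_notMem (by simpa using h)]
      exact hq j
  · let s : S := ⟨pt ⟨(i, j), hij⟩, mem_range_self _⟩
    refine ⟨pt ⟨(i, j), hij⟩, hpt ⟨(i, j), hij⟩, ?_⟩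
    rw [hψ, glue_eq_of_forall_ne hsep htε (k := s) fun s' hne hx =>
      disjoint_left.1 (hVd s' s hne) (hFV s' hx) (hV s).2]
    exact htl s

end Crossing
end SymplecticIFS
end

/-! ### Branches of iterated function systems and the connectedness argument -/

noncomputable section
namespace SymplecticIFS

section IFS

variable {ι X : Type*} {g : ι → X → X}

lemma mem_ifsOrbit {x y : X} : y ∈ ifsOrbit g x ↔ ∃ σ k, branch g σ x (k + 1) = y := by
  simp [ifsOrbit, branchOrbit]

lemma branch_congr {σ τ : ℕ → ι} (x : X) {k : ℕ} (h : ∀ i < k, σ i = τ i) :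
    branch g σ x k = branch g τ x k := by
  induction k with
  | zero => rfl
  | succ k ih =>
    rw [branch, branch, ih fun i hi => h i (hi.trans k.lt_succ_self), h k k.lt_succ_self]

/-- The sequence which follows `τ` for `m` steps, and `σ` afterwards. -/
def concat (τ : ℕ → ι) (m : ℕ) (σ : ℕ → ι) (i : ℕ) : ι := if i < m then τ i else σ (i - m)

lemma branch_concat (τ σ : ℕ → ι) (m k : ℕ) (x : X) :
    branch g (concat τ m σ) x (m + k) = branch g σ (branch g τ x m) k := by
  induction k with
  | zero => exact branch_congr x fun i hi => if_pos hi
  | succ k ih =>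
    rw [← Nat.add_assoc, branch, ih, branch, concat, if_neg (by omega), Nat.add_sub_cancel_left]

/-- The points whose orbit meets `V`. -/
def hitting (g : ι → X → X) (V : Set X) : Set X := {x | (ifsOrbit g x ∩ V).Nonempty}

lemma mem_hitting {V : Set X} {x : X} :
    x ∈ hitting g V ↔ ∃ σ k, branch g σ x (k + 1) ∈ V := by
  constructor
  · rintro ⟨y, hy, hyV⟩
    obtain ⟨σ, k, rfl⟩ := mem_ifsOrbit.1 hy
    exact ⟨σ, k, hyV⟩
  · rintro ⟨σ, k, h⟩
    exact ⟨_, mem_ifsOrbit.2 ⟨σ, k, rfl⟩, h⟩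

lemma mem_hitting_of_branch {V : Set X} {x : X} (τ : ℕ → ι) (m : ℕ)
    (h : branch g τ x m ∈ hitting g V) : x ∈ hitting g V := by
  obtain ⟨σ, k, hk⟩ := mem_hitting.1 h
  exact mem_hitting.2 ⟨concat τ m σ, m + k, by rwa [Nat.add_assoc, branch_concat]⟩

lemma mem_hitting_of_apply {V : Set X} {x : X} (i : ι) (h : g i x ∈ hitting g V) :
    x ∈ hitting g V :=
  mem_hitting_of_branch (fun _ => i) 1 h

variable [TopologicalSpace X]

lemma continuous_branch [TopologicalSpace ι] [DiscreteTopology ι] (hg : ∀ i, Continuous (g i))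
    (k : ℕ) : Continuous fun z : X × (ℕ → ι) => branch g z.2 z.1 k := by
  induction k with
  | zero => exact continuous_fst
  | succ k ih =>
    have h1 : Continuous fun w : ι × X => g w.1 w.2 := continuous_prod_of_discrete_left.2 hg
    exact h1.comp (((continuous_apply k).comp continuous_snd).prodMk ih)

lemma isOpen_hitting (hg : ∀ i, Continuous (g i)) {V : Set X} (hV : IsOpen V) :
    IsOpen (hitting g V) := by
  let _ : TopologicalSpace ι := ⊥
  have : DiscreteTopology ι := ⟨rfl⟩
  have h : hitting g V = ⋃ σ : ℕ → ι, ⋃ k : ℕ, (fun x => branch g σ x (k + 1)) ⁻¹' V := by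
    ext x
    simp [mem_hitting]
  rw [h]
  exact isOpen_iUnion fun σ => isOpen_iUnion fun k =>
    hV.preimage ((continuous_branch hg (k + 1)).comp (Continuous.prodMk_left σ))

/-- If the orbits of a dense set of points meet `V`, for each open set `V`, then there is a dense
orbit. -/
lemma exists_dense_branchOrbit [Nonempty X] [T2Space X] [LocallyCompactSpace X]
    [SecondCountableTopology X] [Finite ι] [Nonempty ι] (hg : ∀ i, Continuous (g i))
    (hgo : ∀ i, IsOpenMap (g i))
    (h : ∀ V : Set X, IsOpen V → V.Nonempty → Dense (hitting g V)) :
    ∃ (x : X) (σ : ℕ → ι), Dense (branchOrbit g σ x) := by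
  let _ : TopologicalSpace ι := ⊥
  have : DiscreteTopology ι := ⟨rfl⟩
  -- Baire's theorem is used for points and sequences together: the space of sequences over a finite
  -- alphabet is compact.
  let G : Set X → Set (X × (ℕ → ι)) := fun V => {z | ∃ k, branch g z.2 z.1 (k + 1) ∈ V}
  have hGo : ∀ V, IsOpen V → IsOpen (G V) := by
    intro V hV
    have : G V = ⋃ k : ℕ, (fun z : X × (ℕ → ι) => branch g z.2 z.1 (k + 1)) ⁻¹' V := by
      ext z
      simp [G]
    rw [this]
    exact isOpen_iUnion fun k => hV.preimage (continuous_branch hg (k + 1))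
  have hopen : ∀ (τ : ℕ → ι) m, IsOpenMap fun x => branch g τ x m := by
    intro τ m
    induction m with
    | zero => exact IsOpenMap.id
    | succ m ih => exact (hgo (τ m)).comp ih
  -- Keeping the first `m` letters of `τ` stays near `τ`. The branch map of length `m` is open, so a
  -- point near `x₀` is sent into the dense hitting set, from where a suitable tail reaches `V`.
  have hGd : ∀ V, IsOpen V → V.Nonempty → Dense (G V) := by
    intro V hV hVne
    rw [dense_iff_inter_open]
    rintro U hU ⟨⟨x₀, τ⟩, hU₀⟩
    obtain ⟨U₁, hU₁, W, hW, hUW⟩ := mem_nhds_prod_iff.1 (hU.mem_nhds hU₀)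
    obtain ⟨U₂, hU₂, hU₂o, hx₀⟩ := mem_nhds_iff.1 hU₁
    have h1 : ∀ m, ∃ x ∈ U₂, ∃ σ k, branch g σ (branch g τ x m) (k + 1) ∈ V := by
      intro m
      obtain ⟨_, ⟨x, hx, rfl⟩, hxV⟩ := (h V hV hVne).inter_open_nonempty _ (hopen τ m _ hU₂o)
        ⟨_, mem_image_of_mem _ hx₀⟩
      exact ⟨x, hx, mem_hitting.1 hxV⟩
    choose x hx σ k hk using h1
    have h2 : Tendsto (fun m => concat τ m (σ m)) atTop (𝓝 τ) := by
      refine tendsto_pi_nhds.2 fun i => tendsto_const_nhds.congr' ?_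
      filter_upwards [eventually_gt_atTop i] with m hm
      exact (if_pos hm).symm
    obtain ⟨m, hm⟩ := (h2.eventually hW).exists
    refine ⟨(x m, concat τ m (σ m)), hUW ⟨hU₂ (hx m), hm⟩, m + k m, ?_⟩
    rw [Nat.add_assoc, branch_concat]
    exact hk m
  obtain ⟨b, hbc, hb0, hb⟩ := TopologicalSpace.exists_countable_basis X
  have : Countable b := hbc.to_subtype
  have hbo : ∀ V : b, IsOpen (V : Set X) := fun V => hb.isOpen V.2
  have hdense : Dense (⋂ V : b, G V) := dense_iInter_of_isOpen (fun V => hGo _ (hbo V))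
    fun V => hGd _ (hbo V) (nonempty_iff_ne_empty.2 fun h0 => hb0 (h0 ▸ V.2))
  obtain ⟨⟨x, σ⟩, hx⟩ := hdense.nonempty
  refine ⟨x, σ, hb.dense_iff.2 fun V hV _ => ?_⟩
  obtain ⟨k, hk⟩ := mem_iInter.1 hx ⟨V, hV⟩
  exact ⟨_, hk, mem_range_self k⟩

end IFS

section Connect

set_option linter.unusedSectionVars false

variable {n : ℕ} {N : Type*} [TopologicalSpace N] [ChartedSpace (Euc (2 * n)) N]
  {Ω : SymplecticForm n N} [IsManifold (𝓡 (2 * n)) ∞ N] {ι : Type} (A : ι → ActionAngle Ω)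

/-- The intersection of `Q` with the domain of the action-angle coordinates is a union of tori. -/
def ActionAngle.Saturated (B : ActionAngle Ω) (Q : Set N) : Prop :=
  ∀ I ∈ B.D, ∀ θ θ', B.param (I, θ) ∈ Q → B.param (I, θ') ∈ Q

/-- Translation of the angles by `θ' - θ` is a local homeomorphism in the coordinates that preserves
`Q`, hence its closure. -/
lemma ActionAngle.Saturated.closure {B : ActionAngle Ω} {Q : Set N} (h : B.Saturated Q) :
    B.Saturated (closure Q) := by
  intro I hI θ θ' hθ
  rw [mem_closure_iff_nhds] at hθ ⊢
  intro U hU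
  have h1 : B.param ⁻¹' U ∈ 𝓝 (I, θ') :=
    (B.contMDiffAt_param hI θ').continuousAt.preimage_mem_nhds hU
  have h2 : ∀ᶠ z : Euc n × Euc n in 𝓝 (I, θ), B.param (z.1, z.2 + (θ' - θ)) ∈ U ∧ z.1 ∈ B.D := by
    have h3 : ContinuousAt (fun z : Euc n × Euc n => (z.1, z.2 + (θ' - θ))) (I, θ) := by fun_prop
    refine (h3.eventually (p := fun w => B.param w ∈ U) ?_).and
      (continuousAt_fst.eventually (B.isOpen_D.mem_nhds hI))
    simp only [add_sub_cancel]
    exact h1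
  have h4 : B.param '' {z | B.param (z.1, z.2 + (θ' - θ)) ∈ U ∧ z.1 ∈ B.D} ∈ 𝓝 (B.param (I, θ)) := by
    rw [← B.map_nhds_param hI θ]
    exact image_mem_map h2
  obtain ⟨_, ⟨z, hz, rfl⟩, hzQ⟩ := hθ _ h4
  exact ⟨_, hz.1, h z.1 hz.2 z.2 _ hzQ⟩

lemma ActionAngle.Saturated.frontier {B : ActionAngle Ω} {Q : Set N} (h : B.Saturated Q)
    (hQ : IsOpen Q) : B.Saturated (frontier Q) := by
  rw [hQ.frontier_eq]
  exact fun I hI θ θ' hθ => ⟨h.closure I hI θ θ' hθ.1, fun hcon => hθ.2 (h I hI θ' θ hcon)⟩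

lemma ActionAngle.isConnected_carrier (B : ActionAngle Ω) : IsConnected B.carrier := by
  rw [← B.image_eq]
  exact (B.isConnected_D.prod isConnected_univ).image _ B.smooth.continuousOn

lemma subset_or_disjoint_of_frontier {X : Type*} [TopologicalSpace X] {S O : Set X}
    (hS : IsPreconnected S) (hO : IsOpen O) (h : Disjoint S (frontier O)) :
    S ⊆ O ∨ Disjoint S (closure O) := by
  by_cases hne : (S ∩ O).Nonempty
  · exact Or.inl (hS.subset_left_of_subset_union hO isClosed_closure.isOpen_compl
      (disjoint_compl_right.mono_left subset_closure) (fun x hx => by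
        by_cases hxc : x ∈ closure O
        · refine Or.inl (by_contra fun hxO => disjoint_left.1 h hx ?_)
          rw [hO.frontier_eq]
          exact ⟨hxc, hxO⟩
        · exact Or.inr hxc) hne)
  · refine Or.inr (disjoint_left.2 fun x hx hxc => disjoint_left.1 h hx ?_)
    rw [hO.frontier_eq]
    exact ⟨hxc, fun hxO => hne ⟨x, hx, hxO⟩⟩

/-- An open set which is a union of tori of all the action-angle coordinates, and of their images
by a suitable homeomorphism, contains the domains of all these coordinates. -/
theorem carrier_subset_of_saturated [ConnectedSpace N] (φ : N ≃ₜ N)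
    (hdense : closure (⋃ i, (A i).carrier) = univ)
    (hlf : LocallyFinite fun i => (A i).carrier)
    (hgood : ∀ i, ∀ J ∈ (A i).D, IsGood A φ i J)
    (hmeet : ∀ i, ∀ I ∈ (A i).D, ∃ θ j, ∃ x ∈ (A j).carrier, φ x = (A i).param (I, θ))
    (hself : ∀ j, ∃ x ∈ (A j).carrier, φ x ∈ (A j).carrier)
    (hcross : ∀ i j, (closure (A i).carrier ∩ closure (A j).carrier).Nonempty →
      ∃ x ∈ closure (A i).carrier ∩ closure (A j).carrier, ∃ l, φ x ∈ (A l).carrier)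
    {O : Set N} (hO : IsOpen O) (hOne : O.Nonempty) (hsat : ∀ i, (A i).Saturated O)
    (hsat' : ∀ i, (A i).Saturated (φ ⁻¹' O)) : ⋃ i, (A i).carrier ⊆ O := by
  -- A torus meeting the frontier of `φ⁻¹(O)` lies in it entirely. Goodness and saturation then put
  -- an open set of tori inside the frontier of `O`, whose interior is empty.
  have hX' : ∀ j, Disjoint (A j).carrier (frontier (φ ⁻¹' O)) := by
    intro j
    rw [disjoint_left]
    intro x hx hxX
    obtain ⟨J, hJ, θ, rfl⟩ := (A j).exists_param hx
    obtain ⟨i, V, hV, ⟨I₀, hI₀⟩, hVD, hVφ⟩ := hgood j J hJ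
    have h1 : ∀ I ∈ V, ∀ τ, (A i).param (I, τ) ∈ frontier O := by
      intro I hI τ
      obtain ⟨θ', τ', h2⟩ := hVφ I hI
      have h3 := (hsat' j).frontier (hO.preimage φ.continuous) J hJ θ θ' hxX
      rw [← φ.preimage_frontier, mem_preimage, h2] at h3
      exact (hsat i).frontier hO I (hVD hI) τ' τ h3
    have h4 : (A i).param '' (V ×ˢ univ) ⊆ frontier O := by
      rintro _ ⟨z, hz, rfl⟩
      exact h1 z.1 hz.1 z.2
    have h5 : IsOpen ((A i).param '' (V ×ˢ univ)) :=
      (A i).isOpen_image_param (hV.prod isOpen_univ) (prod_mono_left hVD)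
    have h6 := interior_maximal h4 h5 (mem_image_of_mem _ (show (I₀, 0) ∈ V ×ˢ univ from
      ⟨hI₀, mem_univ _⟩))
    rw [← frontier_compl, interior_frontier hO.isClosed_compl] at h6
    exact h6
  -- A torus meeting the frontier of `O` lies in it; but it contains a point `φ y` with `y` in some
  -- domain, and such a `y` is not in the frontier of `φ⁻¹(O)`.
  have hX : ∀ i, Disjoint (A i).carrier (frontier O) := by
    intro i
    rw [disjoint_left]
    intro x hx hxX
    obtain ⟨I, hI, θ, rfl⟩ := (A i).exists_param hx
    obtain ⟨θ', j, y, hy, hyφ⟩ := hmeet i I hI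
    refine disjoint_left.1 (hX' j) hy ?_
    rw [← φ.preimage_frontier, mem_preimage, hyφ]
    exact (hsat i).frontier hO I hI θ θ' hxX
  have hor := fun i => subset_or_disjoint_of_frontier (A i).isConnected_carrier.isPreconnected hO
    (hX i)
  have hor' := fun i => subset_or_disjoint_of_frontier (A i).isConnected_carrier.isPreconnected
    (hO.preimage φ.continuous) (hX' i)
  -- The point which stays in its domain under `φ` ties the two alternatives, for `O` and for
  -- `φ⁻¹(O)`, together.
  have hiff : ∀ i, (A i).carrier ⊆ O ↔ (A i).carrier ⊆ φ ⁻¹' O := by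
    intro i
    obtain ⟨x, hx, hx'⟩ := hself i
    constructor
    · intro h
      exact (hor' i).resolve_right fun hd => disjoint_left.1 hd hx (subset_closure (h hx'))
    · intro h
      exact (hor i).resolve_right fun hd => disjoint_left.1 hd hx' (subset_closure (h hx))
  -- The crossing point `p` is in the closure of `φ⁻¹(O)`, so `φ p` is in the closure of `O`. Lying
  -- in a domain, `φ p` avoids the frontier, hence is in `O`, and points of the second domain near
  -- `p` are in `φ⁻¹(O)`.
  have hstep : ∀ i j, (A i).carrier ⊆ O →
      (closure (A i).carrier ∩ closure (A j).carrier).Nonempty → (A j).carrier ⊆ O := by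
    intro i j hi hij
    obtain ⟨p, ⟨hpi, hpj⟩, l, hl⟩ := hcross i j hij
    have h1 : p ∈ closure (φ ⁻¹' O) := closure_mono ((hiff i).1 hi) hpi
    have h2 : φ p ∈ closure O := by
      rw [← φ.preimage_closure] at h1
      exact h1
    have h3 : φ p ∈ O := by
      by_contra hcon
      refine disjoint_left.1 (hX l) hl ?_
      rw [hO.frontier_eq]
      exact ⟨h2, hcon⟩
    obtain ⟨y, hyO, hyj⟩ := mem_closure_iff.1 hpj _ (hO.preimage φ.continuous) h3
    exact (hiff j).2 ((hor' j).resolve_right fun hd => disjoint_left.1 hd hyj (subset_closure hyO))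
  set S : Set ι := {i | (A i).carrier ⊆ O} with hS
  have hcl : ∀ T : Set ι, closure (⋃ i ∈ T, (A i).carrier) = ⋃ i ∈ T, closure (A i).carrier := by
    intro T
    rw [biUnion_eq_iUnion, biUnion_eq_iUnion]
    exact (hlf.comp_injective (g := fun i : T => (i : ι)) Subtype.val_injective).closure_iUnion
  -- By local finiteness the closures of the domains inside `O` and those of the others form two
  -- closed sets covering `N`; the crossing step makes them disjoint.
  have hunion : (⋃ i ∈ S, closure (A i).carrier) ∪ (⋃ i ∈ Sᶜ, closure (A i).carrier) = univ := by
    rw [← hcl, ← hcl, ← closure_union, ← biUnion_union, union_compl_self, biUnion_univ, hdense]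
  have hdisj : Disjoint (⋃ i ∈ S, closure (A i).carrier) (⋃ i ∈ Sᶜ, closure (A i).carrier) := by
    rw [disjoint_left]
    intro x hx hx'
    obtain ⟨i, hi, hxi⟩ := mem_iUnion₂.1 hx
    obtain ⟨j, hj, hxj⟩ := mem_iUnion₂.1 hx'
    exact hj (hstep i j hi ⟨x, hxi, hxj⟩)
  have hclosed : ∀ T : Set ι, IsClosed (⋃ i ∈ T, closure (A i).carrier) := fun T => by
    rw [← hcl]
    exact isClosed_closure
  have hne : (⋃ i ∈ S, closure (A i).carrier).Nonempty := by
    obtain ⟨y, hyU, hyO⟩ := (dense_iff_closure_eq.2 hdense).inter_open_nonempty O hO hOne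
    obtain ⟨i, hi⟩ := mem_iUnion.1 hyO
    exact ⟨y, mem_iUnion₂.2 ⟨i, (hor i).resolve_right fun hd =>
      disjoint_left.1 hd hi (subset_closure hyU), subset_closure hi⟩⟩
  have hcompl : (⋃ i ∈ S, closure (A i).carrier) = (⋃ i ∈ Sᶜ, closure (A i).carrier)ᶜ := by
    refine (subset_compl_iff_disjoint_right.2 hdisj).antisymm fun x hx => ?_
    have h1 := mem_univ x
    rw [← hunion] at h1
    exact h1.resolve_right hx
  have hclopen : IsClopen (⋃ i ∈ S, closure (A i).carrier) :=
    ⟨hclosed S, hcompl ▸ (hclosed Sᶜ).isOpen_compl⟩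
  have huniv := hclopen.eq_univ hne
  refine iUnion_subset fun i => ?_
  by_contra hi
  obtain ⟨x, hx, -⟩ := hself i
  exact disjoint_left.1 hdisj (huniv ▸ mem_univ x)
    (mem_iUnion₂.2 ⟨i, hi, subset_closure hx⟩)

end Connect
end SymplecticIFS
end

/-! ### Assembly of the conjugacy and the main theorem -/

noncomputable section
namespace SymplecticIFS

lemma semiconj_zpow {X Y : Type*} {F : X → Y} {e₁ : Equiv.Perm X} {e₂ : Equiv.Perm Y}
    (h : ∀ x, e₂ (F x) = F (e₁ x)) (d : ℤ) (x : X) : (e₂ ^ d) (F x) = F ((e₁ ^ d) x) := by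
  have hinv : ∀ x, e₂⁻¹ (F x) = F (e₁⁻¹ x) := fun x => by
    rw [Equiv.Perm.inv_eq_iff_eq, h]
    exact congrArg F (e₁.apply_symm_apply x).symm
  induction d generalizing x with
  | zero => simp
  | succ k ih => rw [zpow_add_one, zpow_add_one, Equiv.Perm.mul_apply, Equiv.Perm.mul_apply, h, ih]
  | pred k ih => rw [zpow_sub_one, zpow_sub_one, Equiv.Perm.mul_apply, Equiv.Perm.mul_apply, hinv, ih]

lemma zpow_addRight_apply {E : Type*} [AddCommGroup E] (v : E) (d : ℤ) (x : E) :
    (Equiv.addRight v ^ d : Equiv.Perm E) x = x + d • v := by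
  induction d generalizing x with
  | zero => simp
  | succ k ih =>
    rw [zpow_add_one, Equiv.Perm.mul_apply, ih, Equiv.coe_addRight, add_comm _ (1 : ℤ), add_zsmul,
      one_zsmul, add_assoc]
  | pred k ih =>
    have h : (Equiv.addRight v)⁻¹ x = x - v := (sub_eq_add_neg x v).symm
    rw [zpow_sub_one, Equiv.Perm.mul_apply, ih, h, sub_zsmul, one_zsmul]
    abel

/-- Powers are taken in the group of homeomorphisms and pushed to permutations, so negative powers
are continuous and open as well. -/
lemma exists_homeomorph_zpow {X : Type*} [TopologicalSpace X] (e : X ≃ₜ X) (d : ℤ) :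
    ∃ h : X ≃ₜ X, ⇑h = ⇑(e.toEquiv ^ d : Equiv.Perm X) := by
  let f : (X ≃ₜ X) →* Equiv.Perm X :=
    { toFun := Homeomorph.toEquiv, map_one' := rfl, map_mul' := fun _ _ => rfl }
  exact ⟨e ^ d, congrArg DFunLike.coe (map_zpow f e d)⟩

section Main

set_option linter.unusedSectionVars false

variable {n : ℕ} {N : Type*} [TopologicalSpace N] [ChartedSpace (Euc (2 * n)) N]
  {Ω : SymplecticForm n N} [IsManifold (𝓡 (2 * n)) ∞ N] {r : ℕ∞}

lemma zpow_param {A : ActionAngle Ω} {α : Euc n → Euc n} {T : Equiv.Perm N} {I : Euc n}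
    (h : ∀ θ, T (A.param (I, θ)) = A.param (I, θ + α I)) (d : ℤ) (θ : Euc n) :
    (T ^ d) (A.param (I, θ)) = A.param (I, θ + (d : ℝ) • α I) := by
  have h1 := semiconj_zpow (F := fun θ => A.param (I, θ)) (e₁ := Equiv.addRight (α I)) (e₂ := T)
    (fun θ => h θ) d θ
  rw [zpow_addRight_apply] at h1
  rw [h1, Int.cast_smul_eq_zsmul]

lemma tangentLength_comp_le (g : Bundle.ContinuousRiemannianMetric (Euc (2 * n))
    (fun x : N => TangentSpace (𝓡 (2 * n)) x)) {f h : N → N}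
    (hf : ContMDiff (𝓡 (2 * n)) (𝓡 (2 * n)) ∞ f) (hh : ContMDiff (𝓡 (2 * n)) (𝓡 (2 * n)) ∞ h)
    {a b : ℝ} (ha : 0 ≤ a)
    (hfa : ∀ (x : N) (v : Euc (2 * n)),
      tangentLength g (f x) (tmap f x v) ≤ a * tangentLength g x v)
    (hhb : ∀ (x : N) (v : Euc (2 * n)),
      tangentLength g (h x) (tmap h x v) ≤ b * tangentLength g x v) (x : N) (v : Euc (2 * n)) :
    tangentLength g ((f ∘ h) x) (tmap (f ∘ h) x v) ≤ a * b * tangentLength g x v := by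
  rw [tmap_apply_comp (contMDiff_mdifferentiable hf) (contMDiff_mdifferentiable hh),
    Function.comp_apply, mul_assoc]
  exact (hfa _ _).trans (mul_le_mul_of_nonneg_left (hhb x v) ha)

/-- In every neighbourhood of an integrable diffeomorphism there is a conjugate such that the
iterated function systems generated by powers of both have generic orbits hitting every open
set. -/
theorem exists_conjugation [T2Space N] [SecondCountableTopology N] [ConnectedSpace N]
    (hn : 0 < n) (g : Bundle.ContinuousRiemannianMetric (Euc (2 * n))
      (fun x : N => TangentSpace (𝓡 (2 * n)) x)) (hr : 1 ≤ r)
    (T : N ≃ₘ^r⟮𝓡 (2 * n), 𝓡 (2 * n)⟯ N) (hint : IsIntegrable Ω r T)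
    (W : StrongNhdData (2 * n) N r) (hW : W.IsAt T) :
    ∃ φ : N ≃ₘ^∞⟮𝓡 (2 * n), 𝓡 (2 * n)⟯ N, IsSymplectic Ω φ ∧ IsSymplectic Ω φ.symm ∧
      W.Contains T (conjDiffeo φ T) ∧
      (∀ (x : N) (v : Euc (2 * n)),
        tangentLength g (φ x) (tmap φ x v) ≤ 8 * tangentLength g x v) ∧
      (∀ (x : N) (v : Euc (2 * n)),
        tangentLength g (φ.symm x) (tmap φ.symm x v) ≤ 8 * tangentLength g x v) ∧
      ∀ d d' : ℤ, d ≠ 0 → d' ≠ 0 → ∀ V : Set N, IsOpen V → V.Nonempty →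
        IsLebesgueNull (m := 2 * n) (hitting ![⇑(T.toEquiv ^ d : Equiv.Perm N),
          ⇑((conjDiffeo φ T).toEquiv ^ d' : Equiv.Perm N)] V)ᶜ := by
  have hloc : LocallyCompactSpace N := ChartedSpace.locallyCompactSpace (Euc (2 * n)) N
  obtain ⟨ι, A, hcl, hdisj, hfin, hrot, L, hL, hcov⟩ := hint
  have hne : ∀ i, (A i).carrier.Nonempty := fun i => (A i).isConnected_carrier.nonempty
  have hcount : Countable ι := Pairwise.countable_of_isOpen_disjoint
    (s := fun i => (A i).carrier) hdisj (fun i => (A i).isOpen_carrier) hne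
  obtain ⟨W', hW', hconj⟩ := exists_strongNhd_conj T W hW
  -- The order of choices matters: `a` is adapted to `ψ⁻¹`, and `c` afterwards to `a⁻¹ ∘ ψ`.
  obtain ⟨ψ, hψ, hψ', hψself, hψcross⟩ := exists_crossing A hcl hfin hne g W' hW'
  obtain ⟨a, ha, ha', hafix, hapres, hagood⟩ :=
    exists_twist A hn hdisj hL hcov g W' hW' ψ.symm hψ'.symp
  obtain ⟨c, hc, hc', hcfix, hcpres, hcgood⟩ :=
    exists_twist A hn hdisj hL hcov g W' hW' (ψ.trans a.symm)
      (ha'.symp.comp hψ.symp (contMDiff_mdifferentiable ha'.contMDiff)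
        (contMDiff_mdifferentiable hψ.contMDiff))
  set φ := c.trans (ψ.trans a.symm) with hφ
  have hφx : ∀ x, φ x = a.symm (ψ (c x)) := fun x => rfl
  have hapres' : ∀ i x, x ∈ (A i).carrier → a.symm x ∈ (A i).carrier := fun i x hx =>
    (hapres i _).1 (by rwa [a.apply_symm_apply])
  have hcpres' : ∀ i x, x ∈ (A i).carrier → c.symm x ∈ (A i).carrier := fun i x hx =>
    (hcpres i _).1 (by rwa [c.apply_symm_apply])
  have hlf : LocallyFinite fun i => (A i).carrier := by
    intro x
    obtain ⟨C, hC, hxC⟩ := exists_compact_mem_nhds x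
    exact ⟨C, hxC, hfin C hC⟩
  -- Goodness of the torus for `ψ⁻¹ ∘ a` is used only to find one of its points sent into a domain;
  -- `c⁻¹` preserves that domain.
  have hmeet : ∀ i, ∀ I ∈ (A i).D, ∃ θ j, ∃ x ∈ (A j).carrier, φ x = (A i).param (I, θ) := by
    intro i I hI
    obtain ⟨j, V, -, ⟨I', hI'⟩, hVD, hV⟩ := hagood i I hI
    obtain ⟨θ, τ, h⟩ := hV I' hI'
    refine ⟨θ, j, c.symm ((A j).param (I', τ)), hcpres' j _ ((A j).param_mem (hVD hI') τ), ?_⟩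
    rw [hφx, c.apply_symm_apply, ← h, Function.comp_apply, ψ.apply_symm_apply, a.symm_apply_apply]
  have hself : ∀ j, ∃ x ∈ (A j).carrier, φ x ∈ (A j).carrier := by
    intro j
    obtain ⟨x, hx, hx'⟩ := hψself j
    refine ⟨c.symm x, hcpres' j x hx, ?_⟩
    rw [hφx, c.apply_symm_apply]
    exact hapres' j _ hx'
  have hcross : ∀ i j, (closure (A i).carrier ∩ closure (A j).carrier).Nonempty →
      ∃ x ∈ closure (A i).carrier ∩ closure (A j).carrier, ∃ l, φ x ∈ (A l).carrier := by
    intro i j hij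
    rcases eq_or_ne i j with rfl | hne'
    · obtain ⟨x, hx, hx'⟩ := hself i
      exact ⟨x, ⟨subset_closure hx, subset_closure hx⟩, i, hx'⟩
    · obtain ⟨x, hx, l, hl⟩ := hψcross i j hij
      refine ⟨x, hx, l, ?_⟩
      -- A point in the closures of two different domains lies in no domain, since the domains are
      -- open and disjoint; hence `c` fixes it.
      have hxM : ∀ k, x ∉ (A k).carrier := by
        intro k hk
        have h1 : ∀ i, x ∈ closure (A i).carrier → k = i := by
          intro i hi
          by_contra hki
          obtain ⟨y, hyk, hyi⟩ := mem_closure_iff.1 hi _ (A k).isOpen_carrier hk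
          exact disjoint_left.1 (hdisj k i hki) hyk hyi
        exact hne' ((h1 i hx.1).symm.trans (h1 j hx.2))
      rw [hφx, hcfix x hxM]
      exact hapres' l _ hl
  refine ⟨φ, ?_, ?_, ?_, ?_, ?_, ?_⟩
  · exact (ha'.symp.comp hψ.symp (contMDiff_mdifferentiable ha'.contMDiff)
      (contMDiff_mdifferentiable hψ.contMDiff)).comp hc.symp
      (contMDiff_mdifferentiable (ha'.contMDiff.comp hψ.contMDiff))
      (contMDiff_mdifferentiable hc.contMDiff)
  · exact (hc'.symp.comp hψ'.symp (contMDiff_mdifferentiable hc'.contMDiff)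
      (contMDiff_mdifferentiable hψ'.contMDiff)).comp ha.symp
      (contMDiff_mdifferentiable (hc'.contMDiff.comp hψ'.contMDiff))
      (contMDiff_mdifferentiable ha.contMDiff)
  · exact hconj a.symm ψ c a ψ.symm c.symm ha'.contMDiff hψ.contMDiff hc.contMDiff ha.contMDiff hψ'.contMDiff
      hc'.contMDiff ha'.contains hψ.contains hc.contains ha.contains hψ'.contains hc'.contains
  · intro x v
    have := tangentLength_comp_le g (ha'.contMDiff.comp hψ.contMDiff) hc.contMDiff (by norm_num)
      (tangentLength_comp_le g ha'.contMDiff hψ.contMDiff zero_le_two ha'.length_le hψ.length_le)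
      hc.length_le x v
    norm_num at this
    exact this
  · intro x v
    have := tangentLength_comp_le g (hc'.contMDiff.comp hψ'.contMDiff) ha.contMDiff (by norm_num)
      (tangentLength_comp_le g hc'.contMDiff hψ'.contMDiff zero_le_two hc'.length_le hψ'.length_le)
      ha.length_le x v
    norm_num at this
    exact this
  · intro d d' hd hd' V hV hVne
    set G : Fin 2 → N → N := ![⇑(T.toEquiv ^ d : Equiv.Perm N),
      ⇑((conjDiffeo φ T).toEquiv ^ d' : Equiv.Perm N)] with hG
    obtain ⟨e₁, he₁⟩ := exists_homeomorph_zpow T.toHomeomorph d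
    obtain ⟨e₂, he₂⟩ := exists_homeomorph_zpow (conjDiffeo φ T).toHomeomorph d'
    have hGc : ∀ i, Continuous (G i) := by
      intro i
      fin_cases i
      · change Continuous ⇑(T.toEquiv ^ d : Equiv.Perm N)
        exact he₁ ▸ e₁.continuous
      · change Continuous ⇑((conjDiffeo φ T).toEquiv ^ d' : Equiv.Perm N)
        exact he₂ ▸ e₂.continuous
    set Q := hitting G V with hQ
    have hQo : IsOpen Q := isOpen_hitting hGc hV
    have hsub := SymplecticIFS.IsOpen.subset_conullInterior (m := 2 * n) hQo
    have hQne : Q.Nonempty := by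
      obtain ⟨y, hy⟩ := hVne
      refine ⟨(T.toEquiv ^ d : Equiv.Perm N).symm y, mem_hitting.2 ⟨fun _ => 0, 0, ?_⟩⟩
      change (T.toEquiv ^ d : Equiv.Perm N) ((T.toEquiv ^ d : Equiv.Perm N).symm y) ∈ V
      rwa [Equiv.apply_symm_apply]
    have hsat : ∀ i, (A i).Saturated (conullInterior (2 * n) Q) := by
      intro i I hI θ θ' h
      obtain ⟨α, hα, hαT⟩ := hrot i
      refine (A i).conullInterior_saturated hr hα hQo (c := d) (by exact_mod_cast hd)
        (fun J hJ τ hτ => ?_) hI h θ'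
      refine mem_hitting_of_apply 0 ?_
      change (T.toEquiv ^ d : Equiv.Perm N) _ ∈ _
      rwa [zpow_param (A := A i) (fun τ => hαT J hJ τ)]
    -- In the coordinates pulled back by `φ`, the power of the conjugate acts as the power of `T`,
    -- so the same saturation argument applies with the exponent `d'`.
    have hsat' : ∀ i, (A i).Saturated (φ ⁻¹' conullInterior (2 * n) Q) := by
      intro i I hI θ θ' h
      rw [preimage_conullInterior] at h ⊢
      obtain ⟨α, hα, hαT⟩ := hrot i
      refine (A i).conullInterior_saturated hr hα (hQo.preimage φ.continuous) (c := d')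
        (by exact_mod_cast hd') (fun J hJ τ hτ => ?_) hI h θ'
      refine mem_hitting_of_apply 1 ?_
      change ((conjDiffeo φ T).toEquiv ^ d' : Equiv.Perm N) (φ _) ∈ _
      rw [semiconj_zpow (F := φ) (e₁ := T.toEquiv) (fun x => by
        change φ (T (φ.symm (φ x))) = φ (T x)
        rw [φ.symm_apply_apply]), zpow_param (A := A i) (fun τ => hαT J hJ τ)]
      exact hτ
    have key := carrier_subset_of_saturated A φ.toHomeomorph hcl hlf hcgood hmeet hself hcross
      (isOpen_conullInterior Q) (hQne.mono hsub) hsat hsat'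
    refine ((isLebesgueNull_conullInterior_diff (m := 2 * n) Q).union
      (IsLebesgueNull.iUnion fun k => (hL k).isLebesgueNull)).mono fun x hx => ?_
    by_cases hxU : x ∈ ⋃ i, (A i).carrier
    · exact Or.inl ⟨key hxU, hx⟩
    · exact Or.inr (hcov hxU)

lemma dense_of_isLebesgueNull_compl {Q : Set N} (h : IsLebesgueNull (m := 2 * n) Qᶜ) : Dense Q := by
  rw [← compl_compl Q, ← interior_eq_empty_iff_dense_compl]
  exact (h.mono interior_subset).eq_empty_of_isOpen isOpen_interior

end Main

/-- Charts into a point have singleton domains, so the space is discrete as well as connected. -/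
lemma subsingleton_of_dim_zero {N : Type*} [TopologicalSpace N] [ConnectedSpace N]
    [ChartedSpace (Euc (2 * 0)) N] : Subsingleton N := by
  have hE : Subsingleton (Euc (2 * 0)) := by
    rw [Nat.mul_zero]
    infer_instance
  have : DiscreteTopology N := by
    rw [discreteTopology_iff_isOpen_singleton]
    intro x
    have h : (chartAt (Euc (2 * 0)) x).source = {x} := by
      refine eq_singleton_iff_unique_mem.2 ⟨mem_chart_source _ x, fun y hy => ?_⟩
      exact (chartAt (Euc (2 * 0)) x).injOn hy (mem_chart_source _ x) (Subsingleton.elim _ _)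
    rw [← h]
    exact (chartAt (Euc (2 * 0)) x).open_source
  exact PreconnectedSpace.trivial_of_discrete

end SymplecticIFS
end

theorem mainTheorem10 (n : ℕ) {N : Type*} [TopologicalSpace N] [T2Space N]
    [SecondCountableTopology N] [ConnectedSpace N]
    [ChartedSpace (SymplecticIFS.Euc (2 * n)) N] [IsManifold (𝓡 (2 * n)) ∞ N]
    (g : Bundle.ContinuousRiemannianMetric (SymplecticIFS.Euc (2 * n))
      (fun x : N => TangentSpace (𝓡 (2 * n)) x))
    (Ω : SymplecticIFS.SymplecticForm n N) (r : ℕ∞) (hr : 1 ≤ r)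
    (T₁ : N ≃ₘ^r⟮𝓡 (2 * n), 𝓡 (2 * n)⟯ N)
    (hT₁ : SymplecticIFS.IsSymplectic Ω T₁) (hint : SymplecticIFS.IsIntegrable Ω r T₁)
    (W : SymplecticIFS.StrongNhdData (2 * n) N r) (hW : W.IsAt T₁) :
    ∃ (T₂ : N ≃ₘ^r⟮𝓡 (2 * n), 𝓡 (2 * n)⟯ N) (φ : N ≃ₘ^∞⟮𝓡 (2 * n), 𝓡 (2 * n)⟯ N),
      W.Contains T₁ T₂ ∧
      SymplecticIFS.IsSymplectic Ω T₂ ∧ SymplecticIFS.IsIntegrable Ω r T₂ ∧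
      (∀ δ : ℝ, SymplecticIFS.IsBunched g δ T₁ → SymplecticIFS.IsBunched g δ T₂) ∧
      SymplecticIFS.IsSymplectic Ω φ ∧ (∀ x, T₂ (φ x) = φ (T₁ x)) ∧
      ∀ d d' : ℤ, d ≠ 0 → d' ≠ 0 →
        (∃ (x : N) (σ : ℕ → Fin 2), Dense (SymplecticIFS.branchOrbit
          ![⇑(T₁.toEquiv ^ d : Equiv.Perm N), ⇑(T₂.toEquiv ^ d' : Equiv.Perm N)] σ x)) ∧
        SymplecticIFS.IsLebesgueNull (m := 2 * n) {x : N | ¬ Dense (SymplecticIFS.ifsOrbit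
          ![⇑(T₁.toEquiv ^ d : Equiv.Perm N), ⇑(T₂.toEquiv ^ d' : Equiv.Perm N)] x)} := by
  open SymplecticIFS in
  rcases Nat.eq_zero_or_pos n with rfl | hn
  -- Dimension zero is separate: the twists need an angle coordinate, and a one-point space needs no
  -- perturbation.
  · have hN : Subsingleton N := subsingleton_of_dim_zero
    have hdense : ∀ (S : Set N), S.Nonempty → Dense S := fun S hS =>
      (Subsingleton.eq_univ_of_nonempty hS).symm ▸ dense_univ
    refine ⟨T₁, Diffeomorph.refl _ _ _, fun k => ⟨hW k, fun j _ x _ => ?_⟩, hT₁, hint,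
      fun δ h => h, ?_, fun x => rfl, fun d d' _ _ => ⟨?_, ?_⟩⟩
    · rw [sub_self, norm_zero]
      exact W.ε_pos k
    · refine (isSymplectic_iff Ω).2 fun x u v => ?_
      have h : tmap (m := 2 * 0) (Diffeomorph.refl (𝓡 (2 * 0)) N ∞) x =
          ContinuousLinearMap.id ℝ (Euc (2 * 0)) := tmap_id x
      rw [h]
      rfl
    · exact ⟨Classical.arbitrary N, fun _ => 0, hdense _ (range_nonempty _)⟩
    · have hnull : ∀ S : Set N, S = ∅ → IsLebesgueNull (m := 2 * 0) S := by
        rintro _ rfl e -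
        simp
      refine hnull _ (eq_empty_of_forall_notMem fun x hx => hx (hdense _ ?_))
      exact ⟨_, mem_ifsOrbit.2 ⟨fun _ => 0, 0, rfl⟩⟩
  · obtain ⟨φ, hφ, hφ', hcont, hlen, hlen', hnull⟩ :=
      exists_conjugation (Ω := Ω) hn g hr T₁ hint W hW
    have hloc : LocallyCompactSpace N := ChartedSpace.locallyCompactSpace (Euc (2 * n)) N
    have hr' : MDifferentiable (𝓡 (2 * n)) (𝓡 (2 * n)) T₁ := T₁.contMDiff.mdifferentiable (by
      have : (1 : WithTop ℕ∞) ≤ r := by exact_mod_cast hr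
      exact (zero_lt_one.trans_le this).ne')
    have hdφ := contMDiff_mdifferentiable φ.contMDiff
    have hdφ' := contMDiff_mdifferentiable φ.symm.contMDiff
    refine ⟨conjDiffeo φ T₁, φ, hcont,
      hφ.comp (hT₁.comp hφ' hr' hdφ') hdφ (hr'.comp hdφ'), hint.conj φ T₁ hφ,
      fun δ => IsBunched.conj φ T₁ g hr (by norm_num : (0 : ℝ) < 8) hlen hlen', hφ, fun x => ?_,
      fun d d' hd hd' => ⟨?_, ?_⟩⟩
    · change φ (T₁ (φ.symm (φ x))) = φ (T₁ x)
      rw [φ.symm_apply_apply]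
    · obtain ⟨e₁, he₁⟩ := exists_homeomorph_zpow T₁.toHomeomorph d
      obtain ⟨e₂, he₂⟩ := exists_homeomorph_zpow (conjDiffeo φ T₁).toHomeomorph d'
      -- A set with null complement is dense, which is all that the Baire argument requires of the
      -- hitting sets.
      refine exists_dense_branchOrbit (fun i => ?_) (fun i => ?_) fun V hV hVne =>
        dense_of_isLebesgueNull_compl (hnull d d' hd hd' V hV hVne)
      · fin_cases i
        · change Continuous ⇑(T₁.toEquiv ^ d : Equiv.Perm N)
          exact he₁ ▸ e₁.continuous
        · change Continuous ⇑((conjDiffeo φ T₁).toEquiv ^ d' : Equiv.Perm N)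
          exact he₂ ▸ e₂.continuous
      · fin_cases i
        · change IsOpenMap ⇑(T₁.toEquiv ^ d : Equiv.Perm N)
          exact he₁ ▸ e₁.isOpenMap
        · change IsOpenMap ⇑((conjDiffeo φ T₁).toEquiv ^ d' : Equiv.Perm N)
          exact he₂ ▸ e₂.isOpenMap
    · obtain ⟨b, hbc, hb0, hb⟩ := TopologicalSpace.exists_countable_basis N
      have : Countable b := hbc.to_subtype
      -- A point hitting every set of a countable basis has a dense orbit set, so the exceptional
      -- points lie in a countable union of null sets.
      refine (IsLebesgueNull.iUnion fun V : b => hnull d d' hd hd' V (hb.isOpen V.2)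
        (nonempty_iff_ne_empty.2 fun h0 => hb0 (h0 ▸ V.2))).mono fun x hx => ?_
      by_contra hcon
      refine hx (hb.dense_iff.2 fun V hV _ => ?_)
      have h1 : x ∈ hitting ![⇑(T₁.toEquiv ^ d : Equiv.Perm N), ⇑((conjDiffeo φ T₁).toEquiv ^ d' : Equiv.Perm N)] V := by
        by_contra h2
        exact hcon (mem_iUnion.2 ⟨⟨V, hV⟩, h2⟩)
      obtain ⟨y, hy, hyV⟩ := h1
      exact ⟨y, hyV, hy⟩
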